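/- **Notation.** Let $\varepsilon_0,\dots,\varepsilon_7$ be the standard basis of Euclidean space $\mathbb R^8$. For $0\le i\ne j\le 7$ put $\mathbf v_{i,j}=4(\varepsilon_i+\varepsilon_j)-\sum_{k=0}^7\varepsilon_k$, and let $\Psi=\{\pm\mathbf v_{i,j}:0\le i<j\le 7\}$. Let $\alpha_i=4(\varepsilon_i-\varepsilon_{i+1})$ for $1\le i\le 6$ and $\alpha_7=(-2,-2,-2,-2,2,2,2,2)$. With respect to the matrix $\left(2\,\alpha_i\cdot\alpha_j/\alpha_i\cdot\alpha_i\right)$, the set $\Delta'=\{\alpha_1,\dots,\alpha_7\}$ is a simple system of type $E_7$, and $\Delta'\setminus\{\alpha_6\}$ is one of type $E_6$. For $l=\pm 8$ put $\Psi_l=\{\mathbf v\in\Psi:\mathbf v\cdot\mathbf v_{0,7}=l\}$, so that $\Psi_{-8}=-\Psi_8$. For $\Omega\in\{\Psi,\Psi_8,\Psi_{-8}\}$ let $V_\Omega$ be the complex vector space with basis $\{b_{\mathbf v}:\mathbf v\in\Omega\}$, and for a simple root $\mathbf a$ define operators on $V_\Omega$ by $E_{\mathbf a}b_{\mathbf v}=b_{\mathbf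 v+\mathbf a}$ (or $0$ if $\mathbf v+\mathbf a\notin\Omega$), $F_{\mathbf a}b_{\mathbf v}=b_{\mathbf v-\mathbf a}$ (or $0$ if $\mathbf v-\mathbf a\notin\Omega$), $H_{\mathbf a}b_{\mathbf v}=2\frac{\mathbf v\cdot\mathbf a}{\mathbf a\cdot\mathbf a}b_{\mathbf v}$. Let $\mathfrak e_7$, $\mathfrak e_6$ be the complex simple Lie algebras of types $E_7$, $E_6$ with Serre generators $e_i,f_i,h_i$. For $r\in\{6,7\}$ let $P_1,\dots,P_r\in\mathbb P^2(\mathbb C)$ be distinct points, no three on a line and no six on a conic, and let $X$ be the blow-up of $\mathbb P^2$ at these points, a del Pezzo surface of degree $9-r$. The *lines* on $X$ are the irreducible curves $L$ with $L^2=-1$ and $K_X\cdot L=-1$; two distinct lines are *skew* if they are disjoint. **Proposition.** (a) $V_\Psi$ has dimension $56$, and there is exactly one representation of $\mathfrak e_7$ on it in which $e_i,f_i,h_i$ act as $E_{\alpha_i},F_{\alpha_i},H_{\alpha_i}$ $(1\le i\le 7)$. For all $x\in\mathfrak e_7$ and $\mathbf v\in\Psi$, $$x.b_{\mathbf v}=\sum_{\mathbf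 u\in\Psi''}\lambda_{\mathbf u}b_{\mathbf u},\qquad \Psi''=\{\mathbf v\}\cup\{\mathbf u\in\Psi:|\mathbf v-\mathbf u|=\sqrt{32}\},$$ for some scalars $\lambda_{\mathbf u}\in\mathbb C$. Moreover, for every $X$ as above with $r=7$ there is a bijection from $\Psi$ to the set of lines on $X$ under which (for $1\le i\ne j\le 7$) $\mathbf v_{0,i}$ corresponds to the exceptional curve over $P_i$, $-\mathbf v_{i,j}$ to the strict transform of the line through $P_i,P_j$, $\mathbf v_{i,j}$ to that of the conic through the five points other than $P_i,P_j$, and $-\mathbf v_{0,i}$ to that of the cubic through all seven points with a double point at $P_i$; if $|\mathbf v-\mathbf u|=\sqrt{32}$, then the lines corresponding to $\mathbf u$ and $\mathbf v$ are skew. Hence if $b_{\mathbf u}$ has a non-zero coefficient in $x.b_{\mathbf v}$ for some $x\in\mathfrak e_7$, then either $\mathbf u=\mathbf v$ or the lines on $X$ corresponding to $\mathbf u$ and $\mathbf v$ are skew. (b) Let $l\in\{8,-8\}$. Then $V_{\Psi_l}$ has dimension $27$, and there is exactly one representation of $\mathfrak e_6$ on it in which the Serre generators act as $E_{\mathbf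 a},F_{\mathbf a},H_{\mathbf a}$, $\mathbf a\in\Delta'\setminus\{\alpha_6\}$. For all $x\in\mathfrak e_6$ and $\mathbf v\in\Psi_l$, $x.b_{\mathbf v}$ is a linear combination of $b_{\mathbf v}$ and the $b_{\mathbf u}$ with $\mathbf u\in\Psi_l$, $|\mathbf v-\mathbf u|=\sqrt{32}$. Moreover, for every $X$ as above with $r=6$ there is a bijection from $\Psi_l$ to the set of lines on $X$, given for $l=8$ (and $1\le i\ne j\le 6$) by letting $\mathbf v_{0,i}$ correspond to the exceptional curve over $P_i$, $-\mathbf v_{i,j}$ to the strict transform of the line through $P_i,P_j$, and $\mathbf v_{i,7}$ to that of the conic through the five points other than $P_i$, and for $l=-8$ by composing this with $\mathbf v\mapsto-\mathbf v$; if $|\mathbf v-\mathbf u|=\sqrt{32}$, then the lines corresponding to $\mathbf u$ and $\mathbf v$ are skew. Hence if $b_{\mathbf u}$ has a non-zero coefficient in $x.b_{\mathbf v}$ for some $x\in\mathfrak e_6$, then either $\mathbf u=\mathbf v$ or the lines on $X$ corresponding to $\mathbf u$ and $\mathbf v$ are skew. -/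

import Mathlib

open scoped LinearAlgebra.Projectivization

-- the commutator bracket on `Module.End`
attribute [local instance 100] LieRing.ofAssociativeRing

noncomputable section

/-! ### The module attached to a set of weights -/

section Operators

variable {n : ℕ} (Ψ : Set (EuclideanSpace ℝ (Fin n))) (a : EuclideanSpace ℝ (Fin n))

/-- The complex vector space with basis `b v`, `v ∈ Ψ`. -/
abbrev WeightSpace : Type := Ψ →₀ ℂ

/-- The basis vector `b v`. -/
abbrev basisVec {Ψ : Set (EuclideanSpace ℝ (Fin n))} (v : Ψ) : WeightSpace Ψ :=
  Finsupp.single v 1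

open Classical in
/-- `E_a (b v) = b (v + a)` if `v + a ∈ Ψ`, and `0` otherwise. -/
def opE : Module.End ℂ (WeightSpace Ψ) :=
  Finsupp.linearCombination ℂ fun v : Ψ =>
    if h : (v : EuclideanSpace ℝ (Fin n)) + a ∈ Ψ then basisVec ⟨v + a, h⟩ else 0

open Classical in
/-- `F_a (b v) = b (v - a)` if `v - a ∈ Ψ`, and `0` otherwise. -/
def opF : Module.End ℂ (WeightSpace Ψ) :=
  Finsupp.linearCombination ℂ fun v : Ψ =>
    if h : (v : EuclideanSpace ℝ (Fin n)) - a ∈ Ψ then basisVec ⟨v - a, h⟩ else 0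

/-- `H_a (b v) = (2 (v . a) / (a . a)) b v`. -/
def opH : Module.End ℂ (WeightSpace Ψ) :=
  Finsupp.linearCombination ℂ fun v : Ψ =>
    ((2 * inner ℝ (v : EuclideanSpace ℝ (Fin n)) a / inner ℝ a a : ℝ) : ℂ) • basisVec v

end Operators

/-- The image of a Serre generator in the Lie algebra over `ℂ` with Cartan matrix `A`. -/
def serreGen {B : Type} [DecidableEq B] (A : Matrix B B ℤ) (g : CartanMatrix.Generators B) :
    A.ToLieAlgebra ℂ :=
  (LieSubmodule.Quotient.mk (FreeLieAlgebra.of ℂ g) :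
    FreeLieAlgebra ℂ (CartanMatrix.Generators B) ⧸ CartanMatrix.Relations.toIdeal ℂ A)

/-- `ρ` is the representation on `WeightSpace Ψ` in which the Serre generators
`e_i`, `f_i`, `h_i` act by the operators `E_a`, `F_a`, `H_a` with `a = α i`. -/
def IsWeightRep {B : Type} [DecidableEq B] (A : Matrix B B ℤ) {n : ℕ}
    (Ψ : Set (EuclideanSpace ℝ (Fin n))) (α : B → EuclideanSpace ℝ (Fin n))
    (ρ : A.ToLieAlgebra ℂ →ₗ⁅ℂ⁆ Module.End ℂ (WeightSpace Ψ)) : Prop :=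
  ∀ i, ρ (serreGen A (.E i)) = opE Ψ (α i) ∧ ρ (serreGen A (.F i)) = opF Ψ (α i) ∧
    ρ (serreGen A (.H i)) = opH Ψ (α i)

/-! ### The vertices of the Hesse and Schläfli polytopes -/

/-- `v_{i,j} = 4 (ε_i + ε_j) - ∑ ε_k` in `ℝ^8`. -/
def vertex (i j : Fin 8) : EuclideanSpace ℝ (Fin 8) :=
  (4 : ℝ) • (EuclideanSpace.single i 1 + EuclideanSpace.single j 1) -
    ∑ k, EuclideanSpace.single k 1

/-- The 56 vectors `± v_{i,j}`, `0 ≤ i < j ≤ 7`. -/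
def psiE7 : Set (EuclideanSpace ℝ (Fin 8)) :=
  {v | ∃ i j : Fin 8, i < j ∧ (v = vertex i j ∨ v = -vertex i j)}

/-- The subset of `psiE7` of vectors with scalar product `l` with `v_{0,7}`. -/
def psiE6 (l : ℝ) : Set (EuclideanSpace ℝ (Fin 8)) :=
  {v | v ∈ psiE7 ∧ inner ℝ v (vertex 0 7) = l}

/-- `α_i = 4 (ε_i - ε_{i+1})` for `i < 7`. -/
def chainRoot (i : Fin 7) : EuclideanSpace ℝ (Fin 8) :=
  (4 : ℝ) • (EuclideanSpace.single i.castSucc 1 - EuclideanSpace.single i.succ 1)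

/-- `α_7 = (-2, -2, -2, -2, 2, 2, 2, 2)`. -/
def lastRoot : EuclideanSpace ℝ (Fin 8) := !₂[-2, -2, -2, -2, 2, 2, 2, 2]

/-- The simple roots `α_1, …, α_7`, in the order in which their Cartan matrix is Mathlib's
(Bourbaki's) matrix of type `E₇`: the chain is `α_1, …, α_6`, and `α_7` is attached to `α_3`. -/
def rootE7 : Fin 7 → EuclideanSpace ℝ (Fin 8) :=
  ![chainRoot 1, lastRoot, chainRoot 2, chainRoot 3, chainRoot 4, chainRoot 5, chainRoot 6]

/-- The simple roots `α_1, …, α_5, α_7` of type `E₆`, in Bourbaki's order. -/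
def rootE6 : Fin 6 → EuclideanSpace ℝ (Fin 8) :=
  ![chainRoot 1, lastRoot, chainRoot 2, chainRoot 3, chainRoot 4, chainRoot 5]

/-! ### Del Pezzo surfaces of degree 2 and 3 as blow-ups of the plane, and their lines -/

/-- The complex projective plane. A point `[a]` also stands for the line `a . x = 0`. -/
abbrev Plane : Type := ℙ ℂ (Fin 3 → ℂ)

/-- No three of the points are collinear, and no six of them lie on a conic. For `r = 6, 7` the
blow-up of the plane in such points is a del Pezzo surface of degree `9 - r`. -/
structure GeneralPosition {r : ℕ} (P : Fin r → Plane) : Prop where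
  injective : Function.Injective P
  not_collinear : ∀ i j k, i ≠ j → i ≠ k → j ≠ k →
    ¬ ∃ a : Plane, (P i).orthogonal a ∧ (P j).orthogonal a ∧ (P k).orthogonal a
  not_on_conic : ∀ s : Finset (Fin r), s.card = 6 →
    ¬ ∃ Q : MvPolynomial (Fin 3) ℂ, Q ≠ 0 ∧ Q.IsHomogeneous 2 ∧
      ∀ i ∈ s, MvPolynomial.eval (P i).rep Q = 0

/-- The blow-up of the plane in the (distinct) points `P i`: the points `(x, (ℓ_i))`, where
`ℓ_i` is a line through `x` and `P i`. -/
def BlowUp {r : ℕ} (P : Fin r → Plane) : Type :=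
  {y : Plane × (Fin r → Plane) // ∀ i, (P i).orthogonal (y.2 i) ∧ y.1.orthogonal (y.2 i)}

/-- The polynomial `F (p + t w)` in `t`. -/
def restrictLine (F : MvPolynomial (Fin 3) ℂ) (p w : Fin 3 → ℂ) : Polynomial ℂ :=
  MvPolynomial.aeval (fun k => Polynomial.C (p k) + Polynomial.C (w k) * Polynomial.X) F

/-- The multiplicity at `p` of the plane curve `F = 0`: the least order in `t` of
`F (p + t w)`, over all directions `w`. -/
def curveMult (F : MvPolynomial (Fin 3) ℂ) (p : Plane) : ℕ :=
  sInf {m | ∃ w, (restrictLine F p.rep w).coeff m ≠ 0}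

/-- The exceptional curve over `P i`. -/
def exceptionalCurve {r : ℕ} (P : Fin r → Plane) (i : Fin r) : Set (BlowUp P) :=
  {y | y.1.1 = P i}

/-- The strict transform of the plane curve `F = 0`. Over `P i`, where the curve has multiplicity
`m`, it consists of the tangent directions `w` of the curve, i.e. the zeros of
`(F (p + t w) / t ^ m)` at `t = 0`. -/
def strictTransform {r : ℕ} (P : Fin r → Plane) (F : MvPolynomial (Fin 3) ℂ) :
    Set (BlowUp P) :=
  {y | MvPolynomial.eval y.1.1.rep F = 0 ∧
    ∀ i, y.1.1 = P i → ∀ w : Fin 3 → ℂ, w ⬝ᵥ (y.1.2 i).rep = 0 →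
      (restrictLine F (P i).rep w).coeff (curveMult F (P i)) = 0}

/-- The divisor class `deg • l - ∑ i, mult i • e i` on the blow-up in `r` points, where `l` is
the pull-back of the class of a line and `e i` the class of the `i`-th exceptional curve. -/
structure DivClass (r : ℕ) where
  deg : ℤ
  mult : Fin r → ℤ

/-- The intersection number: `l ^ 2 = 1`, `e_i ^ 2 = -1`, and all other products are `0`. -/
def DivClass.inter {r : ℕ} (D D' : DivClass r) : ℤ :=
  D.deg * D'.deg - ∑ i, D.mult i * D'.mult i

/-- The canonical class `-3 l + ∑ e_i`. -/
def canonicalClass (r : ℕ) : DivClass r := ⟨-3, fun _ => -1⟩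

/-- `IsCurve P C D`: `C` is an irreducible curve on the blow-up, and `D` is its class. Such a curve
is one of the exceptional curves or the strict transform of an irreducible plane curve. -/
inductive IsCurve {r : ℕ} (P : Fin r → Plane) : Set (BlowUp P) → DivClass r → Prop
  | exceptional (i : Fin r) :
      IsCurve P (exceptionalCurve P i) ⟨0, fun k => if k = i then -1 else 0⟩
  | strict (F : MvPolynomial (Fin 3) ℂ) (d : ℕ) (hF : Irreducible F) (hd : F.IsHomogeneous d) :
      IsCurve P (strictTransform P F) ⟨d, fun k => curveMult F (P k)⟩

/-- The lines on a del Pezzo surface: the irreducible curves `L` with `L ^ 2 = -1` and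
`-K . L = 1`. -/
def IsLine {r : ℕ} (P : Fin r → Plane) (L : Set (BlowUp P)) : Prop :=
  ∃ D, IsCurve P L D ∧ D.inter D = -1 ∧ (canonicalClass r).inter D = -1

/-- The class of the line on the degree 2 del Pezzo surface that corresponds to an element of
`psiE7` (the blown-up points being numbered from 1 to 7): `v_{0,i}` corresponds to the exceptional
curve over `P_i`, `-v_{i,j}` to the line through `P_i` and `P_j`, `v_{i,j}` to the conic through
the five points other than `P_i` and `P_j`, and `-v_{0,i}` to the cubic through all seven
points which is singular at `P_i`. -/
inductive LineClass7 : EuclideanSpace ℝ (Fin 8) → DivClass 7 → Prop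
  | exceptional (i : Fin 7) :
      LineClass7 (vertex 0 i.succ) ⟨0, fun k => if k = i then -1 else 0⟩
  | line (i j : Fin 7) (h : i ≠ j) :
      LineClass7 (-vertex i.succ j.succ) ⟨1, fun k => if k = i ∨ k = j then 1 else 0⟩
  | conic (i j : Fin 7) (h : i ≠ j) :
      LineClass7 (vertex i.succ j.succ) ⟨2, fun k => if k = i ∨ k = j then 0 else 1⟩
  | cubic (i : Fin 7) :
      LineClass7 (-vertex 0 i.succ) ⟨3, fun k => if k = i then 2 else 1⟩

/-- The class of the line on the degree 3 del Pezzo surface that corresponds to an element of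
`psiE6 8` (the blown-up points being numbered from 1 to 6): `v_{0,i}` corresponds to the exceptional
curve over `P_i`, `-v_{i,j}` to the line through `P_i` and `P_j`, and `v_{i,7}` to the conic
through the five points other than `P_i`. -/
inductive LineClass6 : EuclideanSpace ℝ (Fin 8) → DivClass 6 → Prop
  | exceptional (i : Fin 6) :
      LineClass6 (vertex 0 i.castSucc.succ) ⟨0, fun k => if k = i then -1 else 0⟩
  | line (i j : Fin 6) (h : i ≠ j) :
      LineClass6 (-vertex i.castSucc.succ j.castSucc.succ)
        ⟨1, fun k => if k = i ∨ k = j then 1 else 0⟩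
  | conic (i : Fin 6) :
      LineClass6 (vertex i.castSucc.succ 7) ⟨2, fun k => if k = i then 0 else 1⟩

end

/-! Two independent arguments, one on representations and one on curves, meet in a single numerical
identity.

Representations. All simple roots have squared length 32, and every weight has scalar product -16, 0
or 16 with each of them; the value decides whether the neighbours along the root are weights
(`IsMinuscule`, a finite check). The Serre relations thereby become statements about single weights,
and the presentation by generators gives existence and uniqueness
(`IsMinuscule.existsUnique_isWeightRep`). Suppose now that `b u` occurs in `x . b w`. By the
triangular decomposition, `u - w` is a combination of simple roots whose coefficients do not have
mixed signs (`IsWeightRep.le_or_le`). The image of the representation is stable under conjugation by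
`(1 + E)(1 - F)(1 + E)`, which permutes the basis, up to signs, as a simple reflection does; so the
reflected pair of weights also occurs. Reflections that shrink the coefficients of `u - w` lead to
zero or to plus or minus a simple root, and they preserve length. Hence the squared length of `u -
w` is 0 or 32 (`IsMinuscule.norm_sub_sq_of_ne_zero`), without any knowledge of the roots of the
presented Lie algebra.

Curves. By Cauchy–Schwarz, a class with self-intersection -1 and product -1 with the canonical class
has degree at most 3, and the possibilities are those of `LineShape`. Counting conditions gives a
curve in each class; general position makes it irreducible with the exact multiplicities. Apart from
the exceptional curves, a curve in such a class has degree `n + 1` and a point of multiplicity `n`,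
so projection from this point parametrizes it rationally. Substituting the parametrization into a
second curve and counting zeros gives Bézout's inequality, and in case of equality no common point
is left on the blow-up (`sum_curveMult_mul_le`). Therefore a line is the only irreducible curve in
its class, and lines with intersection number 0 are skew.

The link. The coordinates of a weight `v` are affine functions of the class `D` of its line, whence
`v . v' = 8 - 16 D . D'` (`LineClass7.inter_eq_zero` draws the conclusion): distance `√32` means `D
. D' = 0`. Since `v_{0,7}` belongs to the exceptional curve over the seventh point, the slice `l =
8` consists of the classes with multiplicity 0 there, that is, of those pulled back from six points.
The slice `l = -8` is its negative. -/

noncomputable section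

/-! ### Expansion of a form along a line -/

section LineExpand

open MvPolynomial

variable {A : Type*} [CommRing A] [Algebra ℂ A] {B : Type*} [CommRing B] [Algebra ℂ B]

/-- The polynomial `F (x + t y)` in `t`, for vectors `x`, `y` over a commutative `ℂ`-algebra. -/
def lineExpand (F : MvPolynomial (Fin 3) ℂ) (x y : Fin 3 → A) : Polynomial A :=
  aeval (fun k => Polynomial.C (x k) + Polynomial.C (y k) * Polynomial.X) F

lemma restrictLine_eq_lineExpand (F : MvPolynomial (Fin 3) ℂ) (x y : Fin 3 → ℂ) :
    restrictLine F x y = lineExpand F x y := rfl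

lemma lineExpand_mul (F G : MvPolynomial (Fin 3) ℂ) (x y : Fin 3 → A) :
    lineExpand (F * G) x y = lineExpand F x y * lineExpand G x y := map_mul _ _ _

lemma eval_lineExpand (F : MvPolynomial (Fin 3) ℂ) (x y : Fin 3 → A) (u : A) :
    (lineExpand F x y).eval u = aeval (x + u • y) F := by
  induction F using MvPolynomial.induction_on with
  | C c => simp [lineExpand, Polynomial.algebraMap_apply]
  | add F G hF hG => simp_all [lineExpand]
  | mul_X F i hF => simp_all [lineExpand, mul_comm u]

lemma eval_lineExpand_complex (F : MvPolynomial (Fin 3) ℂ) (x y : Fin 3 → ℂ) (u : ℂ) :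
    (lineExpand F x y).eval u = eval (x + u • y) F :=
  eval_lineExpand F x y u

lemma lineExpand_map (F : MvPolynomial (Fin 3) ℂ) (x y : Fin 3 → A) (f : A →ₐ[ℂ] B) :
    (lineExpand F x y).map (f : A →+* B) = lineExpand F (f ∘ x) (f ∘ y) := by
  induction F using MvPolynomial.induction_on with
  | C c => simp [lineExpand, Polynomial.algebraMap_apply]
  | add F G hF hG => simp_all [lineExpand]
  | mul_X F i hF => simp_all [lineExpand]

lemma map_coeff_lineExpand (F : MvPolynomial (Fin 3) ℂ) (x y : Fin 3 → A) (f : A →ₐ[ℂ] B)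
    (k : ℕ) : f ((lineExpand F x y).coeff k) = (lineExpand F (f ∘ x) (f ∘ y)).coeff k := by
  rw [← lineExpand_map, Polynomial.coeff_map]; rfl

lemma eval_smul_of_isHomogeneous {F : MvPolynomial (Fin 3) ℂ} {d : ℕ} (hF : F.IsHomogeneous d)
    (c : ℂ) (x : Fin 3 → ℂ) : eval (c • x) F = c ^ d * eval x F := by
  rw [eval_eq, eval_eq, Finset.mul_sum]
  refine Finset.sum_congr rfl fun e he => ?_
  have := hF.degree_eq_sum_deg_support he
  simp only [Pi.smul_apply, smul_eq_mul, mul_pow, Finset.prod_mul_distrib]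
  rw [Finset.prod_pow_eq_pow_sum, ← this]
  ring

lemma natDegree_lineExpand_le {F : MvPolynomial (Fin 3) ℂ} {d : ℕ} (hF : F.IsHomogeneous d)
    (x y : Fin 3 → ℂ) : (lineExpand F x y).natDegree ≤ d := by
  have := MvPolynomial.aeval_natDegree_le (F := F) (m := d) (hF.totalDegree_le)
    (fun k => Polynomial.C (x k) + Polynomial.C (y k) * Polynomial.X) (n := 1) (fun i => by
      compute_degree)
  rw [mul_one] at this
  exact this

/-- Homogeneity converts the expansion along `x + t y` into one along `s x + u y`: for `s ≠ 0` take
`t = u / s` and multiply by `s ^ d`. -/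
lemma eval_comb_eq_sum {F : MvPolynomial (Fin 3) ℂ} {d : ℕ} (hF : F.IsHomogeneous d)
    (x y : Fin 3 → ℂ) (s u : ℂ) :
    eval (s • x + u • y) F =
      ∑ k ∈ Finset.range (d + 1), s ^ (d - k) * u ^ k * (lineExpand F x y).coeff k := by
  have key : lineExpand F (u • y) x = ∑ k ∈ Finset.range (d + 1),
      Polynomial.C (u ^ k * (lineExpand F x y).coeff k) * Polynomial.X ^ (d - k) := by
    -- Both sides are polynomials in `s`. Comparison at positive reals allows division by `s`, and
    -- infinitely many values settle `s = 0` as well.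
    refine Polynomial.eq_of_infinite_eval_eq _ _
      ((Set.Ioi_infinite (0 : ℝ)).image (Complex.ofReal_injective.injOn) |>.mono ?_)
    rintro _ ⟨r, hr, rfl⟩
    have hr0 : (r : ℂ) ≠ 0 := by exact_mod_cast (ne_of_gt hr)
    simp only [Set.mem_ofPred_eq, eval_lineExpand_complex, Polynomial.eval_finsetSum]
    have : u • y + (r : ℂ) • x = (r : ℂ) • (x + (u / r) • y) := by
      ext k; simp; field_simp; ring
    rw [this, eval_smul_of_isHomogeneous hF]
    have h2 := eval_lineExpand_complex F x y (u / r)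
    rw [Polynomial.eval_eq_sum_range' (Nat.lt_succ_of_le (natDegree_lineExpand_le hF x y))] at h2
    rw [← h2, Finset.mul_sum]
    refine Finset.sum_congr rfl fun k hk => ?_
    have hk : k ≤ d := Nat.lt_succ_iff.1 (Finset.mem_range.1 hk)
    simp only [Polynomial.eval_mul, Polynomial.eval_C, Polynomial.eval_pow, Polynomial.eval_X]
    rw [div_pow]
    field_simp
    rw [mul_assoc, mul_assoc, ← pow_add, Nat.add_sub_cancel' hk]
    ring
  have h := eval_lineExpand_complex F (u • y) x s
  rw [key, Polynomial.eval_finsetSum] at h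
  rw [add_comm, ← h]
  refine Finset.sum_congr rfl fun k _ => ?_
  simp; ring

/-- Each factor of the outer variable carries at most one factor of the inner one. This bounds the
degrees of all polynomials attached to a pencil of lines. -/
lemma natDegree_coeff_lineExpand_le (F : MvPolynomial (Fin 3) ℂ) (x q₁ q₂ : Fin 3 → ℂ) (k : ℕ) :
    ((lineExpand F (fun i => Polynomial.C (x i))
      (fun i => Polynomial.C (q₁ i) + Polynomial.C (q₂ i) * Polynomial.X)).coeff k).natDegree
      ≤ k := by
  induction F using MvPolynomial.induction_on generalizing k with
  | C c =>
    simp only [lineExpand, algHom_C, Polynomial.algebraMap_apply, Polynomial.coeff_C]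
    split_ifs <;> simp
  | add F G hF hG =>
    simp only [lineExpand, map_add, Polynomial.coeff_add] at *
    exact Polynomial.natDegree_add_le_of_degree_le (hF k) (hG k)
  | mul_X F i hF =>
    simp only [lineExpand, map_mul, aeval_X, mul_add, Polynomial.coeff_add, ← mul_assoc,
      Polynomial.coeff_mul_C] at *
    refine Polynomial.natDegree_add_le_of_degree_le ?_ ?_
    · exact (Polynomial.natDegree_mul_C_le _ _).trans (hF k)
    · rcases k with _ | k
      · simp
      · rw [Polynomial.coeff_mul_X, Polynomial.coeff_mul_C]
        refine Polynomial.natDegree_mul_le_of_le (hF k) ?_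
        compute_degree

/-- Over an irreducible hypersurface, vanishing is divisibility. -/
lemma Irreducible.dvd_of_forall_eval_eq_zero {F G : MvPolynomial (Fin 3) ℂ} (hF : Irreducible F)
    (h : ∀ x, eval x F = 0 → eval x G = 0) : F ∣ G := by
  have hG : G ∈ vanishingIdeal ℂ (zeroLocus ℂ (Ideal.span {F})) := by
    rw [mem_vanishingIdeal_iff]
    intro x hx
    rw [zeroLocus_span] at hx
    exact h x (hx F rfl)
  -- By the Nullstellensatz a power of `G` is a multiple of the prime `F`.
  rw [vanishingIdeal_zeroLocus_eq_radical] at hG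
  obtain ⟨n, hn⟩ := hG
  exact hF.prime.dvd_of_dvd_pow (Ideal.mem_span_singleton.1 hn)

end LineExpand

/-! ### Multiplicities of plane curves -/

section Multiplicity

open MvPolynomial

/-- All derivatives of `F` of order less than `m` vanish at `x`. -/
def VanishesTo (F : MvPolynomial (Fin 3) ℂ) (x : Fin 3 → ℂ) (m : ℕ) : Prop :=
  ∀ k < m, ∀ w, (lineExpand F x w).coeff k = 0

/-- The form in `w` given by the coefficient of `t ^ k` in `F (x + t w)`. -/
def coeffForm (F : MvPolynomial (Fin 3) ℂ) (x : Fin 3 → ℂ) (k : ℕ) : MvPolynomial (Fin 3) ℂ :=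
  (lineExpand F (fun i => (C (x i) : MvPolynomial (Fin 3) ℂ)) X).coeff k

lemma eval_coeffForm (F : MvPolynomial (Fin 3) ℂ) (x w : Fin 3 → ℂ) (k : ℕ) :
    eval w (coeffForm F x k) = (lineExpand F x w).coeff k := by
  have := map_coeff_lineExpand F (fun i => (C (x i) : MvPolynomial (Fin 3) ℂ)) X (aeval w) k
  have e1 : (aeval w : MvPolynomial (Fin 3) ℂ →ₐ[ℂ] ℂ) ∘ (fun i => C (x i)) = x := by
    ext i; simp
  have e2 : (aeval w : MvPolynomial (Fin 3) ℂ →ₐ[ℂ] ℂ) ∘ X = w := by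
    ext i; simp
  rw [e1, e2] at this
  exact this

lemma coeff_zero_lineExpand (F : MvPolynomial (Fin 3) ℂ) (x w : Fin 3 → ℂ) :
    (lineExpand F x w).coeff 0 = eval x F := by
  rw [Polynomial.coeff_zero_eq_eval_zero, eval_lineExpand_complex]
  simp

lemma vanishesTo_one_iff {F : MvPolynomial (Fin 3) ℂ} {x : Fin 3 → ℂ} :
    VanishesTo F x 1 ↔ eval x F = 0 := by
  simp [VanishesTo, coeff_zero_lineExpand]

lemma vanishesTo_curveMult (F : MvPolynomial (Fin 3) ℂ) (P : Plane) :
    VanishesTo F P.rep (curveMult F P) := by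
  intro k hk w
  by_contra h
  exact Nat.notMem_of_lt_sInf hk ⟨w, h⟩

/-- The infimum in `curveMult` is attained unless its set is empty, which happens only for `F = 0`
(default value 0): if all expansions at the point vanish, the one in direction `x - P.rep` gives `F
x = 0` at parameter 1. -/
lemma exists_coeff_curveMult_ne_zero {F : MvPolynomial (Fin 3) ℂ} (hF : F ≠ 0) (P : Plane) :
    ∃ w, (lineExpand F P.rep w).coeff (curveMult F P) ≠ 0 := by
  refine Nat.sInf_mem (s := {m | ∃ w, (restrictLine F P.rep w).coeff m ≠ 0}) ?_
  by_contra hne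
  rw [Set.not_nonempty_iff_eq_empty, Set.eq_empty_iff_forall_notMem] at hne
  refine hF (MvPolynomial.funext fun x => ?_)
  have h0 : restrictLine F P.rep (x - P.rep) = 0 := by
    ext k
    by_contra hk
    exact hne k ⟨_, hk⟩
  have := eval_lineExpand_complex F P.rep (x - P.rep) 1
  rw [← restrictLine_eq_lineExpand, h0] at this
  simpa using this.symm

lemma le_curveMult_iff {F : MvPolynomial (Fin 3) ℂ} (hF : F ≠ 0) {P : Plane} {m : ℕ} :
    m ≤ curveMult F P ↔ VanishesTo F P.rep m := by
  refine ⟨fun h k hk w => vanishesTo_curveMult F P k (hk.trans_le h) w, fun h => ?_⟩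
  by_contra hlt
  obtain ⟨w, hw⟩ := exists_coeff_curveMult_ne_zero hF P
  exact hw (h _ (not_le.1 hlt) w)

lemma curveMult_pos_iff {F : MvPolynomial (Fin 3) ℂ} (hF : F ≠ 0) {P : Plane} :
    0 < curveMult F P ↔ eval P.rep F = 0 := by
  rw [← vanishesTo_one_iff, ← le_curveMult_iff hF]; rfl

lemma curveMult_le_of_isHomogeneous {F : MvPolynomial (Fin 3) ℂ} (hF : F ≠ 0) {d : ℕ}
    (hd : F.IsHomogeneous d) (P : Plane) : curveMult F P ≤ d := by
  obtain ⟨w, hw⟩ := exists_coeff_curveMult_ne_zero hF P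
  exact (Polynomial.le_natDegree_of_ne_zero hw).trans (natDegree_lineExpand_le hd _ _)

lemma exists_eval_mul_ne_zero {F G : MvPolynomial (Fin 3) ℂ} (hF : F ≠ 0) (hG : G ≠ 0) :
    ∃ x, eval x F ≠ 0 ∧ eval x G ≠ 0 := by
  by_contra! h
  refine mul_ne_zero hF hG (MvPolynomial.funext fun x => ?_)
  by_cases hx : eval x F = 0
  · simp [hx]
  · simp [h x hx]

/-- The leading forms of the two factors are nonzero polynomials, so some direction `w` is a zero of
neither; along it the orders add. -/
lemma curveMult_mul_le {F G : MvPolynomial (Fin 3) ℂ} (hF : F ≠ 0) (hG : G ≠ 0) (P : Plane) :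
    curveMult (F * G) P ≤ curveMult F P + curveMult G P := by
  have ne : ∀ {H : MvPolynomial (Fin 3) ℂ}, H ≠ 0 →
      coeffForm H P.rep (curveMult H P) ≠ 0 := by
    intro H hH h0
    obtain ⟨w, hw⟩ := exists_coeff_curveMult_ne_zero hH P
    rw [← eval_coeffForm, h0] at hw
    simp at hw
  obtain ⟨w, h1, h2⟩ := exists_eval_mul_ne_zero (ne hF) (ne hG)
  rw [eval_coeffForm] at h1 h2
  refine Nat.sInf_le ⟨w, ?_⟩
  rw [restrictLine_eq_lineExpand, lineExpand_mul]
  have hX : ∀ H : MvPolynomial (Fin 3) ℂ,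
      ∃ Q, lineExpand H P.rep w = Polynomial.X ^ curveMult H P * Q := fun H =>
    Polynomial.X_pow_dvd_iff.2 fun k hk => vanishesTo_curveMult H P k hk w
  obtain ⟨Q, hQ⟩ := hX F
  obtain ⟨R, hR⟩ := hX G
  rw [hQ] at h1 ⊢
  rw [hR] at h2 ⊢
  rw [mul_mul_mul_comm, ← pow_add]
  rw [Polynomial.coeff_X_pow_mul', if_pos le_rfl, Nat.sub_self] at *
  rw [Polynomial.mul_coeff_zero]
  exact mul_ne_zero h1 h2

/-- The expansion of a form along a parametrized curve through a point of multiplicity `m`. -/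
lemma VanishesTo.exists_aeval_eq {G : MvPolynomial (Fin 3) ℂ} {x : Fin 3 → ℂ} {m : ℕ}
    (hG : VanishesTo G x m) (v : Fin 3 → Polynomial ℂ) (t : ℂ) (hv : ∀ i, (v i).eval t = x i) :
    ∃ R, aeval v G = (Polynomial.X - Polynomial.C t) ^ m *
      (Polynomial.C ((lineExpand G x fun i => (v i).derivative.eval t).coeff m) +
        (Polynomial.X - Polynomial.C t) * R) := by
  have hu : ∀ i, ∃ u : Polynomial ℂ, v i = Polynomial.C (x i) + (Polynomial.X - Polynomial.C t) * u :=
    fun i => by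
      have : Polynomial.X - Polynomial.C t ∣ v i - Polynomial.C (x i) := by
        rw [Polynomial.dvd_iff_isRoot]; simp [hv]
      obtain ⟨u, hu⟩ := this
      exact ⟨u, by rw [← hu]; ring⟩
  choose u hu using hu
  have hu' : (fun i => (v i).derivative.eval t) = fun i => (u i).eval t := by
    ext i; rw [hu i]; simp
  -- Since `v = x + (X - t) u`, the restriction of `G` to the curve is the expansion `L` along `u`,
  -- evaluated at `X - t`.
  set L := lineExpand G (fun i => Polynomial.C (x i)) u with hL
  have hc : ∀ k τ, (L.coeff k).eval τ = (lineExpand G x fun i => (u i).eval τ).coeff k := by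
    intro k τ
    have := map_coeff_lineExpand G (fun i => Polynomial.C (x i)) u (Polynomial.aeval τ) k
    have e1 : (Polynomial.aeval τ : Polynomial ℂ →ₐ[ℂ] ℂ) ∘ (fun i => Polynomial.C (x i)) = x := by
      ext i; simp
    have e2 : (Polynomial.aeval τ : Polynomial ℂ →ₐ[ℂ] ℂ) ∘ u = fun i => (u i).eval τ := by
      ext i; simp
    rw [e1, e2] at this
    rw [← this, hL]
    simp
  have h0 : ∀ k < m, L.coeff k = 0 := by
    intro k hk
    refine Polynomial.funext fun τ => ?_
    rw [hc, hG k hk]; simp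
  obtain ⟨Q, hQ⟩ := Polynomial.X_pow_dvd_iff.2 h0
  have hQ0 : Q.coeff 0 = L.coeff m := by
    rw [hQ, Polynomial.coeff_X_pow_mul', if_pos le_rfl, Nat.sub_self]
  -- Modulo `X - t` this coefficient depends only on `u t`, which is the derivative of `v` at `t`.
  have hcm : Polynomial.X - Polynomial.C t ∣
      L.coeff m - Polynomial.C ((lineExpand G x fun i => (v i).derivative.eval t).coeff m) := by
    rw [Polynomial.dvd_iff_isRoot, hu']; simp [hc]
  obtain ⟨R, hR⟩ := hcm
  have hev : aeval v G = L.eval (Polynomial.X - Polynomial.C t) := by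
    rw [hL, eval_lineExpand]
    congr 2
    ext1 i
    rw [hu i]; simp
  refine ⟨R + Q.divX.eval (Polynomial.X - Polynomial.C t), ?_⟩
  rw [hev, hQ, Polynomial.eval_mul, Polynomial.eval_pow, Polynomial.eval_X]
  congr 1
  conv_lhs => rw [← Polynomial.divX_mul_X_add Q]
  rw [Polynomial.eval_add, Polynomial.eval_mul, Polynomial.eval_X, Polynomial.eval_C, hQ0,
    eq_add_of_sub_eq hR]
  ring

end Multiplicity

/-! ### Parametrization of a plane curve of degree `n + 1` with a point of multiplicity `n` -/

section Monoid

open MvPolynomial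

/-- An affine coordinate on the pencil of lines through `p`: the line through `p` and
`q₁ + t q₂` has coordinate `t`, and the line `lam = 0` is at infinity. -/
structure PencilChart (p : Fin 3 → ℂ) where
  q₁ : Fin 3 → ℂ
  q₂ : Fin 3 → ℂ
  lam : Module.Dual ℂ (Fin 3 → ℂ)
  mu : Module.Dual ℂ (Fin 3 → ℂ)
  lam_p : lam p = 0
  lam_q₁ : lam q₁ = 1
  lam_q₂ : lam q₂ = 0
  mu_p : mu p = 0
  mu_q₁ : mu q₁ = 0
  mu_q₂ : mu q₂ = 1
  exists_eq : ∀ x, ∃ s : ℂ, x = s • p + (lam x • q₁ + mu x • q₂)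

/-- Over an infinite field some functional vanishes at `p` and at none of finitely many vectors
outside the span of `p`. Its kernel is a plane containing `p`; a second vector of this plane serves
as `q₂`. -/
lemma exists_pencilChart {p : Fin 3 → ℂ} (hp : p ≠ 0) {ι : Type*} [Finite ι]
    (x : ι → Fin 3 → ℂ) (hx : ∀ i, x i ∉ Submodule.span ℂ {p}) :
    ∃ c : PencilChart p, ∀ i, c.lam (x i) ≠ 0 := by
  obtain ⟨y, hy⟩ : ∃ y, y ∉ Submodule.span ℂ {p} := by
    by_contra! h
    have h1 := finrank_span_singleton (K := ℂ) hp
    rw [(Submodule.eq_top_iff'.2 h), finrank_top] at h1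
    simp at h1
  -- The index `none` carries the auxiliary vector `y`, which forces `f ≠ 0` even if `ι` is empty.
  obtain ⟨f, hf, hf'⟩ := Module.Dual.exists_forall_mem_ne_zero_of_forall_exists
    (K := ℂ) (M := Module.Dual ℂ (Fin 3 → ℂ)) (ι := Option ι)
    ((Submodule.span ℂ {p}).dualAnnihilator)
    (fun o => Module.Dual.eval ℂ _ (o.elim y x)) (by
      intro o
      have ho : o.elim y x ∉ Submodule.span ℂ {p} := by cases o <;> simp [hy, hx]
      obtain ⟨f, hf1, hf2⟩ := Submodule.exists_le_ker_of_notMem ho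
      refine ⟨f, ?_, ?_⟩
      · rw [Submodule.mem_dualAnnihilator]
        exact fun w hw => hf2 hw
      · exact hf1)
  have hfp : f p = 0 := by
    rw [Submodule.mem_dualAnnihilator] at hf
    exact hf p (Submodule.mem_span_singleton_self p)
  have hfy : f y ≠ 0 := hf' none
  have hfx : ∀ i, f (x i) ≠ 0 := fun i => hf' (some i)
  have hrank : Module.finrank ℂ (LinearMap.ker f) = 2 := by
    have h := LinearMap.finrank_range_add_finrank_ker f
    have hs : LinearMap.range f = ⊤ := by
      refine LinearMap.range_eq_top.2 (LinearMap.surjective ?_)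
      rintro rfl
      simp at hfy
    rw [hs, finrank_top] at h
    simp at h
    omega
  obtain ⟨z, hz, hzp⟩ : ∃ z ∈ LinearMap.ker f, z ∉ Submodule.span ℂ {p} := by
    by_contra! h
    have := Submodule.finrank_mono (show LinearMap.ker f ≤ _ from h)
    rw [hrank, finrank_span_singleton hp] at this
    omega
  have hli : LinearIndependent ℂ ![p, z] := by
    rw [LinearIndependent.pair_iff' hp]
    intro a ha
    exact hzp (ha ▸ Submodule.smul_mem _ _ (Submodule.mem_span_singleton_self p))
  have hker : Submodule.span ℂ {p, z} = LinearMap.ker f := by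
    refine Submodule.eq_of_le_of_finrank_eq ?_ ?_
    · rw [Submodule.span_le]
      rintro w (rfl | rfl)
      · exact hfp
      · exact hz
    · have hr : Set.range ![p, z] = {p, z} := by simp [Set.pair_comm]
      rw [← hr, finrank_span_eq_card hli, hrank, Fintype.card_fin]
  obtain ⟨g, hg1, hg2⟩ := Submodule.exists_le_ker_of_notMem hzp
  have hgp : g p = 0 := hg2 (Submodule.mem_span_singleton_self p)
  have hfz : f z = 0 := hz
  set q := (f y)⁻¹ • y with hq
  have hfq : f q = 1 := by simp [hq, hfy]
  refine ⟨⟨q, z, f, (g z)⁻¹ • (g - g q • f), hfp, hfq, hz, by simp [hgp, hfp], by simp [hfq],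
    by simp [hfz, hg1], fun w => ?_⟩, hfx⟩
  have : w - f w • q ∈ Submodule.span ℂ {p, z} := by
    rw [hker]; simp [hfq]
  obtain ⟨s, t, hst⟩ := Submodule.mem_span_pair.1 this
  have hw : w = s • p + (f w • q + t • z) := by
    rw [add_left_comm, hst]; abel
  refine ⟨s, ?_⟩
  have ht : ((g z)⁻¹ • (g - g q • f)) w = t := by
    conv_lhs => rw [hw]
    simp [hgp, hfp, hfq, hfz]
    field_simp
    ring
  rw [ht]; exact hw

namespace PencilChart

variable {p : Fin 3 → ℂ} (c : PencilChart p)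

/-- The moving point `q₁ + t q₂`. -/
def moving : Fin 3 → Polynomial ℂ :=
  fun i => Polynomial.C (c.q₁ i) + Polynomial.C (c.q₂ i) * Polynomial.X

/-- The coefficient of `u ^ k` in `F (p + u (q₁ + t q₂))`, as a polynomial in `t`. -/
def coeffPoly (F : MvPolynomial (Fin 3) ℂ) (k : ℕ) : Polynomial ℂ :=
  (lineExpand F (fun i => Polynomial.C (p i)) c.moving).coeff k

lemma eval_coeffPoly (F : MvPolynomial (Fin 3) ℂ) (k : ℕ) (t : ℂ) :
    (c.coeffPoly F k).eval t = (lineExpand F p (c.q₁ + t • c.q₂)).coeff k := by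
  have := map_coeff_lineExpand F (fun i => Polynomial.C (p i)) c.moving (Polynomial.aeval t) k
  have e1 : (Polynomial.aeval t : Polynomial ℂ →ₐ[ℂ] ℂ) ∘ (fun i => Polynomial.C (p i)) = p := by
    ext i; simp
  have e2 : (Polynomial.aeval t : Polynomial ℂ →ₐ[ℂ] ℂ) ∘ c.moving = c.q₁ + t • c.q₂ := by
    ext i; simp [moving]; ring
  rw [e1, e2] at this
  rw [← this]
  simp [coeffPoly]

lemma natDegree_coeffPoly_le (F : MvPolynomial (Fin 3) ℂ) (k : ℕ) :
    (c.coeffPoly F k).natDegree ≤ k :=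
  natDegree_coeff_lineExpand_le F p c.q₁ c.q₂ k

/-- The parametrization of the curve `F = 0` of degree `n + 1` with multiplicity `n` at `p`. -/
def branch (F : MvPolynomial (Fin 3) ℂ) (n : ℕ) : Fin 3 → Polynomial ℂ :=
  fun i => c.coeffPoly F n * c.moving i - c.coeffPoly F (n + 1) * Polynomial.C (p i)

lemma eval_branch (F : MvPolynomial (Fin 3) ℂ) (n : ℕ) (t : ℂ) :
    (fun i => (c.branch F n i).eval t) =
      (-(c.coeffPoly F (n + 1)).eval t) • p + (c.coeffPoly F n).eval t • (c.q₁ + t • c.q₂) := by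
  ext i; simp [branch, moving]; ring

/-- The restriction to the branch of a form `G` of degree `m + l` with multiplicity `m` at `p`,
divided by its obvious zeros. -/
def residual (F G : MvPolynomial (Fin 3) ℂ) (n m l : ℕ) : Polynomial ℂ :=
  ∑ j ∈ Finset.range (l + 1),
    (-c.coeffPoly F (n + 1)) ^ (l - j) * c.coeffPoly F n ^ j * c.coeffPoly G (m + j)

lemma natDegree_residual_le (F G : MvPolynomial (Fin 3) ℂ) (n m l : ℕ) :
    (c.residual F G n m l).natDegree ≤ (n + 1) * l + m := by
  refine Polynomial.natDegree_sum_le_of_forall_le _ _ fun j hj => ?_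
  have hj : j ≤ l := Nat.lt_succ_iff.1 (Finset.mem_range.1 hj)
  have h1 : ((-c.coeffPoly F (n + 1)) ^ (l - j)).natDegree ≤ (l - j) * (n + 1) :=
    Polynomial.natDegree_pow_le_of_le _ (by
      rw [Polynomial.natDegree_neg]; exact c.natDegree_coeffPoly_le F (n + 1))
  have h2 : (c.coeffPoly F n ^ j).natDegree ≤ j * n :=
    Polynomial.natDegree_pow_le_of_le _ (c.natDegree_coeffPoly_le F n)
  have h3 := c.natDegree_coeffPoly_le G (m + j)
  refine (Polynomial.natDegree_mul_le_of_le (Polynomial.natDegree_mul_le_of_le h1 h2) h3).trans ?_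
  obtain ⟨r, rfl⟩ := Nat.exists_eq_add_of_le hj
  simp only [Nat.add_sub_cancel_left]
  -- For every `j` the bounds `(l - j)(n + 1)`, `j n` and `m + j` add up to `(n + 1) l + m`.
  apply le_of_eq
  ring

lemma eval_aeval_eq (v : Fin 3 → Polynomial ℂ) (G : MvPolynomial (Fin 3) ℂ) (t : ℂ) :
    (aeval v G).eval t = eval (fun i => (v i).eval t) G := by
  induction G using MvPolynomial.induction_on with
  | C c => simp
  | add F G hF hG => simp_all
  | mul_X F i hF => simp_all

/-- In the expansion of `G (s p + u w)` the terms with `k < m` vanish and all others contain `u ^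
m`. On the branch `u` is `coeffPoly F n`, which gives the power split off. -/
lemma aeval_branch (F : MvPolynomial (Fin 3) ℂ) {G : MvPolynomial (Fin 3) ℂ} (n : ℕ) {m l : ℕ}
    (hG : G.IsHomogeneous (m + l)) (hGp : VanishesTo G p m) :
    aeval (c.branch F n) G = c.coeffPoly F n ^ m * c.residual F G n m l := by
  refine Polynomial.funext fun t => ?_
  rw [eval_aeval_eq, eval_branch, eval_comb_eq_sum hG, add_assoc, Finset.sum_range_add,
    Finset.sum_eq_zero, zero_add, residual, Polynomial.eval_mul, Polynomial.eval_finsetSum,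
    Finset.mul_sum]
  · refine Finset.sum_congr rfl fun j hj => ?_
    simp only [Polynomial.eval_mul, Polynomial.eval_pow, Polynomial.eval_neg, ← eval_coeffPoly,
      Nat.add_sub_add_left]
    ring
  · intro k hk
    rw [hGp k (Finset.mem_range.1 hk), mul_zero]

variable {F : MvPolynomial (Fin 3) ℂ} {n : ℕ}

/-- Only the two top coefficients, `a` and `b` say, survive, so the value is `u ^ n (s a + u b)`.
The zero `s = -b`, `u = a` on each line through `p` is what `branch` records. -/
lemma _root_.eval_comb_of_vanishesTo (hF : F.IsHomogeneous (n + 1)) (hFp : VanishesTo F p n)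
    (w : Fin 3 → ℂ) (s u : ℂ) :
    eval (s • p + u • w) F = s * u ^ n * (lineExpand F p w).coeff n +
      u ^ (n + 1) * (lineExpand F p w).coeff (n + 1) := by
  rw [eval_comb_eq_sum hF, Finset.sum_range_succ, Finset.sum_range_succ, Finset.sum_eq_zero]
  · simp
  · intro k hk
    rw [hFp k (Finset.mem_range.1 hk), mul_zero]

lemma aeval_branch_self (hF : F.IsHomogeneous (n + 1)) (hFp : VanishesTo F p n) :
    aeval (c.branch F n) F = 0 := by
  refine Polynomial.funext fun t => ?_
  rw [eval_aeval_eq, eval_branch, eval_comb_of_vanishesTo hF hFp, ← eval_coeffPoly,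
    ← eval_coeffPoly]
  simp; ring

/-- The leading form at `p` has degree `n` and does not see multiples of `p` in the direction,
because `p + τ (s p + u w) = (1 + τ s) p + τ u w`. -/
lemma _root_.coeff_lineExpand_comb (hF : F.IsHomogeneous (n + 1)) (hFp : VanishesTo F p n)
    (w : Fin 3 → ℂ) (s u : ℂ) :
    (lineExpand F p (s • p + u • w)).coeff n = u ^ n * (lineExpand F p w).coeff n := by
  have h : lineExpand F p (s • p + u • w) =
      Polynomial.X ^ n * (Polynomial.C (u ^ n * (lineExpand F p w).coeff n) + Polynomial.X *
        (Polynomial.C (s * u ^ n * (lineExpand F p w).coeff n +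
          u ^ (n + 1) * (lineExpand F p w).coeff (n + 1)))) := by
    refine Polynomial.funext fun τ => ?_
    have e : p + τ • (s • p + u • w) = (1 + τ * s) • p + (τ * u) • w := by
      ext i; simp; ring
    rw [eval_lineExpand_complex, e, eval_comb_of_vanishesTo hF hFp]
    simp; ring
  rw [h, Polynomial.coeff_X_pow_mul', if_pos le_rfl, Nat.sub_self, Polynomial.coeff_add,
    Polynomial.coeff_C_zero, Polynomial.mul_coeff_zero]
  simp

end PencilChart

/-- The linear form attached to a functional. -/
def linForm (f : Module.Dual ℂ (Fin 3 → ℂ)) : MvPolynomial (Fin 3) ℂ :=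
  ∑ i, C (f (Pi.single i 1)) * X i

lemma eval_linForm (f : Module.Dual ℂ (Fin 3 → ℂ)) (x : Fin 3 → ℂ) :
    eval x (linForm f) = f x := by
  conv_rhs => rw [pi_eq_sum_univ' x]
  simp [linForm, mul_comm, map_sum]

lemma isHomogeneous_linForm (f : Module.Dual ℂ (Fin 3 → ℂ)) : (linForm f).IsHomogeneous 1 :=
  IsHomogeneous.sum _ _ _ fun i _ => isHomogeneous_C_mul_X _ i

lemma linForm_ne_zero {f : Module.Dual ℂ (Fin 3 → ℂ)} (hf : f ≠ 0) : linForm f ≠ 0 := by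
  intro h
  refine hf (LinearMap.ext fun x => ?_)
  rw [← eval_linForm, h]; simp

lemma irreducible_of_isHomogeneous_one {F : MvPolynomial (Fin 3) ℂ} (hF : F.IsHomogeneous 1)
    (h0 : F ≠ 0) : Irreducible F := by
  refine irreducible_of_totalDegree_eq_one (hF.totalDegree h0) fun x hx => ?_
  by_contra hne
  obtain rfl : x = 0 := by
    by_contra hx0
    exact hne (isUnit_iff_ne_zero.2 hx0)
  exact h0 (MvPolynomial.ext _ _ fun m => by simpa using hx m)

namespace PencilChart

variable {p : Fin 3 → ℂ} (c : PencilChart p) {F : MvPolynomial (Fin 3) ℂ} {n : ℕ}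

lemma exists_eq_smul {x : Fin 3 → ℂ} (hx : c.lam x ≠ 0) :
    ∃ s : ℂ, x = c.lam x • (s • p + (c.q₁ + (c.mu x / c.lam x) • c.q₂)) := by
  obtain ⟨s, hs⟩ := c.exists_eq x
  refine ⟨s / c.lam x, ?_⟩
  conv_lhs => rw [hs]
  simp only [smul_add, smul_smul]
  rw [mul_div_cancel₀ _ hx, mul_div_cancel₀ _ hx]

/-- A line through `p` is not a component of `F`. -/
lemma coeffPoly_eval_ne_zero (hirr : Irreducible F) (hF : F.IsHomogeneous (n + 1))
    (hFp : VanishesTo F p n) (hne : ∃ w, (lineExpand F p w).coeff n ≠ 0) {x : Fin 3 → ℂ}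
    (hx : c.lam x ≠ 0) (hFx : eval x F = 0) :
    (c.coeffPoly F n).eval (c.mu x / c.lam x) ≠ 0 := by
  set t := c.mu x / c.lam x with ht
  intro ha
  obtain ⟨s, hs⟩ := c.exists_eq_smul hx
  rw [← ht] at hs
  have hb : (c.coeffPoly F (n + 1)).eval t = 0 := by
    rw [hs, smul_add, smul_smul, eval_comb_of_vanishesTo hF hFp, ← eval_coeffPoly,
      ← eval_coeffPoly, ha] at hFx
    simpa [hx] using hFx
  -- Both surviving coefficients vanish at `t`, so `F` vanishes on the whole line with parameter
  -- `t`.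
  have hdvd : linForm (c.mu - t • c.lam) ∣ F := by
    refine Irreducible.dvd_of_forall_eval_eq_zero
      (irreducible_of_isHomogeneous_one (isHomogeneous_linForm _) (linForm_ne_zero ?_)) ?_
    · intro h
      have := LinearMap.congr_fun h c.q₂
      simp [c.mu_q₂, c.lam_q₂] at this
    · intro y hy
      rw [eval_linForm] at hy
      have hy : c.mu y = t * c.lam y := by simpa [sub_eq_zero] using hy
      obtain ⟨s', hs'⟩ := c.exists_eq y
      have : y = s' • p + c.lam y • (c.q₁ + t • c.q₂) := by
        conv_lhs => rw [hs', hy]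
        rw [smul_add, smul_smul, mul_comm t]
      rw [this, eval_comb_of_vanishesTo hF hFp, ← eval_coeffPoly, ← eval_coeffPoly, ha, hb]
      simp
  have hl0 : linForm (c.mu - t • c.lam) ≠ 0 := fun h => by
    rw [h, zero_dvd_iff] at hdvd
    exact hirr.ne_zero hdvd
  have hassoc : Associated (linForm (c.mu - t • c.lam)) F :=
    (irreducible_of_isHomogeneous_one (isHomogeneous_linForm _) hl0).associated_of_dvd hirr hdvd
  obtain ⟨k, hk⟩ := hassoc.symm.dvd
  have hdeg := hF.totalDegree hirr.ne_zero
  have hk0 : k ≠ 0 := by rintro rfl; simp at hk; exact hl0 hk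
  have h1 := (isHomogeneous_linForm (c.mu - t • c.lam)).totalDegree hl0
  rw [hk, totalDegree_mul_of_isDomain hirr.ne_zero hk0, hdeg] at h1
  -- An irreducible `F` is then this line itself, so `n = 0`, and `hne` says that `F` does not
  -- vanish at `p`; but the line passes through `p`.
  obtain rfl : n = 0 := by omega
  obtain ⟨w, hw⟩ := hne
  rw [coeff_zero_lineExpand] at hw
  obtain ⟨k', hk'⟩ := hdvd
  rw [hk', map_mul, eval_linForm] at hw
  simp [c.mu_p, c.lam_p] at hw

/-- On the line through `p` and `x`, the equation `F x = 0` forces the top coefficient to be `-s`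
times the preceding one, which is exactly the point chosen by `branch`. -/
lemma eval_branch_eq_smul (hF : F.IsHomogeneous (n + 1)) (hFp : VanishesTo F p n)
    {x : Fin 3 → ℂ} (hx : c.lam x ≠ 0) (hFx : eval x F = 0) :
    (fun i => (c.branch F n i).eval (c.mu x / c.lam x)) =
      ((c.coeffPoly F n).eval (c.mu x / c.lam x) / c.lam x) • x := by
  set t := c.mu x / c.lam x with ht
  obtain ⟨s, hs⟩ := c.exists_eq_smul hx
  rw [← ht] at hs
  have hb : (c.coeffPoly F (n + 1)).eval t = - (s * (c.coeffPoly F n).eval t) := by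
    rw [hs, smul_add, smul_smul, eval_comb_of_vanishesTo hF hFp, ← eval_coeffPoly,
      ← eval_coeffPoly] at hFx
    have : c.lam x ^ (n + 1) * (s * (c.coeffPoly F n).eval t +
      (c.coeffPoly F (n + 1)).eval t) = 0 := by rw [← hFx]; ring
    rcases mul_eq_zero.1 this with h | h
    · exact absurd h (pow_ne_zero _ hx)
    · linear_combination h
  rw [eval_branch, hb]
  conv_rhs => rhs; rw [hs]
  rw [smul_smul, div_mul_cancel₀ _ hx]
  simp only [smul_add, smul_smul]
  congr 2
  ring

/-- Points of the curve with the same parameter coincide. -/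
lemma mem_span_of_parameter_eq (hirr : Irreducible F) (hF : F.IsHomogeneous (n + 1))
    (hFp : VanishesTo F p n) (hne : ∃ w, (lineExpand F p w).coeff n ≠ 0) {x y : Fin 3 → ℂ}
    (hx : c.lam x ≠ 0) (hFx : eval x F = 0) (hy : c.lam y ≠ 0) (hFy : eval y F = 0)
    (h : c.mu x / c.lam x = c.mu y / c.lam y) : x ∈ Submodule.span ℂ {y} := by
  have hax := c.coeffPoly_eval_ne_zero hirr hF hFp hne hx hFx
  have h1 := c.eval_branch_eq_smul hF hFp hx hFx
  rw [h, c.eval_branch_eq_smul hF hFp hy hFy, ← h] at h1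
  have hκ := div_ne_zero hax hx
  rw [Submodule.mem_span_singleton]
  refine ⟨((c.coeffPoly F n).eval (c.mu x / c.lam x) / c.lam x)⁻¹ *
    ((c.coeffPoly F n).eval (c.mu x / c.lam x) / c.lam y), ?_⟩
  rw [mul_smul, h1, smul_smul, inv_mul_cancel₀ hκ, one_smul]

/-- A form that vanishes along the branch vanishes at every zero of `F` off the line `lam = 0`. An
auxiliary factor containing `linForm c.lam` takes care of that line, and `F` does not divide the
auxiliary factor. -/
lemma dvd_of_residual_eq_zero (hirr : Irreducible F) (hF : F.IsHomogeneous (n + 1))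
    (hFp : VanishesTo F p n) (hne : ∃ w, (lineExpand F p w).coeff n ≠ 0)
    {G : MvPolynomial (Fin 3) ℂ} {m l : ℕ} (hG : G.IsHomogeneous (m + l)) (hGp : VanishesTo G p m)
    (h : c.residual F G n m l = 0) : F ∣ G := by
  have hlam : linForm c.lam ≠ 0 := linForm_ne_zero fun h0 => by
    have := c.lam_q₁; rw [h0] at this; simp at this
  have hcf : coeffForm F p n ≠ 0 := by
    obtain ⟨w, hw⟩ := hne
    rw [← eval_coeffForm] at hw
    rintro h0
    simp [h0] at hw
  have hdvd : F ∣ G * (coeffForm F p n * linForm c.lam) := by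
    refine hirr.dvd_of_forall_eval_eq_zero fun x hFx => ?_
    rw [map_mul, map_mul, eval_linForm]
    by_cases hx : c.lam x = 0
    · simp [hx]
    have ha := c.coeffPoly_eval_ne_zero hirr hF hFp hne hx hFx
    have h1 := congrArg (Polynomial.eval (c.mu x / c.lam x)) (c.aeval_branch F n hG hGp)
    rw [eval_aeval_eq, c.eval_branch_eq_smul hF hFp hx hFx, eval_smul_of_isHomogeneous hG, h,
      mul_zero, Polynomial.eval_zero] at h1
    rcases mul_eq_zero.1 h1 with h1 | h1
    · exact absurd h1 (pow_ne_zero _ (div_ne_zero ha hx))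
    · rw [h1, zero_mul]
  refine (hirr.prime.dvd_or_dvd hdvd).resolve_right ?_
  rintro ⟨k, hk⟩
  -- A direction `w` at which neither auxiliary form vanishes can be moved along `p` to a zero of
  -- `F`; both forms keep their values.
  obtain ⟨w, hw1, hw2⟩ := exists_eval_mul_ne_zero hcf hlam
  rw [eval_coeffForm] at hw1
  rw [eval_linForm] at hw2
  set s := -((lineExpand F p w).coeff (n + 1) / (lineExpand F p w).coeff n)
  have hx0 : eval (s • p + (1 : ℂ) • w) F = 0 := by
    rw [eval_comb_of_vanishesTo hF hFp]
    simp only [s]; field_simp; ring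
  have h2 := congrArg (eval (s • p + (1 : ℂ) • w)) hk
  rw [map_mul, map_mul, hx0, eval_coeffForm, eval_linForm, coeff_lineExpand_comb hF hFp] at h2
  simp [c.lam_p, hw1, hw2] at h2

/-- The order of vanishing of the residual at a point of the curve where `G` has multiplicity
`k`. It is larger than `k` if the curve and `G` have a common tangent. -/
lemma pow_dvd_residual (hirr : Irreducible F) (hF : F.IsHomogeneous (n + 1))
    (hFp : VanishesTo F p n) (hne : ∃ w, (lineExpand F p w).coeff n ≠ 0)
    {G : MvPolynomial (Fin 3) ℂ} {m l : ℕ} (hG : G.IsHomogeneous (m + l)) (hGp : VanishesTo G p m)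
    {x : Fin 3 → ℂ} (hx : c.lam x ≠ 0) (hFx : eval x F = 0) {k : ℕ} (hGx : VanishesTo G x k) :
    ∃ u, (lineExpand F x u).coeff 1 = 0 ∧
      (Polynomial.X - Polynomial.C (c.mu x / c.lam x)) ^ k ∣ c.residual F G n m l ∧
      ((lineExpand G x u).coeff k = 0 →
        (Polynomial.X - Polynomial.C (c.mu x / c.lam x)) ^ (k + 1) ∣ c.residual F G n m l) := by
  have ha := c.coeffPoly_eval_ne_zero hirr hF hFp hne hx hFx
  have hbr := c.eval_branch_eq_smul hF hFp hx hFx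
  set t := c.mu x / c.lam x with ht
  set κ := (c.coeffPoly F n).eval t / c.lam x with hκ
  have hκ0 : κ ≠ 0 := div_ne_zero ha hx
  -- Rescaling makes the branch pass through the representative `x` itself, as the local expansion
  -- requires.
  set v : Fin 3 → Polynomial ℂ := fun i => Polynomial.C κ⁻¹ * c.branch F n i with hv
  have hvt : ∀ i, (v i).eval t = x i := fun i => by
    have := congrFun hbr i
    simp only [Pi.smul_apply, smul_eq_mul] at this
    simp only [hv, Polynomial.eval_mul, Polynomial.eval_C, this]
    field_simp
  have hscale : ∀ {H : MvPolynomial (Fin 3) ℂ} {e : ℕ}, H.IsHomogeneous e →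
      aeval v H = Polynomial.C (κ⁻¹ ^ e) * aeval (c.branch F n) H := by
    intro H e hH
    refine Polynomial.funext fun τ => ?_
    rw [eval_aeval_eq, Polynomial.eval_mul, Polynomial.eval_C, eval_aeval_eq,
      ← eval_smul_of_isHomogeneous hH]
    congr 2
    ext i
    simp [hv]
  set u : Fin 3 → ℂ := fun i => (v i).derivative.eval t
  -- The factor split off from the restriction of `G` does not vanish at `t`, so all zeros there
  -- belong to the residual.
  have hcop : IsCoprime (Polynomial.X - Polynomial.C t) (c.coeffPoly F n) := by
    refine ((Polynomial.irreducible_X_sub_C t).coprime_iff_not_dvd).2 ?_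
    rwa [Polynomial.dvd_iff_isRoot]
  have hred : ∀ j, (Polynomial.X - Polynomial.C t) ^ j ∣ aeval v G →
      (Polynomial.X - Polynomial.C t) ^ j ∣ c.residual F G n m l := by
    intro j hj
    rw [hscale hG, c.aeval_branch F n hG hGp] at hj
    have hj := (Polynomial.isUnit_C.2 (isUnit_iff_ne_zero.2
      (pow_ne_zero (m + l) (inv_ne_zero hκ0)))).dvd_mul_left.1 hj
    exact (hcop.pow (m := j) (n := m)).dvd_of_dvd_mul_left hj
  obtain ⟨R, hR⟩ := hGx.exists_aeval_eq v t hvt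
  refine ⟨u, ?_, hred _ (hR ▸ Dvd.intro _ rfl), fun h0 => hred _ ?_⟩
  -- `F` vanishes identically on the branch, so the velocity `u` is a tangent direction of `F` at
  -- `x`.
  · obtain ⟨R', hR'⟩ := (vanishesTo_one_iff.2 hFx).exists_aeval_eq v t hvt
    rw [hscale hF, c.aeval_branch_self hF hFp, mul_zero, pow_one, eq_comm, mul_eq_zero] at hR'
    rcases hR' with h | h
    · exact absurd h (Polynomial.X_sub_C_ne_zero t)
    · simpa using congrArg (Polynomial.eval t) h
  · rw [hR, h0, Polynomial.C_0, zero_add, ← mul_assoc, ← pow_succ]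
    exact Dvd.intro _ rfl

/-- A common tangent direction at `p` is a zero of the residual. -/
lemma eval_residual_eq_zero {G : MvPolynomial (Fin 3) ℂ} {m l : ℕ} {t : ℂ}
    (hF : (lineExpand F p (c.q₁ + t • c.q₂)).coeff n = 0)
    (hG : (lineExpand G p (c.q₁ + t • c.q₂)).coeff m = 0) :
    (c.residual F G n m l).eval t = 0 := by
  rw [residual, Polynomial.eval_finsetSum]
  refine Finset.sum_eq_zero fun j _ => ?_
  -- The term `j = 0` contains the leading coefficient of `G`, all others that of `F`.
  rcases j with _ | j
  · simp [eval_coeffPoly, hG]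
  · simp [eval_coeffPoly, hF]

end PencilChart

end Monoid

/-! ### Intersection numbers and disjointness of strict transforms -/

section Bezout

open MvPolynomial

lemma coeff_one_lineExpand (F : MvPolynomial (Fin 3) ℂ) (x w : Fin 3 → ℂ) :
    (lineExpand F x w).coeff 1 = ∑ i, w i * eval x (pderiv i F) := by
  induction F using MvPolynomial.induction_on with
  | C c => simp [lineExpand]
  | add F G hF hG =>
    rw [lineExpand] at *
    simp [hF, hG, mul_add, Finset.sum_add_distrib]
  | mul_X F i hF =>
    have h0 := coeff_zero_lineExpand F x w
    have hX : lineExpand (X i) x w = Polynomial.C (x i) + Polynomial.C (w i) * Polynomial.X := by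
      simp [lineExpand]
    rw [lineExpand_mul, hX, mul_add, Polynomial.coeff_add, Polynomial.coeff_mul_C, ← mul_assoc,
      Polynomial.coeff_mul_X, Polynomial.coeff_mul_C, hF, h0]
    simp [pderiv_X, Pi.single_apply, mul_add, Finset.sum_add_distrib, Finset.sum_mul]
    rw [add_comm]
    congr 1
    · simp [apply_ite (eval x), mul_comm]
    exact Finset.sum_congr rfl fun j _ => by ring

lemma sum_le_natDegree_of_pow_dvd {ι : Type*} {h : Polynomial ℂ} (hh : h ≠ 0) (T : Finset ι)
    (t : ι → ℂ) (ht : Set.InjOn t T) (n : ι → ℕ)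
    (hn : ∀ i ∈ T, (Polynomial.X - Polynomial.C (t i)) ^ n i ∣ h) :
    ∑ i ∈ T, n i ≤ h.natDegree := by
  have hd : ∏ i ∈ T, (Polynomial.X - Polynomial.C (t i)) ^ n i ∣ h := by
    refine Finset.prod_dvd_of_coprime (fun i hi j hj hij => ?_) hn
    refine IsCoprime.pow (Polynomial.isCoprime_X_sub_C_of_isUnit_sub ?_)
    exact isUnit_iff_ne_zero.2 (sub_ne_zero.2 fun h => hij (ht hi hj h))
  have := Polynomial.natDegree_le_of_dvd hd hh
  rw [Polynomial.natDegree_prod_of_monic _ _ fun i _ => (Polynomial.monic_X_sub_C _).pow _] at this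
  simpa using this

lemma eq_of_rep_mem_span {P Q : Plane} (h : P.rep ∈ Submodule.span ℂ {Q.rep}) : P = Q := by
  obtain ⟨a, ha⟩ := Submodule.mem_span_singleton.1 h
  rw [← P.mk_rep, ← Q.mk_rep, Projectivization.mk_eq_mk_iff']
  exact ⟨a, ha⟩

lemma orthogonal_iff_rep (P Q : Plane) : P.orthogonal Q ↔ P.rep ⬝ᵥ Q.rep = 0 := by
  conv_lhs => rw [← P.mk_rep, ← Q.mk_rep]
  exact Projectivization.orthogonal_mk _ _

/-- Every line through a point contains a second point. -/
lemma exists_dotProduct_eq_zero_notMem_span (p : Fin 3 → ℂ) (a : Fin 3 → ℂ) :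
    ∃ z, z ⬝ᵥ a = 0 ∧ z ∉ Submodule.span ℂ {p} := by
  let f : (Fin 3 → ℂ) →ₗ[ℂ] ℂ := (dotProductBilin ℂ ℂ).flip a
  by_contra! h
  have h1 := Submodule.finrank_mono (show LinearMap.ker f ≤ Submodule.span ℂ {p} from fun z hz =>
    h z hz)
  have h2 := LinearMap.finrank_range_add_finrank_ker f
  have h3 := Submodule.finrank_le (LinearMap.range f)
  have h4 := finrank_span_le_card (R := ℂ) ({p} : Set (Fin 3 → ℂ))
  simp at h2 h3 h4
  omega

/-- A tangent direction of a curve at a simple point lies in its tangent line. -/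
lemma dotProduct_eq_zero_of_tangent {F : MvPolynomial (Fin 3) ℂ} {x a : Fin 3 → ℂ}
    (hF : ∃ w, (lineExpand F x w).coeff 1 ≠ 0)
    (ha : ∀ w, w ⬝ᵥ a = 0 → (lineExpand F x w).coeff 1 = 0) {u : Fin 3 → ℂ}
    (hu : (lineExpand F x u).coeff 1 = 0) : u ⬝ᵥ a = 0 := by
  by_contra h
  obtain ⟨w, hw⟩ := hF
  -- If `u` were off the line `a`, subtracting a multiple of `u` would move any `w` onto the line;
  -- the differential, which vanishes on the line and at `u`, would be zero.
  have h1 := ha (w - (w ⬝ᵥ a / u ⬝ᵥ a) • u) (by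
    rw [sub_dotProduct, smul_dotProduct, smul_eq_mul, div_mul_cancel₀ _ h, sub_self])
  rw [coeff_one_lineExpand] at hw hu h1
  apply hw
  simp only [Pi.sub_apply, Pi.smul_apply, smul_eq_mul, sub_mul, Finset.sum_sub_distrib, mul_assoc,
    ← Finset.mul_sum, hu, mul_zero, sub_zero] at h1
  exact h1

variable {r : ℕ} {P : Fin r → Plane}

/-- The total order of the zeros of the residual at the points `P k` is bounded by its degree;
`z` is an auxiliary direction that is not at infinity. -/
lemma exists_chart_residual (hP : Function.Injective P) {F G : MvPolynomial (Fin 3) ℂ} {n m l : ℕ}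
    (hirr : Irreducible F) (hF : F.IsHomogeneous (n + 1)) (hG : G.IsHomogeneous (m + l))
    (hFG : ¬ F ∣ G) (k₀ : Fin r) (hFn : curveMult F (P k₀) = n) (hGm : curveMult G (P k₀) = m)
    (z : Fin 3 → ℂ) (hz : z ∉ Submodule.span ℂ {(P k₀).rep}) :
    ∃ (c : PencilChart (P k₀).rep) (h : Polynomial ℂ), h = c.residual F G n m l ∧ h ≠ 0 ∧
      c.lam z ≠ 0 ∧ (∀ k, k ≠ k₀ → c.lam (P k).rep ≠ 0) ∧
      h.natDegree ≤ (n + 1) * l + m := by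
  obtain ⟨c, hc⟩ := exists_pencilChart (P k₀).rep_nonzero
    (fun o : Option {k // k ≠ k₀} => o.elim z fun k => (P k.1).rep) (by
      rintro (_ | k)
      · exact hz
      · exact fun h => k.2 (hP (eq_of_rep_mem_span h)))
  refine ⟨c, _, rfl, fun h0 => hFG ?_, hc none, fun k hk => hc (some ⟨k, hk⟩),
    c.natDegree_residual_le F G n m l⟩
  exact c.dvd_of_residual_eq_zero hirr hF (hFn ▸ vanishesTo_curveMult F _)
    (hFn ▸ exists_coeff_curveMult_ne_zero hirr.ne_zero _) hG (hGm ▸ vanishesTo_curveMult G _) h0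

/-- Bézout's inequality for a curve of degree `n + 1` with a point of multiplicity `n`, and the
disjointness of the strict transforms in the case of equality. -/
theorem sum_curveMult_mul_le (hP : Function.Injective P) {F G : MvPolynomial (Fin 3) ℂ} {n e : ℕ}
    (hirr : Irreducible F) (hF : F.IsHomogeneous (n + 1)) (hG0 : G ≠ 0) (hG : G.IsHomogeneous e)
    (hFG : ¬ F ∣ G) (k₀ : Fin r) (hFn : curveMult F (P k₀) = n)
    (hF1 : ∀ k, k ≠ k₀ → curveMult F (P k) ≤ 1) :
    ∑ k, curveMult F (P k) * curveMult G (P k) ≤ (n + 1) * e ∧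
      (∑ k, curveMult F (P k) * curveMult G (P k) = (n + 1) * e →
        Disjoint (strictTransform P F) (strictTransform P G)) := by
  obtain ⟨m, hGm⟩ : ∃ m, curveMult G (P k₀) = m := ⟨_, rfl⟩
  obtain ⟨l, rfl⟩ := Nat.exists_eq_add_of_le (hGm ▸ curveMult_le_of_isHomogeneous hG0 hG (P k₀))
  have hFp : VanishesTo F (P k₀).rep n := hFn ▸ vanishesTo_curveMult F _
  have hFne := exists_coeff_curveMult_ne_zero hirr.ne_zero (P k₀)
  rw [hFn] at hFne
  have hGp : VanishesTo G (P k₀).rep m := hGm ▸ vanishesTo_curveMult G _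
  set T : Finset (Fin r) := {k | k ≠ k₀ ∧ eval (P k).rep F = 0} with hT
  -- Away from `k₀` the multiplicity of `F` is 1 on `T` and 0 elsewhere.
  have hsum : ∑ k, curveMult F (P k) * curveMult G (P k) =
      n * m + ∑ k ∈ T, curveMult G (P k) := by
    rw [← Finset.add_sum_erase _ _ (Finset.mem_univ k₀), hFn, hGm]
    congr 1
    have hTs : T ⊆ Finset.univ.erase k₀ := fun k hk => by
      simp only [hT, Finset.mem_filter] at hk
      simp [hk.2.1]
    rw [← Finset.sum_subset hTs]
    · refine Finset.sum_congr rfl fun k hk => ?_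
      simp only [hT, Finset.mem_filter] at hk
      have := (curveMult_pos_iff hirr.ne_zero).2 hk.2.2
      rw [le_antisymm (hF1 k hk.2.1) this, one_mul]
    · intro k hk hkT
      have hk' : k ≠ k₀ := by simpa using hk
      have : ¬ 0 < curveMult F (P k) := fun h => hkT (by
        simp only [hT, Finset.mem_filter]
        exact ⟨Finset.mem_univ _, hk', (curveMult_pos_iff hirr.ne_zero).1 h⟩)
      rw [Nat.eq_zero_of_not_pos this, zero_mul]
  have hinj : ∀ c : PencilChart (P k₀).rep, (∀ k, k ≠ k₀ → c.lam (P k).rep ≠ 0) →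
      Set.InjOn (fun k => c.mu (P k).rep / c.lam (P k).rep) T := by
    intro c hc i hi j hj hij
    simp only [hT, Finset.coe_filter] at hi hj
    exact hP (eq_of_rep_mem_span (c.mem_span_of_parameter_eq hirr hF hFp hFne
      (hc i hi.2.1) hi.2.2 (hc j hj.2.1) hj.2.2 hij))
  have hTmem : ∀ {k}, k ∈ T → k ≠ k₀ ∧ eval (P k).rep F = 0 := fun hk => by
    simpa [hT] using hk
  -- The degree bound of the residual is the Bézout number minus the contribution `n m` of the point
  -- `P k₀`.
  have harith : ∀ N : ℕ, N ≤ (n + 1) * l + m → n * m + N ≤ (n + 1) * (m + l) := by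
    intro N hN
    calc n * m + N ≤ n * m + ((n + 1) * l + m) := by omega
      _ = (n + 1) * (m + l) := by ring
  constructor
  · obtain ⟨z, -, hz⟩ := exists_dotProduct_eq_zero_notMem_span (P k₀).rep 0
    obtain ⟨c, h, rfl, hh, -, hc, hdeg⟩ :=
      exists_chart_residual hP hirr hF hG hFG k₀ hFn hGm z hz
    rw [hsum]
    refine harith _ (le_trans ?_ hdeg)
    refine sum_le_natDegree_of_pow_dvd hh T _ (hinj c hc) _ fun k hk => ?_
    obtain ⟨u, -, hu, -⟩ := c.pow_dvd_residual hirr hF hFp hFne hG hGp (hc k (hTmem hk).1)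
      (hTmem hk).2 (vanishesTo_curveMult G (P k))
    exact hu
  · intro heq
    rw [hsum] at heq
    rw [Set.disjoint_left]
    rintro y ⟨hyF, hyF'⟩ ⟨hyG, hyG'⟩
    -- In the case of equality the zeros over `T` already exhaust the degree of the residual, so one
    -- more zero is absurd.
    have hcontra : ∀ N : ℕ, ∑ k ∈ T, curveMult G (P k) < N → ¬ N ≤ (n + 1) * l + m := by
      intro N hN hN'
      have := harith N hN'
      omega
    -- It suffices to find a zero of the residual at the parameter of some `z` that differs from all
    -- parameters over `T`. The chart is chosen after `z`, so that `z` is not at infinity.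
    have hextra : ∀ z, z ∉ Submodule.span ℂ {(P k₀).rep} → (∀ c : PencilChart (P k₀).rep,
        c.lam z ≠ 0 → (∀ k, k ≠ k₀ → c.lam (P k).rep ≠ 0) →
        (∀ k ∈ T, c.mu (P k).rep / c.lam (P k).rep ≠ c.mu z / c.lam z) ∧
        Polynomial.X - Polynomial.C (c.mu z / c.lam z) ∣ c.residual F G n m l) → False := by
      intro z hz hzc
      obtain ⟨c, h, rfl, hh, hcz, hc, hdeg⟩ :=
        exists_chart_residual hP hirr hF hG hFG k₀ hFn hGm z hz
      obtain ⟨hne, hdvd⟩ := hzc c hcz hc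
      refine hcontra _ ?_ (le_trans (sum_le_natDegree_of_pow_dvd hh T.insertNone
        (fun o => o.elim (c.mu z / c.lam z) fun k => c.mu (P k).rep / c.lam (P k).rep) ?_
        (fun o => o.elim 1 fun k => curveMult G (P k)) ?_) hdeg)
      · rw [Finset.sum_insertNone]
        simp
      · rintro (_ | i) hi (_ | j) hj hij
        · rfl
        · exact absurd hij.symm (hne j (by simpa using hj))
        · exact absurd hij (hne i (by simpa using hi))
        · rw [hinj c hc (by simpa using hi) (by simpa using hj) hij]
      · rintro (_ | k) hk
        · simpa using hdvd
        · have hk : k ∈ T := by simpa using hk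
          obtain ⟨u, -, hu, -⟩ := c.pow_dvd_residual hirr hF hFp hFne hG hGp (hc k (hTmem hk).1)
            (hTmem hk).2 (vanishesTo_curveMult G (P k))
          exact hu
    by_cases hy : ∃ k, y.1.1 = P k
    · obtain ⟨k, hyk⟩ := hy
      rw [hyk] at hyF hyG
      by_cases hk : k = k₀
      -- A common point over `P k₀` is a common tangent direction there; `z` is a second point on
      -- that tangent line.
      · subst hk
        obtain ⟨z, hza, hz⟩ := exists_dotProduct_eq_zero_notMem_span (P k).rep (y.1.2 k).rep
        refine hextra z hz fun c hcz hc => ?_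
        set t := c.mu z / c.lam z with ht
        obtain ⟨s, hs⟩ := c.exists_eq_smul hcz
        rw [← ht] at hs
        have hp0 := (orthogonal_iff_rep _ _).1 (y.2 k).1
        have hW : (c.q₁ + t • c.q₂) ⬝ᵥ (y.1.2 k).rep = 0 := by
          rw [hs, smul_dotProduct, add_dotProduct, smul_dotProduct, hp0, smul_zero, zero_add] at hza
          simpa [hcz] using hza
        have h1 := hyF' k hyk _ hW
        have h2 := hyG' k hyk _ hW
        rw [hFn, restrictLine_eq_lineExpand] at h1
        rw [hGm, restrictLine_eq_lineExpand] at h2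
        refine ⟨fun j hj hjt => ?_, ?_⟩
        -- Tangent parameters are zeros of the leading coefficient of `F`, whereas this coefficient
        -- is nonzero at the parameters of other points of the curve.
        · have := c.coeffPoly_eval_ne_zero hirr hF hFp hFne (hc j (hTmem hj).1) (hTmem hj).2
          rw [hjt, c.eval_coeffPoly] at this
          exact this h1
        · rw [Polynomial.dvd_iff_isRoot]
          exact c.eval_residual_eq_zero h1 h2
      -- Over a simple point `P k` of `F`, a common tangent raises the order of the zero at its
      -- parameter by one.
      · have hkT : k ∈ T := by simp [hT, hk, hyF]
        obtain ⟨z, -, hz⟩ := exists_dotProduct_eq_zero_notMem_span (P k₀).rep 0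
        obtain ⟨c, h, rfl, hh, -, hc, hdeg⟩ :=
          exists_chart_residual hP hirr hF hG hFG k₀ hFn hGm z hz
        have hF1k : curveMult F (P k) = 1 :=
          le_antisymm (hF1 k hk) ((curveMult_pos_iff hirr.ne_zero).2 hyF)
        obtain ⟨u, hu1, -, hu2⟩ := c.pow_dvd_residual hirr hF hFp hFne hG hGp (hc k hk)
            hyF (vanishesTo_curveMult G (P k))
        have hua : u ⬝ᵥ (y.1.2 k).rep = 0 := by
          refine dotProduct_eq_zero_of_tangent
            (hF1k ▸ exists_coeff_curveMult_ne_zero hirr.ne_zero (P k)) (fun w hw => ?_) hu1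
          have := hyF' k hyk w hw
          rwa [hF1k] at this
        have hu3 := hu2 (hyG' k hyk u hua)
        refine hcontra _ ?_ (le_trans (sum_le_natDegree_of_pow_dvd hh T _ (hinj c hc)
          (fun j => curveMult G (P j) + if j = k then 1 else 0) ?_) hdeg)
        · rw [Finset.sum_add_distrib, Finset.sum_ite_eq', if_pos hkT]
          omega
        · intro j hj
          by_cases hjk : j = k
          · subst hjk
            simpa using hu3
          · simp only [hjk, if_false, add_zero]
            obtain ⟨u, -, hu, -⟩ := c.pow_dvd_residual hirr hF hFp hFne hG hGp (hc j (hTmem hj).1)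
              (hTmem hj).2 (vanishesTo_curveMult G (P j))
            exact hu
    -- A common point outside the blown-up points is a new zero, as distinct points of the curve
    -- have distinct parameters.
    · push Not at hy
      refine hextra y.1.1.rep (fun h => hy k₀ (eq_of_rep_mem_span h)) fun c hcz hc => ⟨?_, ?_⟩
      · intro j hj hjt
        exact hy j (eq_of_rep_mem_span (c.mem_span_of_parameter_eq hirr hF hFp hFne hcz hyF
          (hc j (hTmem hj).1) (hTmem hj).2 hjt.symm))
      · obtain ⟨u, -, hu, -⟩ := c.pow_dvd_residual hirr hF hFp hFne hG hGp hcz hyF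
          (vanishesTo_one_iff.2 hyG)
        simpa using hu

end Bezout

/-! ### Linear systems of plane curves -/

section LinearSystem

open MvPolynomial

/-- The homomorphism `F ↦ F (T X)` that exhibits the homogeneous components. -/
def gradingHom : MvPolynomial (Fin 3) ℂ →ₐ[ℂ] Polynomial (MvPolynomial (Fin 3) ℂ) :=
  aeval fun i => Polynomial.C (X i) * Polynomial.X

lemma gradingHom_monomial (s : Fin 3 →₀ ℕ) (c : ℂ) :
    gradingHom (monomial s c) = Polynomial.C (monomial s c) * Polynomial.X ^ s.degree := by
  have h1 : (monomial s c : MvPolynomial (Fin 3) ℂ) =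
      C c * (X 0 ^ s 0 * X 1 ^ s 1 * X 2 ^ s 2) := by
    rw [monomial_eq, Finsupp.prod_fintype _ _ (by simp), Fin.prod_univ_three]
  have h2 : s.degree = s 0 + s 1 + s 2 := by
    rw [Finsupp.degree_eq_sum, Fin.sum_univ_three]
  have h3 : gradingHom (C c) = Polynomial.C (C c) := by
    rw [gradingHom, algHom_C]; rfl
  rw [h1, h2, map_mul, h3]
  simp only [gradingHom, map_mul, map_pow, aeval_X]
  ring

lemma gradingHom_of_isHomogeneous {F : MvPolynomial (Fin 3) ℂ} {e : ℕ} (hF : F.IsHomogeneous e) :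
    gradingHom F = Polynomial.C F * Polynomial.X ^ e := by
  conv_lhs => rw [F.as_sum]
  conv_rhs => rw [F.as_sum]
  rw [map_sum, map_sum, Finset.sum_mul]
  refine Finset.sum_congr rfl fun s hs => ?_
  rw [gradingHom_monomial, hF.degree_eq_sum_deg_support hs]
  rfl

lemma coeff_gradingHom (F : MvPolynomial (Fin 3) ℂ) (k : ℕ) :
    (gradingHom F).coeff k = homogeneousComponent k F := by
  conv_lhs => rw [← F.sum_homogeneousComponent]
  rw [map_sum, Polynomial.finsetSum_coeff]
  simp_rw [fun i => gradingHom_of_isHomogeneous (homogeneousComponent_isHomogeneous i F),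
    Polynomial.coeff_C_mul, Polynomial.coeff_X_pow, mul_ite, mul_one, mul_zero]
  rw [Finset.sum_ite_eq, ite_eq_left_iff]
  intro hk
  rw [homogeneousComponent_eq_zero]
  simpa using hk

lemma gradingHom_ne_zero {F : MvPolynomial (Fin 3) ℂ} (hF : F ≠ 0) : gradingHom F ≠ 0 := by
  intro hz
  apply hF
  rw [← F.sum_homogeneousComponent]
  exact Finset.sum_eq_zero fun k _ => by rw [← coeff_gradingHom, hz, Polynomial.coeff_zero]

lemma isHomogeneous_of_natTrailingDegree_eq {F : MvPolynomial (Fin 3) ℂ}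
    (hF : (gradingHom F).natTrailingDegree = (gradingHom F).natDegree) :
    F.IsHomogeneous (gradingHom F).natDegree := by
  have : F = homogeneousComponent (gradingHom F).natDegree F := by
    conv_lhs => rw [← F.sum_homogeneousComponent]
    refine Finset.sum_eq_single _ (fun k _ hk => ?_) (fun hk => ?_)
    · rw [← coeff_gradingHom]
      rcases lt_or_gt_of_ne hk with hk | hk
      · exact Polynomial.coeff_eq_zero_of_lt_natTrailingDegree (hF ▸ hk)
      · exact Polynomial.coeff_eq_zero_of_natDegree_lt hk
    · refine homogeneousComponent_eq_zero _ _ ?_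
      simpa using hk
  have h := homogeneousComponent_isHomogeneous (gradingHom F).natDegree F
  rwa [← this] at h

/-- The factors of a nonzero form are forms. -/
lemma exists_isHomogeneous_of_mul {A B : MvPolynomial (Fin 3) ℂ} {d : ℕ}
    (h : (A * B).IsHomogeneous d) (h0 : A * B ≠ 0) :
    ∃ a b, A.IsHomogeneous a ∧ B.IsHomogeneous b ∧ a + b = d := by
  have hA := gradingHom_ne_zero (left_ne_zero_of_mul h0)
  have hB := gradingHom_ne_zero (right_ne_zero_of_mul h0)
  have hprod : gradingHom A * gradingHom B = Polynomial.C (A * B) * Polynomial.X ^ d := by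
    rw [← map_mul, gradingHom_of_isHomogeneous h]
  -- Top and lowest degrees are both additive and coincide for the product, hence for each factor.
  have h1 := congrArg Polynomial.natDegree hprod
  have h2 := congrArg Polynomial.natTrailingDegree hprod
  rw [Polynomial.natDegree_mul hA hB, Polynomial.natDegree_C_mul_X_pow _ _ h0] at h1
  rw [Polynomial.natTrailingDegree_mul hA hB, Polynomial.C_mul_X_pow_eq_monomial,
    Polynomial.natTrailingDegree_monomial h0] at h2
  have h3 := Polynomial.natTrailingDegree_le_natDegree (gradingHom A)
  have h4 := Polynomial.natTrailingDegree_le_natDegree (gradingHom B)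
  exact ⟨_, _, isHomogeneous_of_natTrailingDegree_eq (by omega),
    isHomogeneous_of_natTrailingDegree_eq (by omega), h1⟩

lemma finrank_homogeneousSubmodule (d : ℕ) :
    Module.finrank ℂ (homogeneousSubmodule (Fin 3) ℂ d) = (d + 2).choose d := by
  have hs : homogeneousSubmodule (Fin 3) ℂ d =
      restrictSupport ℂ (Finset.finsuppAntidiag (Finset.univ : Finset (Fin 3)) d :
        Set (Fin 3 →₀ ℕ)) := by
    rw [homogeneousSubmodule_eq_finsupp_supported]
    unfold restrictSupport
    congr 1
    ext s
    simp [Finsupp.degree_eq_sum]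
  rw [hs, Module.finrank_eq_card_basis (basisRestrictSupport ℂ _)]
  simp only [Finset.coe_sort_coe, Fintype.card_coe]
  rw [Finset.card_finsuppAntidiag_nat_eq_choose]
  simp [add_comm]

/-- By Euler's relation the vanishing of the three partial derivatives implies that of the form, so
a double point costs three conditions. -/
lemma vanishesTo_two {F : MvPolynomial (Fin 3) ℂ} {d : ℕ} (hF : F.IsHomogeneous (d + 1))
    {x : Fin 3 → ℂ} (h : ∀ i, eval x (pderiv i F) = 0) : VanishesTo F x 2 := by
  have h1 : ∀ w, (lineExpand F x w).coeff 1 = 0 := fun w => by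
    rw [coeff_one_lineExpand]; simp [h]
  -- In the direction `x` itself homogeneity gives `(1 + t) ^ (d + 1) F x`, whose linear coefficient
  -- is `(d + 1) F x`.
  have hexp : lineExpand F x x = Polynomial.C (eval x F) * (1 + Polynomial.X) ^ (d + 1) := by
    refine Polynomial.funext fun t => ?_
    rw [eval_lineExpand_complex]
    have : x + t • x = (1 + t) • x := by rw [add_smul, one_smul]
    rw [this, eval_smul_of_isHomogeneous hF]
    simp [mul_comm]
  have h0 : eval x F = 0 := by
    have := h1 x
    rw [hexp, Polynomial.coeff_C_mul, Polynomial.coeff_one_add_X_pow] at this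
    simp at this
    exact this.resolve_right (by norm_cast)
  intro k hk w
  interval_cases k
  · rw [coeff_zero_lineExpand, h0]
  · exact h1 w

/-- A linear system of plane curves with few conditions is not empty. -/
lemma exists_form_vanishesTo {r : ℕ} (x : Fin r → Fin 3 → ℂ) (d : ℕ) (m : Fin r → ℕ)
    (hm : ∀ k, m k ≤ 2)
    (h : ∑ k, m k * (m k + 1) / 2 < (d + 3).choose (d + 1)) :
    ∃ F : MvPolynomial (Fin 3) ℂ, F ≠ 0 ∧ F.IsHomogeneous (d + 1) ∧
      ∀ k, VanishesTo F (x k) (m k) := by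
  let J := Σ k, Fin (m k * (m k + 1) / 2)
  let f : MvPolynomial (Fin 3) ℂ →ₗ[ℂ] (J → ℂ) := LinearMap.pi fun j =>
    -- The number `m (m + 1) / 2` of conditions is 0, 1 or 3. For `m = 1` the condition is the value
    -- at the point, for `m = 2` the three partial derivatives, and for `m = 0` there is no index.
    if m j.1 = 1 then (aeval (x j.1) : MvPolynomial (Fin 3) ℂ →ₐ[ℂ] ℂ).toLinearMap
    else (aeval (x j.1) : MvPolynomial (Fin 3) ℂ →ₐ[ℂ] ℂ).toLinearMap ∘ₗ
      (pderiv (Fin.ofNat 3 j.2)).toLinearMap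
  let g := f ∘ₗ (homogeneousSubmodule (Fin 3) ℂ (d + 1)).subtype
  have : Module.Finite ℂ (homogeneousSubmodule (Fin 3) ℂ (d + 1)) :=
    Module.Finite.iff_fg.2 (homogeneousSubmodule_fg _ _ _)
  have hker : LinearMap.ker g ≠ ⊥ := by
    refine LinearMap.ker_ne_bot_of_finrank_lt ?_
    rw [finrank_homogeneousSubmodule, Module.finrank_fintype_fun_eq_card, Fintype.card_sigma]
    simpa using h
  obtain ⟨F, hF, hF0⟩ := Submodule.exists_mem_ne_zero_of_ne_bot hker
  refine ⟨F.1, fun h0 => hF0 (Subtype.ext h0), F.2, fun k => ?_⟩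
  have hFj : ∀ j : J, f F.1 j = 0 := fun j => congrFun hF j
  have hk := hm k
  rcases (by omega : m k = 0 ∨ m k = 1 ∨ m k = 2) with hk | hk | hk
  · rw [hk]; intro j hj; omega
  · rw [hk, vanishesTo_one_iff]
    simpa [f, hk] using hFj ⟨k, ⟨0, by rw [hk]; norm_num⟩⟩
  · rw [hk]
    refine vanishesTo_two F.2 fun i => ?_
    have := hFj ⟨k, ⟨i, by rw [hk]; omega⟩⟩
    simpa [f, hk] using this

/-- A linear form is the scalar product with a nonzero vector. -/
lemma exists_eval_eq_dotProduct {F : MvPolynomial (Fin 3) ℂ} (hF : F.IsHomogeneous 1)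
    (h0 : F ≠ 0) : ∃ a : Fin 3 → ℂ, a ≠ 0 ∧ ∀ x, eval x F = x ⬝ᵥ a := by
  have : F ∈ homogeneousSubmodule (Fin 3) ℂ 1 := hF
  rw [homogeneousSubmodule_one_eq_span_X, Submodule.mem_span_range_iff_exists_fun] at this
  obtain ⟨a, rfl⟩ := this
  refine ⟨a, ?_, fun x => ?_⟩
  · rintro rfl
    simp at h0
  · simp [dotProduct, smul_eval, mul_comm]

variable {r : ℕ} {P : Fin r → Plane}

lemma sum_curveMult_linear_le (hP : GeneralPosition P) {F : MvPolynomial (Fin 3) ℂ}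
    (hF : F.IsHomogeneous 1) (h0 : F ≠ 0) : ∑ k, curveMult F (P k) ≤ 2 := by
  obtain ⟨a, ha0, ha⟩ := exists_eval_eq_dotProduct hF h0
  by_contra! hlt
  set T : Finset (Fin r) := {k | 0 < curveMult F (P k)} with hT
  have hcard : 2 < T.card := by
    refine hlt.trans_le ?_
    rw [Finset.card_filter]
    refine Finset.sum_le_sum fun k _ => ?_
    have := curveMult_le_of_isHomogeneous h0 hF (P k)
    split_ifs <;> omega
  obtain ⟨i, j, k, hi, hj, hk, hij, hik, hjk⟩ := Finset.two_lt_card_iff.1 hcard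
  have horth : ∀ i ∈ T, (P i).orthogonal (Projectivization.mk ℂ a ha0) := by
    intro i hi
    simp only [hT, Finset.mem_filter, curveMult_pos_iff h0, ha] at hi
    conv => rw [← (P i).mk_rep]
    exact (Projectivization.orthogonal_mk _ _).2 hi.2
  exact hP.not_collinear i j k hij hik hjk ⟨_, horth i hi, horth j hj, horth k hk⟩

/-- The line through two of the points. -/
lemma exists_line_through (hP : GeneralPosition P) {i j : Fin r} (hij : i ≠ j) :
    ∃ F : MvPolynomial (Fin 3) ℂ, F ≠ 0 ∧ F.IsHomogeneous 1 ∧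
      ∀ k, curveMult F (P k) = if k = i ∨ k = j then 1 else 0 := by
  have hsum : ∑ k : Fin r, (if k = i ∨ k = j then 1 else 0) = 2 := by
    rw [← Finset.card_filter, Finset.filter_or, Finset.filter_eq', Finset.filter_eq',
      if_pos (Finset.mem_univ _), if_pos (Finset.mem_univ _)]
    exact Finset.card_pair hij
  obtain ⟨F, h0, hF, hv⟩ := exists_form_vanishesTo (fun k => (P k).rep) 0
    (fun k => if k = i ∨ k = j then 1 else 0) (fun k => by split_ifs <;> norm_num) (by
      have : ∀ k : Fin r, (if k = i ∨ k = j then 1 else 0) * ((if k = i ∨ k = j then 1 else 0) + 1) / 2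
        = if k = i ∨ k = j then 1 else 0 := fun k => by split_ifs <;> norm_num
      simp_rw [this, hsum]
      decide)
  refine ⟨F, h0, hF, ?_⟩
  have hle := sum_curveMult_linear_le hP hF h0
  have hge : ∀ k ∈ Finset.univ, (if k = i ∨ k = j then 1 else 0) ≤ curveMult F (P k) :=
    fun k _ => (le_curveMult_iff h0).2 (hv k)
  -- The prescribed multiplicities already add up to the maximum 2, so none of them can be exceeded.
  have heq := (Finset.sum_eq_sum_iff_of_le hge).1
    (le_antisymm (Finset.sum_le_sum hge) (hsum ▸ hle))
  exact fun k => (heq k (Finset.mem_univ k)).symm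

/-- An irreducible curve of degree at least two meets a line through two of the points with total
multiplicity at most its degree. -/
lemma curveMult_add_le (hP : GeneralPosition P) (hr : 3 ≤ r) {G : MvPolynomial (Fin 3) ℂ} {e : ℕ}
    (hirr : Irreducible G) (hG : G.IsHomogeneous e) (he : 2 ≤ e) {i j : Fin r} (hij : i ≠ j) :
    curveMult G (P i) + curveMult G (P j) ≤ e := by
  obtain ⟨F, h0, hF, hm⟩ := exists_line_through hP hij
  -- A third point, off the line, plays the role of the point of multiplicity `n = 0` on a curve of
  -- degree 1.
  obtain ⟨k₀, hk₀⟩ : ∃ k₀ : Fin r, k₀ ∉ ({i, j} : Finset (Fin r)) := by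
    by_contra! h
    have := Finset.card_le_card (fun k _ => h k : (Finset.univ : Finset (Fin r)) ⊆ {i, j})
    rw [Finset.card_univ, Fintype.card_fin, Finset.card_pair hij] at this
    omega
  simp only [Finset.mem_insert, Finset.mem_singleton] at hk₀
  have hFirr := irreducible_of_isHomogeneous_one hF h0
  have hdvd : ¬ F ∣ G := fun hd => by
    obtain ⟨k, hk⟩ := (hFirr.associated_of_dvd hirr hd).symm.dvd
    have h1 := hF.totalDegree h0
    have hk0 : k ≠ 0 := by rintro rfl; simp at hk; exact h0 hk
    rw [hk, totalDegree_mul_of_isDomain hirr.ne_zero hk0, hG.totalDegree hirr.ne_zero] at h1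
    omega
  have := (sum_curveMult_mul_le hP.injective (n := 0) hFirr hF hirr.ne_zero hG hdvd k₀
    (by rw [hm, if_neg hk₀]) (fun k _ => by rw [hm]; split_ifs <;> norm_num)).1
  simp_rw [hm, ite_mul, one_mul, zero_mul, zero_add] at this
  rw [one_mul] at this
  refine le_trans ?_ this
  rw [← Finset.sum_filter, Finset.filter_or, Finset.filter_eq', Finset.filter_eq',
      if_pos (Finset.mem_univ _), if_pos (Finset.mem_univ _)]
  exact (Finset.sum_pair (f := fun k => curveMult G (P k)) hij).ge

/-- A reducible form is a product of forms of smaller degree. -/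
lemma exists_mul_of_not_irreducible {F : MvPolynomial (Fin 3) ℂ} {d : ℕ}
    (hF : F.IsHomogeneous d) (h0 : F ≠ 0) (hd : d ≠ 0) (hirr : ¬ Irreducible F) :
    ∃ (A B : MvPolynomial (Fin 3) ℂ) (a b : ℕ), F = A * B ∧ A ≠ 0 ∧ B ≠ 0 ∧
      A.IsHomogeneous a ∧ B.IsHomogeneous b ∧ 1 ≤ a ∧ a ≤ b ∧ a + b = d := by
  have hunit : ¬ IsUnit F := fun hu => by
    rw [isUnit_iff_totalDegree_of_isReduced] at hu
    rw [hF.totalDegree h0] at hu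
    exact hd hu.2
  obtain ⟨A, B, hA, hB, rfl⟩ : ∃ A B, ¬ IsUnit A ∧ ¬ IsUnit B ∧ F = A * B := by
    by_contra! h
    refine hirr ⟨hunit, fun A B hAB => ?_⟩
    by_contra! hu
    exact h A B hu.1 hu.2 hAB
  have hA0 := left_ne_zero_of_mul h0
  have hB0 := right_ne_zero_of_mul h0
  obtain ⟨a, b, ha, hb, hab⟩ := exists_isHomogeneous_of_mul hF h0
  have hpos : ∀ {A : MvPolynomial (Fin 3) ℂ} {a : ℕ}, A.IsHomogeneous a → A ≠ 0 → ¬ IsUnit A →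
      1 ≤ a := by
    intro A a ha hA0 hA
    by_contra! h
    obtain rfl : a = 0 := by omega
    rw [← totalDegree_zero_iff_isHomogeneous, totalDegree_eq_zero_iff_eq_C] at ha
    rw [ha] at hA hA0
    exact hA ((isUnit_iff_ne_zero.2 fun h => hA0 (by rw [h, C_0])).map C)
  have h1 := hpos ha hA0 hA
  have h2 := hpos hb hB0 hB
  rcases le_total a b with h | h
  · exact ⟨A, B, a, b, rfl, hA0, hB0, ha, hb, h1, h, hab⟩
  · exact ⟨B, A, b, a, mul_comm _ _, hB0, hA0, hb, ha, h2, h, by omega⟩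

lemma sum_curveMult_mul_le_add {A B : MvPolynomial (Fin 3) ℂ} (hA : A ≠ 0) (hB : B ≠ 0) :
    ∑ k, curveMult (A * B) (P k) ≤ ∑ k, curveMult A (P k) + ∑ k, curveMult B (P k) := by
  rw [← Finset.sum_add_distrib]
  exact Finset.sum_le_sum fun k _ => curveMult_mul_le hA hB (P k)

/-- A product of two lines has total multiplicity at most 4. An irreducible conic with a double
point at one `P i` passes through no other, by `curveMult_add_le`; if all its points are simple,
there are at most five. -/
lemma sum_curveMult_quadric_le (hP : GeneralPosition P) (hr : 3 ≤ r) {F : MvPolynomial (Fin 3) ℂ}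
    (hF : F.IsHomogeneous 2) (h0 : F ≠ 0) : ∑ k, curveMult F (P k) ≤ 5 := by
  by_cases hirr : Irreducible F
  · by_cases h2 : ∃ i, 2 ≤ curveMult F (P i)
    · obtain ⟨i, hi⟩ := h2
      rw [Finset.sum_eq_single i]
      · have := curveMult_le_of_isHomogeneous h0 hF (P i)
        omega
      · intro j _ hj
        have := curveMult_add_le hP hr hirr hF le_rfl hj
        omega
      · simp
    · push Not at h2
      by_contra! hlt
      set T : Finset (Fin r) := {k | 0 < curveMult F (P k)} with hT
      have hcard : 6 ≤ T.card := by
        refine (Nat.succ_le_of_lt hlt).trans ?_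
        rw [Finset.card_filter]
        refine Finset.sum_le_sum fun k _ => ?_
        have := h2 k
        split_ifs <;> omega
      obtain ⟨S, hS, hS6⟩ := Finset.exists_subset_card_eq hcard
      refine hP.not_on_conic S hS6 ⟨F, h0, hF, fun i hi => ?_⟩
      have := hS hi
      simp only [hT, Finset.mem_filter] at this
      exact (curveMult_pos_iff h0).1 this.2
  · obtain ⟨A, B, a, b, rfl, hA0, hB0, hA, hB, ha, hab, hsum⟩ :=
      exists_mul_of_not_irreducible hF h0 two_ne_zero hirr
    obtain rfl : a = 1 := by omega
    obtain rfl : b = 1 := by omega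
    have h1 := sum_curveMult_linear_le hP hA hA0
    have h2 := sum_curveMult_linear_le hP hB hB0
    have h3 := sum_curveMult_mul_le_add (P := P) hA0 hB0
    omega

/-- The conic through five of the points. -/
lemma exists_conic_through (hP : GeneralPosition P) (hr : 3 ≤ r) {S : Finset (Fin r)}
    (hS : S.card = 5) : ∃ F : MvPolynomial (Fin 3) ℂ, Irreducible F ∧ F.IsHomogeneous 2 ∧
      ∀ k, curveMult F (P k) = if k ∈ S then 1 else 0 := by
  have hsum : ∑ k : Fin r, (if k ∈ S then 1 else 0) = 5 := by
    rw [← Finset.card_filter, Finset.filter_mem_eq_inter, Finset.univ_inter, hS]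
  obtain ⟨F, h0, hF, hv⟩ := exists_form_vanishesTo (fun k => (P k).rep) 1
    (fun k => if k ∈ S then 1 else 0) (fun k => by split_ifs <;> norm_num) (by
      have : ∀ k : Fin r, (if k ∈ S then 1 else 0) * ((if k ∈ S then 1 else 0) + 1) / 2
        = if k ∈ S then 1 else 0 := fun k => by split_ifs <;> norm_num
      simp_rw [this, hsum]
      decide)
  have hge : ∀ k ∈ Finset.univ, (if k ∈ S then 1 else 0) ≤ curveMult F (P k) :=
    fun k _ => (le_curveMult_iff h0).2 (hv k)
  have hge' := Finset.sum_le_sum hge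
  rw [hsum] at hge'
  have hirr : Irreducible F := by
    -- Two lines have total multiplicity at most 4, but 5 is prescribed.
    by_contra hirr
    obtain ⟨A, B, a, b, rfl, hA0, hB0, hA, hB, ha, hab, hsum⟩ :=
      exists_mul_of_not_irreducible hF h0 two_ne_zero hirr
    obtain rfl : a = 1 := by omega
    obtain rfl : b = 1 := by omega
    have h1 := sum_curveMult_linear_le hP hA hA0
    have h2 := sum_curveMult_linear_le hP hB hB0
    have h3 := sum_curveMult_mul_le_add (P := P) hA0 hB0
    omega
  refine ⟨F, hirr, hF, ?_⟩
  have hle := sum_curveMult_quadric_le hP hr hF h0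
  have heq := (Finset.sum_eq_sum_iff_of_le hge).1
    (le_antisymm (Finset.sum_le_sum hge) (hsum ▸ hle))
  exact fun k => (heq k (Finset.mem_univ k)).symm

/-- The cubic through seven points which is singular at one of them. -/
lemma exists_cubic_through {P : Fin 7 → Plane} (hP : GeneralPosition P) (i : Fin 7) :
    ∃ F : MvPolynomial (Fin 3) ℂ, Irreducible F ∧ F.IsHomogeneous 3 ∧
      ∀ k, curveMult F (P k) = if k = i then 2 else 1 := by
  have hsum : ∑ k : Fin 7, (if k = i then 2 else 1) = 8 := by revert i; decide
  -- One double and six simple points impose `3 + 6 = 9` conditions on the 10-dimensional space of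
  -- cubic forms.
  obtain ⟨F, h0, hF, hv⟩ := exists_form_vanishesTo (fun k => (P k).rep) 2
    (fun k => if k = i then 2 else 1) (fun k => by split_ifs <;> norm_num) (by
      revert i; decide)
  have hge : ∀ k, (if k = i then 2 else 1) ≤ curveMult F (P k) :=
    fun k => (le_curveMult_iff h0).2 (hv k)
  have hge' := Finset.sum_le_sum fun k (_ : k ∈ Finset.univ) => hge k
  rw [hsum] at hge'
  have hirr : Irreducible F := by
    -- A line and a quadric have total multiplicity at most `2 + 5 = 7`, but 8 is prescribed.
    by_contra hirr
    obtain ⟨A, B, a, b, rfl, hA0, hB0, hA, hB, ha, hab, hsum⟩ :=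
      exists_mul_of_not_irreducible hF h0 three_ne_zero hirr
    obtain rfl : a = 1 := by omega
    obtain rfl : b = 2 := by omega
    have h1 := sum_curveMult_linear_le hP hA hA0
    have h2 := sum_curveMult_quadric_le hP (by norm_num) hB hB0
    have h3 := sum_curveMult_mul_le_add (P := P) hA0 hB0
    omega
  refine ⟨F, hirr, hF, fun k => ?_⟩
  have hi := hge i
  rw [if_pos rfl] at hi
  -- The line through `P i` and another of the points bounds the sum of the two multiplicities by 3,
  -- so the lower bounds 2 and 1 are attained.
  by_cases hk : k = i
  · subst hk
    obtain ⟨j, hj⟩ : ∃ j : Fin 7, k ≠ j := (exists_ne k).imp fun _ h => h.symm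
    have h1 := curveMult_add_le hP (by norm_num) hirr hF (by norm_num) hj
    have h2 := hge j
    rw [if_neg hj.symm] at h2
    rw [if_pos rfl]
    omega
  · have h1 := curveMult_add_le hP (by norm_num) hirr hF (by norm_num) hk
    have h2 := hge k
    rw [if_neg hk] at h2 ⊢
    omega

end LinearSystem

/-! ### Irreducible curves on the blow-up and their classes -/

section Curves

open MvPolynomial

variable {r : ℕ} {P : Fin r → Plane}

lemma isCurve_iff {L : Set (BlowUp P)} {D : DivClass r} :
    IsCurve P L D ↔
      (∃ i, L = exceptionalCurve P i ∧ D = ⟨0, fun k => if k = i then -1 else 0⟩) ∨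
      ∃ (F : MvPolynomial (Fin 3) ℂ) (d : ℕ), Irreducible F ∧ F.IsHomogeneous d ∧
        L = strictTransform P F ∧ D = ⟨d, fun k => curveMult F (P k)⟩ := by
  constructor
  · rintro (i | ⟨F, d, hF, hd⟩)
    · exact Or.inl ⟨i, rfl, rfl⟩
    · exact Or.inr ⟨F, d, hF, hd, rfl, rfl⟩
  · rintro (⟨i, rfl, rfl⟩ | ⟨F, d, hF, hd, rfl, rfl⟩)
    · exact .exceptional i
    · exact .strict F d hF hd

lemma coeff_restrictLine_mul_C (F : MvPolynomial (Fin 3) ℂ) (c : ℂ) (x w : Fin 3 → ℂ) (k : ℕ) :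
    (restrictLine (F * C c) x w).coeff k = (restrictLine F x w).coeff k * c := by
  rw [restrictLine_eq_lineExpand, lineExpand_mul, restrictLine_eq_lineExpand]
  have : lineExpand (C c) x w = Polynomial.C c := by simp [lineExpand]
  rw [this, Polynomial.coeff_mul_C]

lemma exists_eq_mul_C_of_associated {F G : MvPolynomial (Fin 3) ℂ} (h : Associated F G) :
    ∃ c : ℂ, c ≠ 0 ∧ G = F * C c := by
  obtain ⟨u, rfl⟩ := h
  obtain ⟨c, hc, hu⟩ := isUnit_iff_eq_C_of_isReduced.1 u.isUnit
  exact ⟨c, hc.ne_zero, by rw [hu]⟩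

lemma curveMult_eq_of_associated {F G : MvPolynomial (Fin 3) ℂ} (h : Associated F G) (p : Plane) :
    curveMult F p = curveMult G p := by
  obtain ⟨c, hc, rfl⟩ := exists_eq_mul_C_of_associated h
  simp [curveMult, coeff_restrictLine_mul_C, hc]

lemma strictTransform_eq_of_associated {F G : MvPolynomial (Fin 3) ℂ} (h : Associated F G) :
    strictTransform P F = strictTransform P G := by
  have hm := curveMult_eq_of_associated h
  obtain ⟨c, hc, rfl⟩ := exists_eq_mul_C_of_associated h
  ext y
  simp [strictTransform, coeff_restrictLine_mul_C, hc, ← hm]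

lemma degree_eq_of_associated {F G : MvPolynomial (Fin 3) ℂ} (h : Associated F G) {d e : ℕ}
    (hF : F.IsHomogeneous d) (hG : G.IsHomogeneous e) (h0 : F ≠ 0) : d = e := by
  obtain ⟨c, hc, rfl⟩ := exists_eq_mul_C_of_associated h
  have := hF.mul (isHomogeneous_C (Fin 3) c)
  exact this.inj_right hG (mul_ne_zero h0 (by simpa using hc))

/-- Through any two points there is a line. -/
lemma exists_orthogonal (Q R : Plane) : ∃ a : Plane, Q.orthogonal a ∧ R.orthogonal a := by
  classical
  by_cases h : Q = R
  · obtain ⟨z, hz, hz0⟩ := exists_dotProduct_eq_zero_notMem_span 0 Q.rep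
    have hz0 : z ≠ 0 := by simpa using hz0
    have : Q.orthogonal (Projectivization.mk ℂ z hz0) := by
      conv => rw [← Q.mk_rep]
      rw [Projectivization.orthogonal_mk, dotProduct_comm]; exact hz
    exact ⟨_, this, h ▸ this⟩
  · exact ⟨Q.cross R, Projectivization.orthogonal_comm.1 (Projectivization.cross_orthogonal_left h),
      Projectivization.orthogonal_comm.1 (Projectivization.cross_orthogonal_right h)⟩

lemma exists_blowUp_point (P : Fin r → Plane) (Q : Plane) : ∃ y : BlowUp P, y.1.1 = Q := by
  choose a ha using fun k => exists_orthogonal (P k) Q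
  exact ⟨⟨(Q, a), ha⟩, rfl⟩

/-- A form that vanishes at the points `P k` but not on the curve `F = 0`. -/
lemma exists_vanishing_not_dvd (P : Fin r → Plane) {F : MvPolynomial (Fin 3) ℂ}
    (hF : Irreducible F) : ∃ H : MvPolynomial (Fin 3) ℂ, ¬ F ∣ H ∧
      ∀ k, ∀ x ∈ Submodule.span ℂ {(P k).rep}, eval x H = 0 := by
  have h1 : ∀ k, ∃ f : Module.Dual ℂ (Fin 3 → ℂ), f (P k).rep = 0 ∧ ¬ F ∣ linForm f := by
    intro k
    obtain ⟨c, -⟩ := exists_pencilChart (P k).rep_nonzero (ι := Empty) (fun i => i.elim)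
      (fun i => i.elim)
    by_contra! h
    have hl := h c.lam c.lam_p
    have hm := h c.mu c.mu_p
    have hlam : linForm c.lam ≠ 0 := linForm_ne_zero fun h0 => by
      have := c.lam_q₁; rw [h0] at this; simp at this
    -- If `F` divided both linear forms of the chart, the first would divide the second; but at `q₂`
    -- they take the values 0 and 1.
    have ha := hF.associated_of_dvd
      (irreducible_of_isHomogeneous_one (isHomogeneous_linForm _) hlam) hl
    obtain ⟨k, hk⟩ := ha.symm.dvd.trans hm
    have := congrArg (eval c.q₂) hk
    rw [map_mul, eval_linForm, eval_linForm, c.lam_q₂, c.mu_q₂] at this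
    simp at this
  choose f hf hFf using h1
  refine ⟨∏ k, linForm (f k), fun h => ?_, fun k x hx => ?_⟩
  · obtain ⟨k, -, hk⟩ := (Prime.dvd_finsetProd_iff hF.prime _).1 h
    exact hFf k hk
  · rw [map_prod]
    refine Finset.prod_eq_zero (Finset.mem_univ k) ?_
    obtain ⟨a, rfl⟩ := Submodule.mem_span_singleton.1 hx
    rw [eval_linForm, map_smul, hf, smul_zero]

/-- If the strict transform of `F = 0` lies over the blown-up points and the zeros of `G`, then
`F` divides `G`. -/
lemma dvd_of_strictTransform [NeZero r] {F G : MvPolynomial (Fin 3) ℂ} {d e : ℕ}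
    (hF : Irreducible F) (hFd : F.IsHomogeneous d) (hGe : G.IsHomogeneous e)
    (h : ∀ y ∈ strictTransform P F, (∃ k, y.1.1 = P k) ∨ eval y.1.1.rep G = 0) : F ∣ G := by
  -- The hypothesis says nothing about `G` at the blown-up points; the factor `H` vanishes there and
  -- is not divisible by `F`.
  obtain ⟨H, hH, hHP⟩ := exists_vanishing_not_dvd P hF
  refine (hF.prime.dvd_or_dvd (hF.dvd_of_forall_eval_eq_zero (G := G * H) fun x hx => ?_)
    ).resolve_right hH
  rw [map_mul]
  by_cases hxP : ∃ k, x ∈ Submodule.span ℂ {(P k).rep}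
  · obtain ⟨k, hk⟩ := hxP
    rw [hHP k x hk, mul_zero]
  · push Not at hxP
    -- The zero vector lies in the span of any point; there is one since `r ≠ 0`.
    have hx0 : x ≠ 0 := by
      rintro rfl
      exact hxP 0 (Submodule.zero_mem _)
    set Q : Plane := Projectivization.mk ℂ x hx0 with hQ
    obtain ⟨a, ha⟩ := Projectivization.exists_smul_eq_mk_rep ℂ x hx0
    have ha' : x = ((a⁻¹ : ℂˣ) : ℂ) • Q.rep := by
      rw [hQ, ← ha, Units.smul_def, smul_smul]; simp
    have hQP : ∀ k, Q ≠ P k := by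
      intro k hk
      refine hxP k ?_
      rw [← hk, ha']
      exact Submodule.smul_mem _ _ (Submodule.mem_span_singleton_self _)
    obtain ⟨y, hy⟩ := exists_blowUp_point P Q
    -- Away from the blown-up points the tangent condition is vacuous.
    have hyF : y ∈ strictTransform P F := by
      refine ⟨?_, fun k hk => absurd (hy ▸ hk) (hQP k)⟩
      rw [hy, hQ, ← ha, Units.smul_def, eval_smul_of_isHomogeneous hFd, hx, mul_zero]
    rcases h y hyF with ⟨k, hk⟩ | hG
    · exact absurd (hy ▸ hk) (hQP k)
    · rw [hy] at hG
      rw [ha', eval_smul_of_isHomogeneous hGe, hG, mul_zero, zero_mul]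

lemma associated_of_strictTransform_eq [NeZero r] {F G : MvPolynomial (Fin 3) ℂ} {d e : ℕ}
    (hF : Irreducible F) (hFd : F.IsHomogeneous d) (hG : Irreducible G) (hGe : G.IsHomogeneous e)
    (h : strictTransform P F = strictTransform P G) : Associated F G :=
  hF.associated_of_dvd hG (dvd_of_strictTransform (P := P) hF hFd hGe fun _ hy =>
    Or.inr (h ▸ hy : _ ∈ strictTransform P G).1)

lemma strictTransform_ne_exceptionalCurve [NeZero r] {F : MvPolynomial (Fin 3) ℂ} {d : ℕ}
    (hF : Irreducible F) (hFd : F.IsHomogeneous d) (i : Fin r) :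
    strictTransform P F ≠ exceptionalCurve P i := by
  intro h
  -- With the constant form 1 in place of `G`, the irreducible `F` would divide 1.
  refine hF.not_isUnit (isUnit_of_dvd_one (dvd_of_strictTransform (P := P) hF hFd
    (isHomogeneous_one (Fin 3) ℂ) fun y hy => Or.inl ⟨i, ?_⟩))
  rw [h] at hy
  exact hy

/-- An irreducible curve determines its class. -/
theorem IsCurve.class_eq [NeZero r] (hP : Function.Injective P) {L : Set (BlowUp P)}
    {D D' : DivClass r} (h : IsCurve P L D) (h' : IsCurve P L D') : D = D' := by
  rw [isCurve_iff] at h h'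
  rcases h with ⟨i, rfl, rfl⟩ | ⟨F, d, hF, hd, rfl, rfl⟩ <;>
    rcases h' with ⟨j, hj, rfl⟩ | ⟨G, e, hG, he, hj, rfl⟩
  · obtain ⟨y, hy⟩ := exists_blowUp_point P (P i)
    have : y ∈ exceptionalCurve P j := hj ▸ hy
    obtain rfl : i = j := hP (hy.symm.trans this)
    rfl
  · exact absurd hj.symm (strictTransform_ne_exceptionalCurve hG he i)
  · exact absurd hj (strictTransform_ne_exceptionalCurve hF hd j)
  · have ha := associated_of_strictTransform_eq hF hd hG he hj
    rw [degree_eq_of_associated ha hd he hF.ne_zero]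
    simp_rw [curveMult_eq_of_associated ha]

end Curves

/-! ### Classes of lines -/

section Classes

/-- The classes of the lines on a del Pezzo surface of degree 2 or 3. -/
inductive LineShape {r : ℕ} : DivClass r → Prop
  | exceptional (i : Fin r) : LineShape ⟨0, fun k => if k = i then -1 else 0⟩
  | line (i j : Fin r) (h : i ≠ j) : LineShape ⟨1, fun k => if k = i ∨ k = j then 1 else 0⟩
  | conic (S : Finset (Fin r)) (h : S.card = 5) : LineShape ⟨2, fun k => if k ∈ S then 1 else 0⟩
  | cubic (h : r = 7) (i : Fin r) : LineShape ⟨3, fun k => if k = i then 2 else 1⟩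

lemma sum_ite_pair {r : ℕ} {i j : Fin r} (h : i ≠ j) :
    ∑ k : Fin r, (if k = i ∨ k = j then (1 : ℤ) else 0) = 2 := by
  rw [← Finset.sum_filter, Finset.filter_or, Finset.filter_eq', Finset.filter_eq',
    if_pos (Finset.mem_univ _), if_pos (Finset.mem_univ _)]
  exact Finset.sum_pair (f := fun _ => (1 : ℤ)) h

lemma sum_ite_mem {r : ℕ} (S : Finset (Fin r)) :
    ∑ k : Fin r, (if k ∈ S then (1 : ℤ) else 0) = S.card := by
  rw [← Finset.sum_filter]; simp

lemma LineShape.inter_self {r : ℕ} {D : DivClass r} (h : LineShape D) : D.inter D = -1 := by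
  rcases h with i | ⟨i, j, h⟩ | ⟨S, h⟩ | ⟨rfl, i⟩
  · simp [DivClass.inter]
  · have := sum_ite_pair h
    simp only [DivClass.inter, mul_ite, mul_one, mul_zero] at *
    have e : ∀ k : Fin r, (if k = i ∨ k = j then if k = i ∨ k = j then (1 : ℤ) else 0 else 0) =
      if k = i ∨ k = j then 1 else 0 := fun k => by split_ifs <;> rfl
    simp_rw [e, this]; norm_num
  · have := sum_ite_mem S
    simp only [DivClass.inter, mul_ite, mul_one, mul_zero] at *
    have e : ∀ k : Fin r, (if k ∈ S then if k ∈ S then (1 : ℤ) else 0 else 0) =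
      if k ∈ S then 1 else 0 := fun k => by split_ifs <;> rfl
    simp_rw [e, this, h]; norm_num
  · simp only [DivClass.inter]; revert i; decide

lemma LineShape.canonical_inter {r : ℕ} {D : DivClass r} (h : LineShape D) :
    (canonicalClass r).inter D = -1 := by
  rcases h with i | ⟨i, j, h⟩ | ⟨S, h⟩ | ⟨rfl, i⟩
  · simp [DivClass.inter, canonicalClass]
  · have := sum_ite_pair h
    simp only [DivClass.inter, canonicalClass, neg_mul, one_mul, Finset.sum_neg_distrib, this]
    norm_num
  · have := sum_ite_mem S
    simp only [DivClass.inter, canonicalClass, neg_mul, one_mul, Finset.sum_neg_distrib, this, h]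
    norm_num
  · simp only [DivClass.inter, canonicalClass]; revert i; decide

/-- The product of two consecutive integers is never negative, so every summand vanishes. -/
lemma eq_ite_of_sum_mul_sub_one {r : ℕ} {m : Fin r → ℤ} (h : ∑ k, m k * (m k - 1) = 0) (k : Fin r) :
    m k = 0 ∨ m k = 1 := by
  have hnn : ∀ k ∈ Finset.univ, 0 ≤ m k * (m k - 1) := fun k _ => by
    rcases le_or_gt (m k) 0 with h | h
    · exact mul_nonneg_of_nonpos_of_nonpos h (by omega)
    · exact mul_nonneg h.le (by omega)
  have := (Finset.sum_eq_zero_iff_of_nonneg hnn).1 h k (Finset.mem_univ k)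
  rcases mul_eq_zero.1 this with h | h
  · exact Or.inl h
  · exact Or.inr (by omega)

/-- The numerical classification of the classes of lines with non-negative multiplicities. -/
lemma lineShape_of_inter {r : ℕ} (hr : r ≤ 7) {D : DivClass r} (hd : 0 ≤ D.deg)
    (hm : ∀ k, 0 ≤ D.mult k) (h1 : D.inter D = -1) (h2 : (canonicalClass r).inter D = -1) :
    LineShape D := by
  obtain ⟨d, m⟩ := D
  simp only [DivClass.inter, canonicalClass, neg_mul, one_mul, Finset.sum_neg_distrib] at *
  have hs : ∑ k, m k = 3 * d - 1 := by omega
  have hq : ∑ k, m k * m k = d * d + 1 := by omega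
  -- Cauchy–Schwarz for the multiplicities; it amounts to `d ^ 2 - 3 d - 3 ≤ 0`, which excludes `d ≥
  -- 4`.
  have hc : (3 * d - 1) ^ 2 ≤ 7 * (d * d + 1) := by
    have := sq_sum_le_card_mul_sum_sq (s := (Finset.univ : Finset (Fin r))) (f := m)
    simp only [pow_two (m _), hs, hq, Finset.card_univ, Fintype.card_fin] at this
    refine this.trans (mul_le_mul_of_nonneg_right (by exact_mod_cast hr) (by positivity))
  have hd3 : d ≤ 3 := by nlinarith
  -- The right side is `(d - 1)(d - 2)`: it is 0 for `d = 1, 2`, where all multiplicities are 0 or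
  -- 1, and 2 for `d = 3`.
  have hsq : ∑ k, m k * (m k - 1) = d * d + 1 - (3 * d - 1) := by
    rw [← hq, ← hs, ← Finset.sum_sub_distrib]
    exact Finset.sum_congr rfl fun k _ => by ring
  have hind : (∀ k, m k = 0 ∨ m k = 1) → ∃ S : Finset (Fin r), (S.card : ℤ) = 3 * d - 1 ∧
      m = fun k => if k ∈ S then 1 else 0 := by
    intro h01
    have e : m = fun k => if k ∈ ({k | m k = 1} : Finset (Fin r)) then 1 else 0 := by
      ext k
      rcases h01 k with h | h <;> simp [h]
    refine ⟨({k | m k = 1} : Finset (Fin r)), ?_, e⟩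
    rw [← sum_ite_mem, ← hs]
    exact Finset.sum_congr rfl fun k _ => (congrFun e k).symm
  interval_cases d
  · have := Finset.sum_nonneg fun k (_ : k ∈ Finset.univ) => hm k
    omega
  · obtain ⟨S, hS, rfl⟩ := hind fun k => eq_ite_of_sum_mul_sub_one hsq k
    obtain ⟨i, j, hij, rfl⟩ := Finset.card_eq_two.1 (by omega : S.card = 2)
    simp only [Finset.mem_insert, Finset.mem_singleton]
    exact .line i j hij
  · obtain ⟨S, hS, rfl⟩ := hind fun k => eq_ite_of_sum_mul_sub_one hsq k
    exact .conic S (by omega)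
  -- The multiplicities add up to 8 at no more than seven points, so one is at least 2. It uses up
  -- all of the sum 2 of the `m (m - 1)`; the others are at most 1 and add up to 6, so they are six
  -- ones.
  · obtain ⟨i, hi⟩ : ∃ i, 2 ≤ m i := by
      by_contra! h
      have := Finset.sum_le_sum fun k (_ : k ∈ Finset.univ) =>
        (Int.le_of_lt_add_one (h k) : m k ≤ 1)
      simp [hs] at this
      omega
    rw [← Finset.add_sum_erase _ _ (Finset.mem_univ i)] at hs hsq
    have hnn : ∀ k, 0 ≤ m k * (m k - 1) := fun k => by
      rcases eq_or_lt_of_le (hm k) with h | h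
      · simp [← h]
      · exact mul_nonneg h.le (by omega)
    have hnn' := Finset.sum_nonneg fun k (_ : k ∈ Finset.univ.erase i) => hnn k
    have hi2 : m i = 2 := by nlinarith
    rw [hi2] at hs hsq
    have h0 : ∑ k ∈ Finset.univ.erase i, m k * (m k - 1) = 0 := by omega
    have hle : ∀ k ∈ Finset.univ.erase i, m k ≤ 1 := by
      intro k hk
      have := (Finset.sum_eq_zero_iff_of_nonneg fun k _ => hnn k).1 h0 k hk
      rcases mul_eq_zero.1 this with h | h <;> omega
    have hcard : ((Finset.univ.erase i : Finset (Fin r)).card : ℤ) = r - 1 := by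
      rw [Finset.card_erase_of_mem (Finset.mem_univ i), Finset.card_univ, Fintype.card_fin]
      have := i.pos
      omega
    have hle' := Finset.sum_le_sum hle
    rw [Finset.sum_const, nsmul_one, hcard] at hle'
    have hr7 : r = 7 := by omega
    have heq := (Finset.sum_eq_sum_iff_of_le hle).1 (by
      rw [Finset.sum_const, nsmul_one, hcard]; omega)
    have : m = fun k => if k = i then 2 else 1 := by
      ext k
      split_ifs with h
      · rw [h, hi2]
      · exact heq k (by simp [h])
    rw [this]
    exact .cubic hr7 i

/-- A class of a line is that of a curve with a point of multiplicity one less than the degree. -/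
lemma LineShape.exists_monoidal {r : ℕ} (hr : 3 ≤ r) {d : ℕ} {m : Fin r → ℕ}
    (h : LineShape (⟨d, fun k => m k⟩ : DivClass r)) :
    ∃ (n : ℕ) (k₀ : Fin r), d = n + 1 ∧ m k₀ = n ∧ ∀ k, k ≠ k₀ → m k ≤ 1 := by
  generalize hD : (⟨d, fun k => m k⟩ : DivClass r) = D at h
  -- Exceptional classes have a negative multiplicity and do not occur. For a line take a point off
  -- it (here `r ≥ 3` enters), for a conic any of its five points, for a cubic its double point.
  rcases h with i | ⟨i, j, h⟩ | ⟨S, h⟩ | ⟨rfl, i⟩ <;>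
    simp only [DivClass.mk.injEq, funext_iff] at hD
  · have := hD.2 i
    simp at this
  · obtain ⟨k₀, hk₀⟩ : ∃ k₀ : Fin r, k₀ ∉ ({i, j} : Finset (Fin r)) := by
      by_contra! h'
      have := Finset.card_le_card (fun k _ => h' k : (Finset.univ : Finset (Fin r)) ⊆ {i, j})
      rw [Finset.card_univ, Fintype.card_fin, Finset.card_pair h] at this
      omega
    simp only [Finset.mem_insert, Finset.mem_singleton] at hk₀
    refine ⟨0, k₀, by omega, ?_, fun k _ => ?_⟩
    · have := hD.2 k₀
      rw [if_neg hk₀] at this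
      omega
    · have := hD.2 k
      split_ifs at this <;> omega
  · obtain ⟨k₀, hk₀⟩ := Finset.card_pos.1 (by omega : 0 < S.card)
    refine ⟨1, k₀, by omega, ?_, fun k _ => ?_⟩
    · have := hD.2 k₀
      rw [if_pos hk₀] at this
      omega
    · have := hD.2 k
      split_ifs at this <;> omega
  · refine ⟨2, i, by omega, ?_, fun k hk => ?_⟩
    · have := hD.2 i
      rw [if_pos rfl] at this
      omega
    · have := hD.2 k
      rw [if_neg hk] at this
      omega

end Classes

/-! ### The lines on the blow-up -/

section Lines

open MvPolynomial

variable {r : ℕ} {P : Fin r → Plane}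

theorem LineShape.exists_isCurve (hr : 3 ≤ r) (hP : GeneralPosition P) {D : DivClass r}
    (h : LineShape D) : ∃ L, IsCurve P L D := by
  rcases h with i | ⟨i, j, h⟩ | ⟨S, h⟩ | ⟨rfl, i⟩
  · exact ⟨_, .exceptional i⟩
  · obtain ⟨F, h0, hF, hm⟩ := exists_line_through hP h
    refine ⟨_, isCurve_iff.2 (Or.inr ⟨F, 1, irreducible_of_isHomogeneous_one hF h0, hF, rfl, ?_⟩)⟩
    simp [hm]
  · obtain ⟨F, hirr, hF, hm⟩ := exists_conic_through hP hr h
    refine ⟨_, isCurve_iff.2 (Or.inr ⟨F, 2, hirr, hF, rfl, ?_⟩)⟩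
    simp [hm]
  · obtain ⟨F, hirr, hF, hm⟩ := exists_cubic_through hP i
    refine ⟨_, isCurve_iff.2 (Or.inr ⟨F, 3, hirr, hF, rfl, ?_⟩)⟩
    simp [hm]

/-- The intersection inequality for classes of lines. -/
lemma inter_strict (hr : 3 ≤ r) (hP : GeneralPosition P) {F G : MvPolynomial (Fin 3) ℂ} {d e : ℕ}
    (hF : Irreducible F) (hd : F.IsHomogeneous d) (hG : Irreducible G) (he : G.IsHomogeneous e)
    (hFG : ¬ F ∣ G) (hs : LineShape (⟨d, fun k => curveMult F (P k)⟩ : DivClass r)) :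
    0 ≤ DivClass.inter (⟨d, fun k => curveMult F (P k)⟩ : DivClass r)
        ⟨e, fun k => curveMult G (P k)⟩ ∧
      (DivClass.inter (⟨d, fun k => curveMult F (P k)⟩ : DivClass r)
        ⟨e, fun k => curveMult G (P k)⟩ = 0 →
        Disjoint (strictTransform P F) (strictTransform P G)) := by
  obtain ⟨n, k₀, rfl, hn, h1⟩ := hs.exists_monoidal hr
  obtain ⟨hle, hdisj⟩ := sum_curveMult_mul_le hP.injective hF hd hG.ne_zero he hFG k₀ hn h1
  simp only [DivClass.inter]
  refine ⟨?_, fun h0 => hdisj ?_⟩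
  · rw [sub_nonneg]; exact_mod_cast hle
  · rw [sub_eq_zero] at h0; exact_mod_cast h0.symm

/-- A line is the only irreducible curve in its class. -/
theorem LineShape.curve_unique (hr : 3 ≤ r) (hP : GeneralPosition P) {D : DivClass r}
    (h : LineShape D) {L L' : Set (BlowUp P)} (hL : IsCurve P L D) (hL' : IsCurve P L' D) :
    L = L' := by
  rw [isCurve_iff] at hL hL'
  have hexc : ∀ (i : Fin r) (F : MvPolynomial (Fin 3) ℂ) (d : ℕ),
      (⟨0, fun k => if k = i then -1 else 0⟩ : DivClass r) ≠ ⟨d, fun k => curveMult F (P k)⟩ := by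
    intro i F d heq
    rw [DivClass.mk.injEq] at heq
    have := congrFun heq.2 i
    simp at this
  rcases hL with ⟨i, rfl, rfl⟩ | ⟨F, d, hF, hd, rfl, rfl⟩ <;>
    rcases hL' with ⟨j, rfl, hj⟩ | ⟨G, e, hG, he, rfl, hj⟩
  · rw [DivClass.mk.injEq] at hj
    have := congrFun hj.2 i
    simp only [if_true] at this
    split_ifs at this with hij
    rw [hij]
  · exact absurd hj (hexc _ _ _)
  · exact absurd hj.symm (hexc _ _ _)
  · refine strictTransform_eq_of_associated (hF.associated_of_dvd hG ?_)
    -- Two different curves in the class would have intersection number at least 0, but `D . D =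
    -- -1`.
    by_contra hFG
    have h1 := (inter_strict hr hP hF hd hG he hFG h).1
    rw [← hj, h.inter_self] at h1
    omega

theorem isLine_iff (hr : r ≤ 7) {L : Set (BlowUp P)} :
    IsLine P L ↔ ∃ D, LineShape D ∧ IsCurve P L D := by
  constructor
  · rintro ⟨D, hD, h1, h2⟩
    refine ⟨D, ?_, hD⟩
    rcases isCurve_iff.1 hD with ⟨i, -, rfl⟩ | ⟨F, d, hF, hd, -, rfl⟩
    · exact .exceptional i
    · exact lineShape_of_inter hr (by simp) (by simp) h1 h2
  · rintro ⟨D, hD, hL⟩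
    exact ⟨D, hL, hD.inter_self, hD.canonical_inter⟩

/-- Lines with intersection number `0` are skew. -/
theorem LineShape.disjoint (hr : 3 ≤ r) (hP : GeneralPosition P) {D D' : DivClass r}
    (h : LineShape D) {L L' : Set (BlowUp P)} (hL : IsCurve P L D)
    (hL' : IsCurve P L' D') (h0 : D.inter D' = 0) : Disjoint L L' := by
  -- A plane curve of multiplicity 0 at `P i` does not pass through it, so its strict transform has
  -- no point over `P i`.
  have hexc : ∀ (i : Fin r) (F : MvPolynomial (Fin 3) ℂ), Irreducible F → curveMult F (P i) = 0 →
      Disjoint (exceptionalCurve P i) (strictTransform P F) := by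
    intro i F hF hm
    rw [Set.disjoint_left]
    intro y hy hyF
    have := (curveMult_pos_iff hF.ne_zero).2 ((show y.1.1 = P i from hy) ▸ hyF.1)
    omega
  rcases isCurve_iff.1 hL with ⟨i, rfl, rfl⟩ | ⟨F, d, hF, hd, rfl, rfl⟩ <;>
    rcases isCurve_iff.1 hL' with ⟨j, rfl, rfl⟩ | ⟨G, e, hG, he, rfl, rfl⟩
  · have hij : i ≠ j := by
      rintro rfl
      simp [DivClass.inter] at h0
    rw [Set.disjoint_left]
    intro y hy hy'
    exact hij (hP.injective ((show y.1.1 = P i from hy).symm.trans hy'))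
  · refine hexc i G hG ?_
    simpa [DivClass.inter] using h0
  · refine (hexc j F hF ?_).symm
    simpa [DivClass.inter] using h0
  · refine (inter_strict hr hP hF hd hG he (fun hFG => ?_) h).2 h0
    have ha := hF.associated_of_dvd hG hFG
    have h1 := h.inter_self
    obtain rfl := degree_eq_of_associated ha hd he hF.ne_zero
    simp_rw [← curveMult_eq_of_associated ha, h1] at h0
    omega

end Lines

/-! ### The weights and the classes of lines -/

section Correspondence

/-- Every class in `LineShape` contains an irreducible curve, this curve is unique, and a curve has
only one class; so an injective labelling of the classes is a labelling of the lines. -/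
theorem exists_line_equiv {r : ℕ} [NeZero r] (hr : 3 ≤ r) (hr' : r ≤ 7) {P : Fin r → Plane}
    (hP : GeneralPosition P) {Ω : Type*} (cls : Ω → DivClass r) (hinj : Function.Injective cls)
    (hcls : ∀ D, LineShape D ↔ ∃ v, cls v = D) :
    ∃ line : Ω ≃ {L : Set (BlowUp P) // IsLine P L}, (∀ v, IsCurve P (line v) (cls v)) ∧
      ∀ u v, (cls u).inter (cls v) = 0 → Disjoint (line u : Set (BlowUp P)) (line v) := by
  have hshape : ∀ v, LineShape (cls v) := fun v => (hcls _).2 ⟨v, rfl⟩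
  choose L hL using fun v => (hshape v).exists_isCurve hr hP
  let f : Ω → {L : Set (BlowUp P) // IsLine P L} := fun v =>
    ⟨L v, (isLine_iff hr').2 ⟨_, hshape v, hL v⟩⟩
  have hf : Function.Bijective f := by
    constructor
    · intro u v huv
      have h : L u = L v := congrArg Subtype.val huv
      exact hinj ((hL u).class_eq hP.injective (h ▸ hL v))
    · rintro ⟨L', hL'⟩
      obtain ⟨D, hD, hLD⟩ := (isLine_iff hr').1 hL'
      obtain ⟨v, rfl⟩ := (hcls D).1 hD
      exact ⟨v, Subtype.ext ((hshape v).curve_unique hr hP (hL v) hLD)⟩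
  exact ⟨Equiv.ofBijective f hf, hL, fun u v h => (hshape u).disjoint hr hP (hL u) (hL v) h⟩

lemma vertex_apply (i j k : Fin 8) :
    vertex i j k = 4 * ((if k = i then 1 else 0) + (if k = j then 1 else 0)) - 1 := by
  simp only [vertex, PiLp.sub_apply, PiLp.smul_apply, PiLp.add_apply, WithLp.ofLp_sum,
    Finset.sum_apply, smul_eq_mul, PiLp.single_apply]
  simp

lemma vertex_comm (i j : Fin 8) : vertex i j = vertex j i := by
  ext k; rw [vertex_apply, vertex_apply, add_comm (if k = i then _ else _)]

lemma vertex_mem_psiE7 {i j : Fin 8} (h : i ≠ j) : vertex i j ∈ psiE7 := by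
  rcases lt_or_gt_of_ne h with h | h
  · exact ⟨i, j, h, Or.inl rfl⟩
  · exact ⟨j, i, h, Or.inl (vertex_comm i j)⟩

lemma neg_mem_psiE7 {v : EuclideanSpace ℝ (Fin 8)} (h : v ∈ psiE7) : -v ∈ psiE7 := by
  obtain ⟨i, j, hij, rfl | rfl⟩ := h
  · exact ⟨i, j, hij, Or.inr rfl⟩
  · exact ⟨i, j, hij, Or.inl (neg_neg _)⟩

lemma LineClass7.mem_psiE7 {v : EuclideanSpace ℝ (Fin 8)} {D : DivClass 7} (h : LineClass7 v D) :
    v ∈ psiE7 := by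
  cases h with
  | exceptional i => exact vertex_mem_psiE7 (Fin.succ_ne_zero i).symm
  | line i j h => exact neg_mem_psiE7 (vertex_mem_psiE7 (by simpa using h))
  | conic i j h => exact vertex_mem_psiE7 (by simpa using h)
  | cubic i => exact neg_mem_psiE7 (vertex_mem_psiE7 (Fin.succ_ne_zero i).symm)

lemma exists_lineClass7 {v : EuclideanSpace ℝ (Fin 8)} (h : v ∈ psiE7) : ∃ D, LineClass7 v D := by
  obtain ⟨i, j, hij, hv⟩ := h
  obtain ⟨j, rfl⟩ := Fin.exists_succ_eq.2 (Fin.ne_zero_of_lt hij)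
  rcases Fin.eq_zero_or_eq_succ i with rfl | ⟨i, rfl⟩ <;> rcases hv with rfl | rfl
  · exact ⟨_, .exceptional j⟩
  · exact ⟨_, .cubic j⟩
  · exact ⟨_, .conic i j (by simpa using hij.ne)⟩
  · exact ⟨_, .line i j (by simpa using hij.ne)⟩

lemma LineClass7.lineShape {v : EuclideanSpace ℝ (Fin 8)} {D : DivClass 7} (h : LineClass7 v D) :
    LineShape D := by
  cases h with
  | exceptional i => exact .exceptional i
  | line i j h => exact .line i j h
  | conic i j h =>
    have := LineShape.conic (r := 7) ({i, j}ᶜ) (by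
      rw [Finset.card_compl, Finset.card_pair h]; rfl)
    simpa [ite_not, ← not_or] using this
  | cubic i => exact .cubic rfl i

lemma exists_lineClass7_of_lineShape {D : DivClass 7} (h : LineShape D) :
    ∃ v, LineClass7 v D := by
  rcases h with i | ⟨i, j, h⟩ | ⟨S, h⟩ | ⟨-, i⟩
  · exact ⟨_, .exceptional i⟩
  · exact ⟨_, .line i j h⟩
  · obtain ⟨i, j, hij, hS⟩ := Finset.card_eq_two.1 (by
      rw [Finset.card_compl, h]; rfl : Sᶜ.card = 2)
    have hmem : ∀ k, k ∈ S ↔ ¬ (k = i ∨ k = j) := fun k => by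
      rw [← not_iff_not, not_not, ← Finset.mem_compl, hS]; simp
    simp only [hmem, ite_not]
    exact ⟨_, .conic i j hij⟩
  · exact ⟨_, .cubic i⟩

/-- One affine formula covers all four types, so weight and class determine each other and scalar
products become intersection numbers. -/
lemma LineClass7.apply {v : EuclideanSpace ℝ (Fin 8)} {D : DivClass 7} (h : LineClass7 v D) :
    v 0 = 3 - 2 * D.deg ∧ ∀ k : Fin 7, v k.succ = 2 * D.deg - 4 * D.mult k - 1 := by
  cases h with
  | exceptional i =>
    refine ⟨?_, fun k => ?_⟩
    · simp [vertex_apply, (Fin.succ_ne_zero i).symm]; norm_num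
    · simp only [vertex_apply, Fin.succ_ne_zero, if_false, Fin.succ_inj]
      split_ifs <;> norm_num
  | line i j h =>
    refine ⟨?_, fun k => ?_⟩
    · simp [vertex_apply, (Fin.succ_ne_zero _).symm]; norm_num
    · simp only [PiLp.neg_apply, vertex_apply, Fin.succ_inj]
      by_cases hi : k = i
      · subst hi; simp [h]; norm_num
      · by_cases hj : k = j
        · subst hj; simp [hi]; norm_num
        · simp [hi, hj]; norm_num
  | conic i j h =>
    refine ⟨?_, fun k => ?_⟩
    · simp [vertex_apply, (Fin.succ_ne_zero _).symm]; norm_num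
    · simp only [vertex_apply, Fin.succ_inj]
      by_cases hi : k = i
      · subst hi; simp [h]; norm_num
      · by_cases hj : k = j
        · subst hj; simp [hi]; norm_num
        · simp [hi, hj]; norm_num
  | cubic i =>
    refine ⟨?_, fun k => ?_⟩
    · simp [vertex_apply, (Fin.succ_ne_zero _).symm]; norm_num
    · simp only [PiLp.neg_apply, vertex_apply, Fin.succ_ne_zero, if_false, Fin.succ_inj]
      split_ifs <;> norm_num

lemma LineClass7.class_unique {v : EuclideanSpace ℝ (Fin 8)} {D D' : DivClass 7}
    (h : LineClass7 v D) (h' : LineClass7 v D') : D = D' := by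
  obtain ⟨h0, h1⟩ := h.apply
  obtain ⟨h0', h1'⟩ := h'.apply
  obtain ⟨d, m⟩ := D
  obtain ⟨d', m'⟩ := D'
  simp only at *
  have hd : d = d' := by
    have : (d : ℝ) = d' := by linarith
    exact_mod_cast this
  subst hd
  congr 1
  ext k
  have : (m k : ℝ) = m' k := by linarith [h1 k, h1' k]
  exact_mod_cast this

lemma LineClass7.vector_unique {v v' : EuclideanSpace ℝ (Fin 8)} {D : DivClass 7}
    (h : LineClass7 v D) (h' : LineClass7 v' D) : v = v' := by
  ext k
  refine Fin.cases ?_ (fun k => ?_) k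
  · rw [h.apply.1, h'.apply.1]
  · rw [h.apply.2, h'.apply.2]

/-- The scalar product of two weights in terms of the intersection number of the lines. -/
lemma LineClass7.inner_eq {v v' : EuclideanSpace ℝ (Fin 8)} {D D' : DivClass 7}
    (h : LineClass7 v D) (h' : LineClass7 v' D') :
    inner ℝ v v' = 8 - 16 * (D.inter D' : ℝ) := by
  have hs : ∀ {v : EuclideanSpace ℝ (Fin 8)} {D : DivClass 7}, LineClass7 v D →
      ∑ k, (D.mult k : ℝ) = 3 * D.deg - 1 := by
    intro v D h
    have := h.lineShape.canonical_inter
    simp only [DivClass.inter, canonicalClass, neg_mul, one_mul, Finset.sum_neg_distrib] at this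
    have h2 : ∑ k, D.mult k = 3 * D.deg - 1 := by omega
    exact_mod_cast h2
  have h1 := hs h
  have h2 := hs h'
  rw [PiLp.inner_apply, Fin.sum_univ_succ, h.apply.1, h'.apply.1]
  simp only [h.apply.2, h'.apply.2, DivClass.inter]
  simp only [Fin.sum_univ_seven] at *
  simp
  -- The terms linear in the multiplicities are eliminated by `∑ m = 3 d - 1`, the condition on the
  -- canonical class.
  linear_combination (-8 * (D'.deg : ℝ) + 4) * h1 + (-8 * (D.deg : ℝ) + 4) * h2

/-- By `inner_eq` and `D . D = -1` every weight has squared length 24, hence the squared distance is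
`32 + 32 D . D'`. -/
lemma LineClass7.inter_eq_zero {v v' : EuclideanSpace ℝ (Fin 8)} {D D' : DivClass 7}
    (h : LineClass7 v D) (h' : LineClass7 v' D') (hd : dist v v' = √32) : D.inter D' = 0 := by
  have h1 : ‖v - v'‖ ^ 2 = 32 := by
    rw [← dist_eq_norm, hd, Real.sq_sqrt (by norm_num)]
  rw [norm_sub_sq_real, ← real_inner_self_eq_norm_sq, ← real_inner_self_eq_norm_sq,
    h.inner_eq h, h'.inner_eq h', h.inner_eq h', h.lineShape.inter_self,
    h'.lineShape.inter_self] at h1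
  have : (D.inter D' : ℝ) = 0 := by push_cast at h1; linarith
  exact_mod_cast this

theorem exists_line_equiv_psiE7 {P : Fin 7 → Plane} (hP : GeneralPosition P) :
    ∃ line : psiE7 ≃ {L : Set (BlowUp P) // IsLine P L},
      (∀ v : psiE7, ∃ D, LineClass7 v D ∧ IsCurve P (line v) D) ∧
      ∀ v u : psiE7, dist v u = √32 → Disjoint (line u : Set (BlowUp P)) (line v) := by
  choose cls hcls using fun v : psiE7 => exists_lineClass7 v.2
  obtain ⟨line, h1, h2⟩ := exists_line_equiv (by norm_num) le_rfl hP cls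
    (fun u v h => Subtype.ext ((hcls u).vector_unique (h ▸ hcls v))) (fun D => by
      constructor
      · intro hD
        obtain ⟨v, hv⟩ := exists_lineClass7_of_lineShape hD
        exact ⟨⟨v, hv.mem_psiE7⟩, (hcls _).class_unique hv⟩
      · rintro ⟨v, rfl⟩
        exact (hcls v).lineShape)
  exact ⟨line, fun v => ⟨_, hcls v, h1 v⟩, fun v u h =>
    h2 u v ((hcls u).inter_eq_zero (hcls v) (by rw [dist_comm]; exact h))⟩

/-- The pull-back of a class on the blow-up in six points to the blow-up in seven points. -/
def DivClass.pullback (D : DivClass 6) : DivClass 7 := ⟨D.deg, Fin.snoc D.mult 0⟩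

lemma DivClass.pullback_mult_last (D : DivClass 6) : D.pullback.mult (Fin.last 6) = 0 := by
  simp [DivClass.pullback, Fin.snoc]

lemma DivClass.pullback_mult_castSucc (D : DivClass 6) (k : Fin 6) :
    D.pullback.mult k.castSucc = D.mult k :=
  Fin.snoc_castSucc (α := fun _ => ℤ) _ _ _

lemma DivClass.pullback_inter (D D' : DivClass 6) : D.pullback.inter D'.pullback = D.inter D' := by
  simp only [DivClass.inter, Fin.sum_univ_castSucc (n := 6), pullback_mult_castSucc,
    pullback_mult_last, mul_zero, add_zero]
  rfl

lemma DivClass.pullback_eq_mk {D : DivClass 6} {d : ℤ} {m : Fin 7 → ℤ} (hd : D.deg = d)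
    (hl : 0 = m (Fin.last 6)) (hm : ∀ k : Fin 6, D.mult k = m k.castSucc) :
    D.pullback = ⟨d, m⟩ := by
  subst hd
  change DivClass.mk _ D.pullback.mult = _
  congr 1
  ext k
  refine Fin.lastCases ?_ (fun k => ?_) k
  · rw [pullback_mult_last, hl]
  · rw [pullback_mult_castSucc, hm]

lemma DivClass.pullback_injective : Function.Injective DivClass.pullback := by
  intro D D' h
  have hm : ∀ k, D.mult k = D'.mult k := fun k => by
    rw [← pullback_mult_castSucc, h, pullback_mult_castSucc]
  have hd : D.deg = D'.deg := (DivClass.mk.inj h).1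
  cases D
  cases D'
  exact DivClass.mk.injEq .. ▸ ⟨hd, funext hm⟩

/-- Pulling back adds multiplicity 0 at the seventh point, and the conic labelled `v_{i,7}` is the
one that avoids `P_i` and `P_7`. This reduces degree 3 to degree 2. -/
lemma LineClass6.pullback {v : EuclideanSpace ℝ (Fin 8)} {D : DivClass 6} (h : LineClass6 v D) :
    LineClass7 v D.pullback := by
  have hne : ∀ i : Fin 6, Fin.last 6 ≠ i.castSucc := fun i => (Fin.castSucc_lt_last i).ne'
  cases h with
  | exceptional i =>
    convert LineClass7.exceptional i.castSucc using 1
    exact DivClass.pullback_eq_mk rfl (if_neg (hne i)).symm fun k => by simp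
  | line i j h =>
    convert LineClass7.line i.castSucc j.castSucc (by simpa using h) using 1
    exact DivClass.pullback_eq_mk rfl (if_neg (not_or.2 ⟨hne i, hne j⟩)).symm fun k => by simp
  | conic i =>
    rw [DivClass.pullback_eq_mk (m := fun k => if k = i.castSucc ∨ k = Fin.last 6 then 0 else 1)
      rfl (if_pos (Or.inr rfl)).symm fun k => by
        simp only [Fin.castSucc_inj, (hne _).symm, or_false]]
    exact LineClass7.conic i.castSucc (Fin.last 6) (hne i).symm

lemma DivClass.inter_exceptional (D : DivClass 7) (i : Fin 7) :
    D.inter ⟨0, fun k => if k = i then -1 else 0⟩ = D.mult i := by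
  simp [DivClass.inter]

/-- The weight `v_{0,7}` belongs to the exceptional curve over the seventh point, so the scalar
product with it is `8 - 16 m_7`, and it is 8 exactly if `m_7 = 0`. -/
lemma LineClass6.mem_psiE6 {v : EuclideanSpace ℝ (Fin 8)} {D : DivClass 6} (h : LineClass6 v D) :
    v ∈ psiE6 8 := by
  refine ⟨h.pullback.mem_psiE7, ?_⟩
  have := h.pullback.inner_eq (LineClass7.exceptional (Fin.last 6))
  rw [DivClass.inter_exceptional, DivClass.pullback_mult_last] at this
  refine Eq.trans this ?_
  norm_num

lemma exists_lineClass6 {v : EuclideanSpace ℝ (Fin 8)} (h : v ∈ psiE6 8) :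
    ∃ D, LineClass6 v D := by
  obtain ⟨hv, hin⟩ := h
  obtain ⟨D, hD⟩ := exists_lineClass7 hv
  have h7 : D.mult (Fin.last 6) = 0 := by
    have := hD.inner_eq (LineClass7.exceptional (Fin.last 6))
    rw [DivClass.inter_exceptional] at this
    have h0 := hin.symm.trans this
    have : (D.mult (Fin.last 6) : ℝ) = 0 := by linarith
    exact_mod_cast this
  cases hD with
  | exceptional i =>
    obtain ⟨i, rfl⟩ := Fin.exists_castSucc_eq.2 (show i ≠ Fin.last 6 by
      rintro rfl; simp at h7)
    exact ⟨_, .exceptional i⟩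
  | line i j h =>
    simp only [ite_eq_right_iff, one_ne_zero, imp_false, not_or] at h7
    obtain ⟨i, rfl⟩ := Fin.exists_castSucc_eq.2 (Ne.symm h7.1)
    obtain ⟨j, rfl⟩ := Fin.exists_castSucc_eq.2 (Ne.symm h7.2)
    exact ⟨_, .line i j (by simpa using h)⟩
  | conic i j h =>
    simp only [ite_eq_left_iff, one_ne_zero, imp_false, not_not] at h7
    rcases h7 with rfl | rfl
    · obtain ⟨j, rfl⟩ := Fin.exists_castSucc_eq.2 h.symm
      rw [vertex_comm]
      exact ⟨_, .conic j⟩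
    · obtain ⟨i, rfl⟩ := Fin.exists_castSucc_eq.2 h
      exact ⟨_, .conic i⟩
  | cubic i =>
    simp only at h7
    split_ifs at h7 <;> omega

lemma LineClass6.lineShape {v : EuclideanSpace ℝ (Fin 8)} {D : DivClass 6} (h : LineClass6 v D) :
    LineShape D := by
  cases h with
  | exceptional i => exact .exceptional i
  | line i j h => exact .line i j h
  | conic i =>
    have := LineShape.conic (r := 6) ({i}ᶜ) (by
      rw [Finset.card_compl, Finset.card_singleton]; rfl)
    simpa [ite_not] using this

lemma exists_lineClass6_of_lineShape {D : DivClass 6} (h : LineShape D) :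
    ∃ v, LineClass6 v D := by
  rcases h with i | ⟨i, j, h⟩ | ⟨S, h⟩ | ⟨h, i⟩
  · exact ⟨_, .exceptional i⟩
  · exact ⟨_, .line i j h⟩
  · obtain ⟨i, hS⟩ := Finset.card_eq_one.1 (by
      rw [Finset.card_compl, h]; rfl : Sᶜ.card = 1)
    have hmem : ∀ k, k ∈ S ↔ ¬ k = i := fun k => by
      rw [← not_iff_not, not_not, ← Finset.mem_compl, hS]; simp
    simp only [hmem, ite_not]
    exact ⟨_, .conic i⟩
  · omega

lemma smul_mem_psiE6 {s : ℝ} (hs : s = 1 ∨ s = -1) (l : ℝ) {v : EuclideanSpace ℝ (Fin 8)}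
    (hv : v ∈ psiE6 l) : s • v ∈ psiE6 (s * l) := by
  refine ⟨?_, by rw [inner_smul_left, hv.2]; rfl⟩
  rcases hs with rfl | rfl
  · simpa using hv.1
  · simpa using neg_mem_psiE7 hv.1

/-- Multiplication by `s = ± 1` is an isometry between the slice `8 s` and the slice `8`, which
treats both modules at once. -/
theorem exists_line_equiv_psiE6 {s : ℝ} (hs : s = 1 ∨ s = -1) {P : Fin 6 → Plane}
    (hP : GeneralPosition P) :
    ∃ line : psiE6 (8 * s) ≃ {L : Set (BlowUp P) // IsLine P L},
      (∀ v : psiE6 (8 * s), ∃ D, LineClass6 (s • (v : EuclideanSpace ℝ (Fin 8))) D ∧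
        IsCurve P (line v) D) ∧
      ∀ v u : psiE6 (8 * s), dist v u = √32 → Disjoint (line u : Set (BlowUp P)) (line v) := by
  have hs2 : s * s = 1 := by rcases hs with rfl | rfl <;> norm_num
  have hmem : ∀ v : psiE6 (8 * s), s • (v : EuclideanSpace ℝ (Fin 8)) ∈ psiE6 8 := fun v => by
    have := smul_mem_psiE6 hs _ v.2
    rwa [mul_left_comm, hs2, mul_one] at this
  choose cls hcls using fun v : psiE6 (8 * s) => exists_lineClass6 (hmem v)
  have hdist : ∀ u v : EuclideanSpace ℝ (Fin 8), dist (s • u) (s • v) = dist u v := fun u v => by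
    rw [dist_smul₀]
    rcases hs with rfl | rfl <;> simp
  obtain ⟨line, h1, h2⟩ := exists_line_equiv (by norm_num) (by norm_num) hP cls
    (fun u v h => by
      have h3 := (hcls u).pullback.vector_unique (h ▸ (hcls v).pullback)
      rw [Subtype.ext_iff, ← dist_eq_zero, ← hdist, h3, dist_self]) (fun D => by
      constructor
      · intro hD
        obtain ⟨v, hv⟩ := exists_lineClass6_of_lineShape hD
        have hsv : s • v ∈ psiE6 (8 * s) := by
          rw [mul_comm]; exact smul_mem_psiE6 hs _ hv.mem_psiE6
        refine ⟨⟨s • v, hsv⟩, DivClass.pullback_injective ((hcls _).pullback.class_unique ?_)⟩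
        simpa [smul_smul, hs2] using hv.pullback
      · rintro ⟨v, rfl⟩
        exact (hcls v).lineShape)
  refine ⟨line, fun v => ⟨_, hcls v, h1 v⟩, fun v u h => h2 u v ?_⟩
  rw [← DivClass.pullback_inter]
  refine (hcls u).pullback.inter_eq_zero (hcls v).pullback ?_
  rw [hdist, dist_comm]
  exact h

end Correspondence

/-! ### The module attached to a minuscule set of weights -/

section WeightRep

open Module

variable {n : ℕ} {Ω : Set (EuclideanSpace ℝ (Fin n))}

/-- A set of weights in which each step along a simple root is governed by the scalar product,
as for a minuscule representation of a simply laced Lie algebra. -/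
structure IsMinuscule {B : Type} (A : Matrix B B ℤ) (Ω : Set (EuclideanSpace ℝ (Fin n)))
    (α : B → EuclideanSpace ℝ (Fin n)) : Prop where
  add_mem : ∀ v ∈ Ω, ∀ i, v + α i ∈ Ω ↔ inner ℝ v (α i) = -16
  sub_mem : ∀ v ∈ Ω, ∀ i, v - α i ∈ Ω ↔ inner ℝ v (α i) = 16
  inner_cases : ∀ v ∈ Ω, ∀ i,
    inner ℝ v (α i) = -16 ∨ inner ℝ v (α i) = 0 ∨ inner ℝ v (α i) = 16
  inner_root : ∀ i j, inner ℝ (α i) (α j) = 16 * (A i j : ℝ)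
  diag : ∀ i, A i i = 2
  off_diag : ∀ i j, i ≠ j → A i j = 0 ∨ A i j = -1

open Classical in
/-- The coefficient of `b e` in `x`, which is `0` if `e` is not a weight. -/
def coeffAt (x : WeightSpace Ω) (e : EuclideanSpace ℝ (Fin n)) : ℂ :=
  if h : e ∈ Ω then x ⟨e, h⟩ else 0

lemma coeffAt_coe (x : WeightSpace Ω) (v : Ω) : coeffAt x v = x v := by
  simp [coeffAt]

lemma coeffAt_of_notMem (x : WeightSpace Ω) {e : EuclideanSpace ℝ (Fin n)} (h : e ∉ Ω) :
    coeffAt x e = 0 := by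
  simp [coeffAt, h]

lemma ext_coeffAt {x y : WeightSpace Ω} (h : ∀ e ∈ Ω, coeffAt x e = coeffAt y e) : x = y := by
  ext v
  rw [← coeffAt_coe, ← coeffAt_coe, h v v.2]

lemma coeffAt_add (x y : WeightSpace Ω) (e) : coeffAt (x + y) e = coeffAt x e + coeffAt y e := by
  unfold coeffAt; split_ifs <;> simp

lemma coeffAt_sub (x y : WeightSpace Ω) (e) : coeffAt (x - y) e = coeffAt x e - coeffAt y e := by
  unfold coeffAt; split_ifs <;> simp

lemma coeffAt_smul (c : ℂ) (x : WeightSpace Ω) (e) : coeffAt (c • x) e = c * coeffAt x e := by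
  unfold coeffAt; split_ifs <;> simp

lemma coeffAt_zero (e) : coeffAt (0 : WeightSpace Ω) e = 0 := by
  unfold coeffAt; split_ifs <;> simp

open Classical in
lemma coeffAt_basisVec (v : Ω) (e) :
    coeffAt (basisVec v) e = if e = (v : EuclideanSpace ℝ (Fin n)) then 1 else 0 := by
  by_cases h : e ∈ Ω
  · lift e to Ω using h
    rw [coeffAt_coe, Finsupp.single_apply]
    simp only [Subtype.ext_iff, eq_comm]
  · rw [coeffAt_of_notMem _ h, if_neg]
    rintro rfl
    exact h v.2

/-- As `coeffAt` is defined for all vectors and is 0 off `Ω`, the operator becomes a plain shift,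
with no case distinction on whether `e - a` is a weight. -/
lemma coeffAt_opE_of_mem (a : EuclideanSpace ℝ (Fin n)) (x : WeightSpace Ω) {e} (he : e ∈ Ω) :
    coeffAt (opE Ω a x) e = coeffAt x (e - a) := by
  induction x using Finsupp.induction_linear with
  | zero => simp [coeffAt_zero]
  | add x y hx hy => rw [map_add, coeffAt_add, coeffAt_add, hx, hy]
  | single v c =>
    have hs : (Finsupp.single v c : WeightSpace Ω) = c • basisVec v := by simp
    rw [hs, map_smul, coeffAt_smul, coeffAt_smul]
    congr 1
    rw [opE, Finsupp.linearCombination_single, one_smul, coeffAt_basisVec]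
    split_ifs with h1 h2 h2
    · rw [coeffAt_basisVec, if_pos]; simp [← h2]
    · rw [coeffAt_basisVec, if_neg]; rintro rfl; simp at h2
    · exact absurd (by rw [← h2]; simpa using he) h1
    · exact coeffAt_zero e

lemma coeffAt_opF_of_mem (a : EuclideanSpace ℝ (Fin n)) (x : WeightSpace Ω) {e} (he : e ∈ Ω) :
    coeffAt (opF Ω a x) e = coeffAt x (e + a) := by
  induction x using Finsupp.induction_linear with
  | zero => simp [coeffAt_zero]
  | add x y hx hy => rw [map_add, coeffAt_add, coeffAt_add, hx, hy]
  | single v c =>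
    have hs : (Finsupp.single v c : WeightSpace Ω) = c • basisVec v := by simp
    rw [hs, map_smul, coeffAt_smul, coeffAt_smul]
    congr 1
    rw [opF, Finsupp.linearCombination_single, one_smul, coeffAt_basisVec]
    split_ifs with h1 h2 h2
    · rw [coeffAt_basisVec, if_pos]; simp [← h2]
    · rw [coeffAt_basisVec, if_neg]; rintro rfl; simp at h2
    · exact absurd (by rw [← h2]; simpa using he) h1
    · exact coeffAt_zero e

lemma coeffAt_opH (a : EuclideanSpace ℝ (Fin n)) (x : WeightSpace Ω) (e) :
    coeffAt (opH Ω a x) e = ((2 * inner ℝ e a / inner ℝ a a : ℝ) : ℂ) * coeffAt x e := by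
  induction x using Finsupp.induction_linear with
  | zero => simp [coeffAt_zero]
  | add x y hx hy => rw [map_add, coeffAt_add, coeffAt_add, hx, hy]; ring
  | single v c =>
    have hs : (Finsupp.single v c : WeightSpace Ω) = c • basisVec v := by simp
    rw [hs, map_smul, coeffAt_smul, coeffAt_smul, opH, Finsupp.linearCombination_single, one_smul,
      coeffAt_smul, coeffAt_basisVec]
    split_ifs with h
    · rw [h]; ring
    · simp

namespace IsMinuscule

variable {B : Type} {A : Matrix B B ℤ} {α : B → EuclideanSpace ℝ (Fin n)}

lemma coeffAt_opE (h : IsMinuscule A Ω α) (i : B) (x : WeightSpace Ω) {e} (he : e ∈ Ω) :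
    coeffAt (opE Ω (α i) x) e = if inner ℝ e (α i) = 16 then coeffAt x (e - α i) else 0 := by
  rw [coeffAt_opE_of_mem _ _ he]
  split_ifs with h1
  · rfl
  · exact coeffAt_of_notMem _ fun h2 => h1 ((h.sub_mem e he i).1 h2)

lemma coeffAt_opF (h : IsMinuscule A Ω α) (i : B) (x : WeightSpace Ω) {e} (he : e ∈ Ω) :
    coeffAt (opF Ω (α i) x) e = if inner ℝ e (α i) = -16 then coeffAt x (e + α i) else 0 := by
  rw [coeffAt_opF_of_mem _ _ he]
  split_ifs with h1
  · rfl
  · exact coeffAt_of_notMem _ fun h2 => h1 ((h.add_mem e he i).1 h2)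

lemma coeffAt_opH' (h : IsMinuscule A Ω α) (i : B) (x : WeightSpace Ω) (e) :
    coeffAt (opH Ω (α i) x) e = ((inner ℝ e (α i) / 16 : ℝ) : ℂ) * coeffAt x e := by
  rw [coeffAt_opH, h.inner_root, h.diag]
  congr 2
  push_cast; ring

lemma symm_apply (h : IsMinuscule A Ω α) (i j : B) : A i j = A j i := by
  have h1 := h.inner_root i j
  rw [real_inner_comm, h.inner_root] at h1
  have : (A j i : ℝ) = A i j := by linarith
  exact_mod_cast this.symm

lemma inner_add (h : IsMinuscule A Ω α) (e : EuclideanSpace ℝ (Fin n)) (i j : B) :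
    inner ℝ (e + α i) (α j) = inner ℝ e (α j) + 16 * (A i j : ℝ) := by
  rw [inner_add_left, h.inner_root]

lemma inner_sub (h : IsMinuscule A Ω α) (e : EuclideanSpace ℝ (Fin n)) (i j : B) :
    inner ℝ (e - α i) (α j) = inner ℝ e (α j) - 16 * (A i j : ℝ) := by
  rw [inner_sub_left, h.inner_root]

/-- One step changes the scalar product with the root from 16 to -16, which leaves no second step.
-/
lemma opE_opE_self (h : IsMinuscule A Ω α)
    (i : B) (x : WeightSpace Ω) : opE Ω (α i) (opE Ω (α i) x) = 0 := by
  refine ext_coeffAt fun e he => ?_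
  rw [h.coeffAt_opE _ _ he, coeffAt_zero]
  split_ifs with h1
  · rw [h.coeffAt_opE _ _ ((h.sub_mem e he i).2 h1), h.inner_sub, h1, h.diag, if_neg]
    norm_num
  · rfl

lemma opF_opF_self (h : IsMinuscule A Ω α)
    (i : B) (x : WeightSpace Ω) : opF Ω (α i) (opF Ω (α i) x) = 0 := by
  refine ext_coeffAt fun e he => ?_
  rw [h.coeffAt_opF _ _ he, coeffAt_zero]
  split_ifs with h1
  · rw [h.coeffAt_opF _ _ ((h.add_mem e he i).2 h1), h.inner_add, h1, h.diag, if_neg]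
    norm_num
  · rfl

lemma opE_opE_comm (h : IsMinuscule A Ω α) {i j : B} (hij : A i j = 0) (x : WeightSpace Ω) :
    opE Ω (α i) (opE Ω (α j) x) = opE Ω (α j) (opE Ω (α i) x) := by
  refine ext_coeffAt fun e he => ?_
  have hji : A j i = 0 := h.symm_apply j i ▸ hij
  rw [h.coeffAt_opE _ _ he, h.coeffAt_opE _ _ he]
  by_cases h1 : inner ℝ e (α i) = 16 <;> by_cases h2 : inner ℝ e (α j) = 16 <;>
    simp only [h1, h2, if_true, if_false]
  · rw [h.coeffAt_opE _ _ ((h.sub_mem e he i).2 h1), h.coeffAt_opE _ _ ((h.sub_mem e he j).2 h2),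
      h.inner_sub, h.inner_sub, h1, h2, hij, hji, sub_right_comm]
  · rw [h.coeffAt_opE _ _ ((h.sub_mem e he i).2 h1), h.inner_sub, hij]; simp [h2]
  · rw [h.coeffAt_opE _ _ ((h.sub_mem e he j).2 h2), h.inner_sub, hji]; simp [h1]

lemma opF_opF_comm (h : IsMinuscule A Ω α) {i j : B} (hij : A i j = 0) (x : WeightSpace Ω) :
    opF Ω (α i) (opF Ω (α j) x) = opF Ω (α j) (opF Ω (α i) x) := by
  refine ext_coeffAt fun e he => ?_
  have hji : A j i = 0 := h.symm_apply j i ▸ hij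
  rw [h.coeffAt_opF _ _ he, h.coeffAt_opF _ _ he]
  by_cases h1 : inner ℝ e (α i) = -16 <;> by_cases h2 : inner ℝ e (α j) = -16 <;>
    simp only [h1, h2, if_true, if_false]
  · rw [h.coeffAt_opF _ _ ((h.add_mem e he i).2 h1), h.coeffAt_opF _ _ ((h.add_mem e he j).2 h2),
      h.inner_add, h.inner_add, h1, h2, hij, hji, add_right_comm]
  · rw [h.coeffAt_opF _ _ ((h.add_mem e he i).2 h1), h.inner_add, hij]; simp [h2]
  · rw [h.coeffAt_opF _ _ ((h.add_mem e he j).2 h2), h.inner_add, hji]; simp [h1]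

/-- Two steps back along `α i` and `α j` change the scalar product with `α i` from 16 to -16 and
then to 0, so the third step is impossible. Together with `opE_opE_self` this is the Serre relation
for a Cartan entry -1. -/
lemma opE_opE_opE (h : IsMinuscule A Ω α) {i j : B} (hij : A i j = -1) (x : WeightSpace Ω) :
    opE Ω (α i) (opE Ω (α j) (opE Ω (α i) x)) = 0 := by
  refine ext_coeffAt fun e he => ?_
  have hji : A j i = -1 := h.symm_apply j i ▸ hij
  rw [h.coeffAt_opE _ _ he, coeffAt_zero]
  split_ifs with h1
  · have he1 := (h.sub_mem e he i).2 h1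
    rw [h.coeffAt_opE _ _ he1]
    split_ifs with h2
    · have he2 := (h.sub_mem _ he1 j).2 h2
      rw [h.coeffAt_opE _ _ he2, if_neg]
      rw [h.inner_sub, h.inner_sub, h1, h.diag, hji]
      norm_num
    · rfl
  · rfl

lemma opF_opF_opF (h : IsMinuscule A Ω α) {i j : B} (hij : A i j = -1) (x : WeightSpace Ω) :
    opF Ω (α i) (opF Ω (α j) (opF Ω (α i) x)) = 0 := by
  refine ext_coeffAt fun e he => ?_
  have hji : A j i = -1 := h.symm_apply j i ▸ hij
  rw [h.coeffAt_opF _ _ he, coeffAt_zero]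
  split_ifs with h1
  · have he1 := (h.add_mem e he i).2 h1
    rw [h.coeffAt_opF _ _ he1]
    split_ifs with h2
    · have he2 := (h.add_mem _ he1 j).2 h2
      rw [h.coeffAt_opF _ _ he2, if_neg]
      rw [h.inner_add, h.inner_add, h1, h.diag, hji]
      norm_num
    · rfl
  · rfl

/-- On each weight at most one of the products `E F` and `F E` is nonzero, and that one is the
identity: `F E` for scalar product -16, `E F` for 16. -/
lemma commutator_opE_opF_self (h : IsMinuscule A Ω α) (i : B) :
    opE Ω (α i) * opF Ω (α i) - opF Ω (α i) * opE Ω (α i) =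
      opH Ω (α i) := by
  refine LinearMap.ext fun x => ext_coeffAt fun e he => ?_
  rw [LinearMap.sub_apply, coeffAt_sub, Module.End.mul_apply, Module.End.mul_apply,
    h.coeffAt_opE _ _ he, h.coeffAt_opF _ _ he, h.coeffAt_opH']
  rcases h.inner_cases e he i with h1 | h1 | h1
  · rw [h1, if_neg (by norm_num), if_pos rfl, h.coeffAt_opE _ _ ((h.add_mem e he i).2 h1),
      h.inner_add, h1, h.diag, if_pos (by norm_num), add_sub_cancel_right]
    norm_num
  · rw [h1, if_neg (by norm_num), if_neg (by norm_num)]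
    norm_num
  · rw [h1, if_pos rfl, if_neg (by norm_num), h.coeffAt_opF _ _ ((h.sub_mem e he i).2 h1),
      h.inner_sub, h1, h.diag, if_pos (by norm_num), sub_add_cancel]
    norm_num

/-- For orthogonal roots the two steps are independent. For a Cartan entry -1 both products vanish,
since the first step makes the second one impossible. -/
lemma commutator_opE_opF (h : IsMinuscule A Ω α) {i j : B} (hij : i ≠ j) :
    opE Ω (α i) * opF Ω (α j) - opF Ω (α j) * opE Ω (α i) =
      0 := by
  refine LinearMap.ext fun x => ext_coeffAt fun e he => ?_
  rw [LinearMap.sub_apply, coeffAt_sub, Module.End.mul_apply, Module.End.mul_apply,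
    h.coeffAt_opE _ _ he, h.coeffAt_opF _ _ he, LinearMap.zero_apply, coeffAt_zero]
  have hji : A j i = A i j := h.symm_apply j i
  by_cases h1 : inner ℝ e (α i) = 16 <;> by_cases h2 : inner ℝ e (α j) = -16 <;>
    simp only [h1, h2, if_true, if_false]
  · rw [h.coeffAt_opF _ _ ((h.sub_mem e he i).2 h1), h.coeffAt_opE _ _ ((h.add_mem e he j).2 h2),
      h.inner_sub, h.inner_add, h1, h2, hji]
    rcases h.off_diag i j hij with h3 | h3
    · rw [h3]
      simp only [Int.cast_zero, mul_zero, sub_zero, add_zero, if_true]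
      rw [sub_add_eq_add_sub, sub_self]
    · rw [h3, if_neg (by norm_num), if_neg (by norm_num), sub_self]
  · rw [h.coeffAt_opF _ _ ((h.sub_mem e he i).2 h1), h.inner_sub, if_neg, sub_zero]
    rcases h.off_diag i j hij with h3 | h3
    · simpa [h3] using h2
    · rcases h.inner_cases e he j with h4 | h4 | h4 <;> rw [h3, h4] <;> norm_num
  · rw [h.coeffAt_opE _ _ ((h.add_mem e he j).2 h2), h.inner_add, if_neg, sub_zero]
    rw [hji]
    rcases h.off_diag i j hij with h3 | h3
    · simpa [h3] using h1
    · rcases h.inner_cases e he i with h4 | h4 | h4 <;> rw [h3, h4] <;> norm_num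
  · simp

lemma commutator_opH_opH (h : IsMinuscule A Ω α) (i j : B) :
    opH Ω (α i) * opH Ω (α j) - opH Ω (α j) * opH Ω (α i) =
      0 := by
  refine LinearMap.ext fun x => ext_coeffAt fun e he => ?_
  rw [LinearMap.sub_apply, coeffAt_sub, Module.End.mul_apply, Module.End.mul_apply,
    h.coeffAt_opH', h.coeffAt_opH', h.coeffAt_opH', h.coeffAt_opH', LinearMap.zero_apply,
    coeffAt_zero]
  ring

lemma commutator_opH_opE (h : IsMinuscule A Ω α) (i j : B) :
    opH Ω (α i) * opE Ω (α j) - opE Ω (α j) * opH Ω (α i) =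
      ((A i j : ℤ) : ℂ) • opE Ω (α j) := by
  refine LinearMap.ext fun x => ext_coeffAt fun e he => ?_
  rw [LinearMap.sub_apply, coeffAt_sub, Module.End.mul_apply, Module.End.mul_apply,
    h.coeffAt_opH', h.coeffAt_opE _ _ he, h.coeffAt_opE _ _ he, LinearMap.smul_apply, coeffAt_smul,
    h.coeffAt_opE _ _ he, h.coeffAt_opH', h.inner_sub, h.symm_apply j i]
  split_ifs
  · push_cast; ring
  · simp

lemma commutator_opH_opF (h : IsMinuscule A Ω α) (i j : B) :
    opH Ω (α i) * opF Ω (α j) - opF Ω (α j) * opH Ω (α i) =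
      (-((A i j : ℤ) : ℂ)) • opF Ω (α j) := by
  refine LinearMap.ext fun x => ext_coeffAt fun e he => ?_
  rw [LinearMap.sub_apply, coeffAt_sub, Module.End.mul_apply,
    Module.End.mul_apply,
    h.coeffAt_opH', h.coeffAt_opF _ _ he, h.coeffAt_opF _ _ he, LinearMap.smul_apply, coeffAt_smul,
    h.coeffAt_opF _ _ he, h.coeffAt_opH', h.inner_add, h.symm_apply j i]
  split_ifs
  · push_cast; ring
  · simp

end IsMinuscule

end WeightRep

/-! ### The Lie algebra of a Cartan matrix by generators and relations -/

section Serre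

open CartanMatrix

variable {B : Type} [DecidableEq B] (A : Matrix B B ℤ)

/-- The projection of the free Lie algebra to the Lie algebra of a Cartan matrix. -/
def serreMap : FreeLieAlgebra ℂ (Generators B) →ₗ⁅ℂ⁆ A.ToLieAlgebra ℂ :=
  { (LieSubmodule.Quotient.mk' (Relations.toIdeal ℂ A) :
      FreeLieAlgebra ℂ (Generators B) →ₗ[ℂ]
        FreeLieAlgebra ℂ (Generators B) ⧸ Relations.toIdeal ℂ A) with
    map_lie' := fun {x y} => LieSubmodule.Quotient.mk_bracket (Relations.toIdeal ℂ A) x y }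

lemma serreMap_surjective : Function.Surjective (serreMap A) :=
  LieSubmodule.Quotient.surjective_mk' (Relations.toIdeal ℂ A)

lemma serreMap_of (g : Generators B) : serreMap A (FreeLieAlgebra.of ℂ g) = serreGen A g := rfl

lemma serreMap_eq_zero {x : FreeLieAlgebra ℂ (Generators B)} (hx : x ∈ Relations.toSet ℂ A) :
    serreMap A x = 0 :=
  (LieSubmodule.Quotient.mk_eq_zero (Relations.toIdeal ℂ A)).2 (LieSubmodule.subset_lieSpan hx)

/-- A homomorphism out of the free Lie algebra that kills the Serre relations descends to the
Lie algebra of the Cartan matrix. -/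
lemma exists_comp_serreMap {L : Type*} [LieRing L] [LieAlgebra ℂ L]
    (f : FreeLieAlgebra ℂ (Generators B) →ₗ⁅ℂ⁆ L) (hf : ∀ x ∈ Relations.toSet ℂ A, f x = 0) :
    ∃ g : A.ToLieAlgebra ℂ →ₗ⁅ℂ⁆ L, ∀ x, g (serreMap A x) = f x := by
  have hker : Relations.toIdeal ℂ A ≤ f.ker :=
    LieSubmodule.lieSpan_le.2 fun x hx => f.mem_ker.2 (hf x hx)
  let g₀ : (FreeLieAlgebra ℂ (Generators B) ⧸ Relations.toIdeal ℂ A) →ₗ[ℂ] L :=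
    Submodule.liftQ (Relations.toIdeal ℂ A).toSubmodule (f : _ →ₗ[ℂ] L)
      fun x hx => LinearMap.mem_ker.2 (f.mem_ker.1 (hker hx))
  have hg₀ : ∀ x, g₀ (serreMap A x) = f x := fun x => rfl
  refine ⟨{ (show A.ToLieAlgebra ℂ →ₗ[ℂ] L from g₀) with map_lie' := ?_ }, hg₀⟩
  intro x y
  obtain ⟨x, rfl⟩ := serreMap_surjective A x
  obtain ⟨y, rfl⟩ := serreMap_surjective A y
  rw [← LieHom.map_lie]
  exact (hg₀ _).trans (f.map_lie x y)

lemma lieSpan_range_serreGen :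
    LieSubalgebra.lieSpan ℂ (A.ToLieAlgebra ℂ) (Set.range (serreGen A)) = ⊤ := by
  set K := LieSubalgebra.lieSpan ℂ (A.ToLieAlgebra ℂ) (Set.range (serreGen A)) with hK
  have hmem : ∀ g, serreGen A g ∈ K := fun g => LieSubalgebra.subset_lieSpan ⟨g, rfl⟩
  have hcomp : K.incl.comp (FreeLieAlgebra.lift ℂ fun g => (⟨serreGen A g, hmem g⟩ : K)) =
      serreMap A := by
    apply FreeLieAlgebra.hom_ext
    intro g
    rw [LieHom.comp_apply, FreeLieAlgebra.lift_of_apply]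
    rfl
  refine eq_top_iff.2 fun x _ => ?_
  obtain ⟨x, rfl⟩ := serreMap_surjective A x
  rw [← hcomp]
  exact (FreeLieAlgebra.lift ℂ (fun g => (⟨serreGen A g, hmem g⟩ : K)) x).2

lemma lie_serreGen_H_H (i j : B) : ⁅serreGen A (.H i), serreGen A (.H j)⁆ = 0 := by
  rw [← serreMap_of, ← serreMap_of, ← LieHom.map_lie]
  exact serreMap_eq_zero A (by
    simp only [Relations.toSet, Set.mem_union]
    exact .inl (.inl (.inl (.inl (.inl ⟨(i, j), rfl⟩)))))

lemma lie_serreGen_E_F_self (i : B) :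
    ⁅serreGen A (.E i), serreGen A (.F i)⁆ = serreGen A (.H i) := by
  rw [← serreMap_of, ← serreMap_of, ← serreMap_of, ← LieHom.map_lie, ← sub_eq_zero, ← map_sub]
  exact serreMap_eq_zero A (by
    simp only [Relations.toSet, Set.mem_union]
    exact .inl (.inl (.inl (.inl (.inr ⟨(i, i), by simp [Relations.EF]⟩)))))

lemma lie_serreGen_E_F {i j : B} (hij : i ≠ j) :
    ⁅serreGen A (.E i), serreGen A (.F j)⁆ = 0 := by
  rw [← serreMap_of, ← serreMap_of, ← LieHom.map_lie]
  exact serreMap_eq_zero A (by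
    simp only [Relations.toSet, Set.mem_union]
    exact .inl (.inl (.inl (.inl (.inr ⟨(i, j), by simp [Relations.EF, hij]⟩)))))

lemma lie_serreGen_H_E (i j : B) :
    ⁅serreGen A (.H i), serreGen A (.E j)⁆ = A i j • serreGen A (.E j) := by
  rw [← serreMap_of, ← serreMap_of, ← LieHom.map_lie, ← sub_eq_zero, ← map_zsmul, ← map_sub]
  exact serreMap_eq_zero A (by
    simp only [Relations.toSet, Set.mem_union]
    exact .inl (.inl (.inl (.inr ⟨(i, j), by simp [Relations.HE]⟩))))

lemma lie_serreGen_H_F (i j : B) :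
    ⁅serreGen A (.H i), serreGen A (.F j)⁆ = -(A i j • serreGen A (.F j)) := by
  rw [← serreMap_of, ← serreMap_of, ← LieHom.map_lie, ← add_eq_zero_iff_eq_neg, ← map_zsmul,
    ← map_add]
  exact serreMap_eq_zero A (by
    simp only [Relations.toSet, Set.mem_union]
    exact .inl (.inl (.inr ⟨(i, j), by simp [Relations.HF]⟩)))

end Serre

/-! ### The representation on a minuscule set of weights: existence and uniqueness -/

section WeightRep

open CartanMatrix

variable {n : ℕ} {Ω : Set (EuclideanSpace ℝ (Fin n))} {B : Type} [DecidableEq B]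
  {A : Matrix B B ℤ} {α : B → EuclideanSpace ℝ (Fin n)}

/-- The operator by which a Serre generator acts. -/
def genOp (Ω : Set (EuclideanSpace ℝ (Fin n))) (α : B → EuclideanSpace ℝ (Fin n)) :
    Generators B → Module.End ℂ (WeightSpace Ω)
  | .H i => opH Ω (α i)
  | .E i => opE Ω (α i)
  | .F i => opF Ω (α i)

lemma isWeightRep_iff {ρ : A.ToLieAlgebra ℂ →ₗ⁅ℂ⁆ Module.End ℂ (WeightSpace Ω)} :
    IsWeightRep A Ω α ρ ↔ ∀ g, ρ (serreGen A g) = genOp Ω α g := by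
  constructor
  · rintro h (i | i | i)
    exacts [(h i).2.2, (h i).1, (h i).2.1]
  · exact fun h i => ⟨h (.E i), h (.F i), h (.H i)⟩

lemma map_lie_eq_commutator {L V : Type*} [LieRing L] [LieAlgebra ℂ L] [AddCommGroup V]
    [Module ℂ V] (ρ : L →ₗ⁅ℂ⁆ Module.End ℂ V) (x y : L) : ρ ⁅x, y⁆ = ρ x * ρ y - ρ y * ρ x :=
  ρ.map_lie x y

/-- All Cartan entries are 2, 0 or -1, so each relation is one of the operator identities above. -/
theorem IsMinuscule.map_relation_eq_zero (h : IsMinuscule A Ω α)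
    {f : FreeLieAlgebra ℂ (Generators B) →ₗ⁅ℂ⁆ Module.End ℂ (WeightSpace Ω)}
    (hf : ∀ g, f (FreeLieAlgebra.of ℂ g) = genOp Ω α g) {x : FreeLieAlgebra ℂ (Generators B)}
    (hx : x ∈ Relations.toSet ℂ A) : f x = 0 := by
  have hne : ∀ i j : B, i = j ∨ A i j = 0 ∨ A i j = -1 := fun i j =>
    or_iff_not_imp_left.2 (h.off_diag i j)
  -- The Serre relations are also imposed for `i = j`; there the exponent truncates to 0 and the
  -- relation reads `⁅e_i, e_i⁆ = 0`.
  have hz : (-2 : ℤ).toNat = 0 := rfl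
  simp only [Relations.toSet, Set.mem_union] at hx
  obtain ((((⟨⟨i, j⟩, rfl⟩ | ⟨⟨i, j⟩, rfl⟩) | ⟨⟨i, j⟩, rfl⟩) | ⟨⟨i, j⟩, rfl⟩) | ⟨⟨i, j⟩, rfl⟩) |
    ⟨⟨i, j⟩, rfl⟩ := hx
  · simp only [Relations.HH, Function.uncurry_apply_pair, Function.comp_apply,
      map_lie_eq_commutator, hf]
    exact h.commutator_opH_opH i j
  · simp only [Relations.EF, Function.uncurry_apply_pair, Function.comp_apply]
    split_ifs with hij
    · simp only [map_sub, map_lie_eq_commutator, hf]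
      exact sub_eq_zero.2 (h.commutator_opE_opF_self i)
    · simp only [map_lie_eq_commutator, hf]
      exact h.commutator_opE_opF hij
  · simp only [Relations.HE, Function.uncurry_apply_pair, Function.comp_apply, map_sub, map_zsmul,
      map_lie_eq_commutator, hf]
    rw [sub_eq_zero, ← Int.cast_smul_eq_zsmul ℂ]
    exact h.commutator_opH_opE i j
  · simp only [Relations.HF, Function.uncurry_apply_pair, Function.comp_apply, map_add, map_zsmul,
      map_lie_eq_commutator, hf]
    refine (add_eq_zero_iff_eq_neg (G := Module.End ℂ (WeightSpace Ω))).2 ?_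
    rw [← Int.cast_smul_eq_zsmul ℂ, ← neg_smul]
    exact h.commutator_opH_opF i j
  · simp only [Relations.adE, Function.uncurry_apply_pair, Function.comp_apply]
    rcases hne i j with rfl | hij | hij
    · rw [h.diag, hz, pow_zero, Module.End.one_apply, lie_self, map_zero]
    · rw [hij, neg_zero, Int.toNat_zero, pow_zero, Module.End.one_apply, map_lie_eq_commutator,
        hf, hf]
      exact sub_eq_zero.2 (LinearMap.ext (h.opE_opE_comm hij) :
        opE Ω (α i) * opE Ω (α j) = opE Ω (α j) * opE Ω (α i))
    · rw [hij, neg_neg, Int.toNat_one, pow_one, LieAlgebra.ad_apply]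
      simp only [map_lie_eq_commutator, hf]
      refine LinearMap.ext fun x => ?_
      simp [genOp, h.opE_opE_opE hij, h.opE_opE_self]
  · simp only [Relations.adF, Function.uncurry_apply_pair, Function.comp_apply]
    rcases hne i j with rfl | hij | hij
    · rw [h.diag, hz, pow_zero, Module.End.one_apply, lie_self, map_zero]
    · rw [hij, neg_zero, Int.toNat_zero, pow_zero, Module.End.one_apply, map_lie_eq_commutator,
        hf, hf]
      exact sub_eq_zero.2 (LinearMap.ext (h.opF_opF_comm hij) :
        opF Ω (α i) * opF Ω (α j) = opF Ω (α j) * opF Ω (α i))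
    · rw [hij, neg_neg, Int.toNat_one, pow_one, LieAlgebra.ad_apply]
      simp only [map_lie_eq_commutator, hf]
      refine LinearMap.ext fun x => ?_
      simp [genOp, h.opF_opF_opF hij, h.opF_opF_self]

/-- A minuscule set of weights carries exactly one representation of the Lie algebra with the
given Cartan matrix in which the Serre generators act by the operators `E`, `F`, `H`. -/
theorem IsMinuscule.existsUnique_isWeightRep (h : IsMinuscule A Ω α) :
    ∃! ρ, IsWeightRep A Ω α ρ := by
  obtain ⟨ρ, hρ⟩ := exists_comp_serreMap A (FreeLieAlgebra.lift ℂ (genOp Ω α)) fun x hx =>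
    h.map_relation_eq_zero (fun g => FreeLieAlgebra.lift_of_apply ..) hx
  refine ⟨ρ, isWeightRep_iff.2 fun g => ?_, fun ρ' hρ' => ?_⟩
  · rw [← serreMap_of, hρ, FreeLieAlgebra.lift_of_apply]
  · have hcomp : ρ'.comp (serreMap A) = ρ.comp (serreMap A) := by
      apply FreeLieAlgebra.hom_ext
      intro g
      rw [LieHom.comp_apply, LieHom.comp_apply, hρ, FreeLieAlgebra.lift_of_apply, serreMap_of,
        isWeightRep_iff.1 hρ']
    refine LieHom.ext fun x => ?_
    obtain ⟨x, rfl⟩ := serreMap_surjective A x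
    exact DFunLike.congr_fun hcomp x

end WeightRep


/-! ### The triangular decomposition -/

section Triangular

variable {L B : Type*} [LieRing L] [LieAlgebra ℂ L] {e f h : B → L} {c : B → B → ℂ}

/-- Bracketing with `h i` is a derivation that multiplies the generators by scalars, so it preserves
the subalgebra they generate. -/
lemma lie_mem_lieSpan_of_lie_eq_smul (he : ∀ i j, ⁅h i, e j⁆ = c i j • e j) {x a : L}
    (ha : a ∈ Submodule.span ℂ (Set.range h))
    (hx : x ∈ LieSubalgebra.lieSpan ℂ L (Set.range e)) :
    ⁅a, x⁆ ∈ LieSubalgebra.lieSpan ℂ L (Set.range e) := by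
  induction ha using Submodule.span_induction with
  | zero => simp
  | add a b _ _ ha hb => rw [add_lie]; exact add_mem ha hb
  | smul t a _ ha => rw [smul_lie]; exact (LieSubalgebra.lieSpan ℂ L _).smul_mem t ha
  | mem a ha =>
    obtain ⟨i, rfl⟩ := ha
    induction hx using LieSubalgebra.lieSpan_induction with
    | mem x hx =>
      obtain ⟨j, rfl⟩ := hx
      rw [he]
      exact (LieSubalgebra.lieSpan ℂ L _).smul_mem _ (LieSubalgebra.subset_lieSpan ⟨j, rfl⟩)
    | zero => simp
    | smul t x _ hx => rw [lie_smul]; exact (LieSubalgebra.lieSpan ℂ L _).smul_mem t hx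
    | add x y _ _ hx hy => rw [lie_add]; exact add_mem hx hy
    | lie x y hx' hy' hx hy =>
      rw [leibniz_lie]
      exact add_mem (LieSubalgebra.lie_mem _ hx hy') (LieSubalgebra.lie_mem _ hx' hy)

/-- Bracketing with `f i` is a derivation that sends the generators `e j` into the span of the `h`;
by the Leibniz rule a bracket of two elements is then sent into the subalgebra itself. -/
lemma lie_mem_span_sup_lieSpan (he : ∀ i j, ⁅h i, e j⁆ = c i j • e j)
    (hfe : ∀ i j, ⁅f i, e j⁆ ∈ Submodule.span ℂ (Set.range h)) (i : B) {x : L}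
    (hx : x ∈ LieSubalgebra.lieSpan ℂ L (Set.range e)) :
    ⁅f i, x⁆ ∈ Submodule.span ℂ (Set.range h) ⊔
      (LieSubalgebra.lieSpan ℂ L (Set.range e)).toSubmodule := by
  have key : ∀ {a y : L}, a ∈ Submodule.span ℂ (Set.range h) ⊔
      (LieSubalgebra.lieSpan ℂ L (Set.range e)).toSubmodule →
      y ∈ LieSubalgebra.lieSpan ℂ L (Set.range e) →
      ⁅a, y⁆ ∈ LieSubalgebra.lieSpan ℂ L (Set.range e) := by
    intro a y ha hy
    obtain ⟨p, hp, q, hq, rfl⟩ := Submodule.mem_sup.1 ha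
    rw [add_lie]
    exact add_mem (lie_mem_lieSpan_of_lie_eq_smul he hp hy) (LieSubalgebra.lie_mem _ hq hy)
  induction hx using LieSubalgebra.lieSpan_induction with
  | mem x hx =>
    obtain ⟨j, rfl⟩ := hx
    exact Submodule.mem_sup_left (hfe i j)
  | zero => simp
  | smul t x _ hx => rw [lie_smul]; exact Submodule.smul_mem _ t hx
  | add x y _ _ hx hy => rw [lie_add]; exact add_mem hx hy
  | lie x y hx' hy' hx hy =>
    rw [leibniz_lie, ← lie_skew x]
    exact Submodule.mem_sup_right (add_mem (key hx hy') (neg_mem (key hy hx')))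

/-- A Lie algebra generated by elements `e i`, `f i`, `h i` that satisfy the commutation relations
of Serre generators is the sum of the subalgebra generated by the `f i`, the span of the `h i`
and the subalgebra generated by the `e i`. -/
theorem triangular_decomposition (hh : ∀ i j, ⁅h i, h j⁆ = 0)
    (he : ∀ i j, ⁅h i, e j⁆ = c i j • e j) (hf : ∀ i j, ⁅h i, f j⁆ = -c i j • f j)
    (hef : ∀ i j, ⁅e i, f j⁆ ∈ Submodule.span ℂ (Set.range h))
    (htop : LieSubalgebra.lieSpan ℂ L (Set.range e ∪ Set.range f ∪ Set.range h) = ⊤) (x : L) :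
    x ∈ (LieSubalgebra.lieSpan ℂ L (Set.range f)).toSubmodule ⊔ Submodule.span ℂ (Set.range h) ⊔
      (LieSubalgebra.lieSpan ℂ L (Set.range e)).toSubmodule := by
  set U := (LieSubalgebra.lieSpan ℂ L (Set.range f)).toSubmodule with hU
  set H := Submodule.span ℂ (Set.range h) with hH
  set V := (LieSubalgebra.lieSpan ℂ L (Set.range e)).toSubmodule with hV
  have hUle : U ≤ U ⊔ H ⊔ V := le_sup_left.trans le_sup_left
  have hHle : H ≤ U ⊔ H ⊔ V := le_sup_right.trans le_sup_left
  have hVle : V ≤ U ⊔ H ⊔ V := le_sup_right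
  have heV : ∀ i, e i ∈ V := fun i => LieSubalgebra.subset_lieSpan ⟨i, rfl⟩
  have hfU : ∀ i, f i ∈ U := fun i => LieSubalgebra.subset_lieSpan ⟨i, rfl⟩
  have hhH : ∀ i, h i ∈ H := fun i => Submodule.subset_span ⟨i, rfl⟩
  have hfe : ∀ i j, ⁅f i, e j⁆ ∈ H := fun i j => by
    rw [← lie_skew]; exact neg_mem (hef j i)
  have hHV : ∀ {a y}, a ∈ H → y ∈ V → ⁅a, y⁆ ∈ V := fun ha hy =>
    lie_mem_lieSpan_of_lie_eq_smul he ha hy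
  have hHU : ∀ {a y}, a ∈ H → y ∈ U → ⁅a, y⁆ ∈ U := fun ha hy =>
    lie_mem_lieSpan_of_lie_eq_smul hf ha hy
  have hHH : ∀ i, ∀ a ∈ H, ⁅h i, a⁆ = 0 := by
    intro i a ha
    induction ha using Submodule.span_induction with
    | zero => simp
    | add a b _ _ ha hb => rw [lie_add, ha, hb, add_zero]
    | smul t a _ ha => rw [lie_smul, ha, smul_zero]
    | mem a ha => obtain ⟨j, rfl⟩ := ha; exact hh i j
  have hgen : ∀ g ∈ Set.range e ∪ Set.range f ∪ Set.range h, g ∈ U ⊔ H ⊔ V ∧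
      ∀ z ∈ U ⊔ H ⊔ V, ⁅g, z⁆ ∈ U ⊔ H ⊔ V := by
    rintro _ ((⟨i, rfl⟩ | ⟨i, rfl⟩) | ⟨i, rfl⟩)
    · refine ⟨hVle (heV i), fun z hz => ?_⟩
      obtain ⟨ab, hab, y, hy, rfl⟩ := Submodule.mem_sup.1 hz
      obtain ⟨a, ha, b, hb, rfl⟩ := Submodule.mem_sup.1 hab
      rw [lie_add, lie_add, ← lie_skew _ b]
      refine add_mem (add_mem ?_ (hVle (neg_mem (hHV hb (heV i)))))
        (hVle (LieSubalgebra.lie_mem _ (heV i) hy))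
      exact sup_le hHle hUle (lie_mem_span_sup_lieSpan hf hef i ha)
    · refine ⟨hUle (hfU i), fun z hz => ?_⟩
      obtain ⟨ab, hab, y, hy, rfl⟩ := Submodule.mem_sup.1 hz
      obtain ⟨a, ha, b, hb, rfl⟩ := Submodule.mem_sup.1 hab
      rw [lie_add, lie_add, ← lie_skew _ b]
      refine add_mem (add_mem (hUle (LieSubalgebra.lie_mem _ (hfU i) ha))
        (hUle (neg_mem (hHU hb (hfU i))))) ?_
      exact sup_le hHle hVle (lie_mem_span_sup_lieSpan he hfe i hy)
    · refine ⟨hHle (hhH i), fun z hz => ?_⟩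
      obtain ⟨ab, hab, y, hy, rfl⟩ := Submodule.mem_sup.1 hz
      obtain ⟨a, ha, b, hb, rfl⟩ := Submodule.mem_sup.1 hab
      rw [lie_add, lie_add, hHH i b hb, add_zero]
      exact add_mem (hUle (hHU (hhH i) ha)) (hVle (hHV (hhH i) hy))
  have hx : x ∈ LieSubalgebra.lieSpan ℂ L (Set.range e ∪ Set.range f ∪ Set.range h) := by
    rw [htop]; trivial
  -- The statement is strengthened by stability of the sum under bracketing with `x`, so that it
  -- passes to brackets.
  suffices hmain : x ∈ U ⊔ H ⊔ V ∧ ∀ z ∈ U ⊔ H ⊔ V, ⁅x, z⁆ ∈ U ⊔ H ⊔ V from hmain.1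
  induction hx using LieSubalgebra.lieSpan_induction with
  | mem x hx => exact hgen x hx
  | zero => exact ⟨zero_mem _, fun z _ => by rw [zero_lie]; exact zero_mem _⟩
  | smul t x _ hx =>
    refine ⟨Submodule.smul_mem _ t hx.1, fun z hz => ?_⟩
    rw [smul_lie]
    exact Submodule.smul_mem _ t (hx.2 z hz)
  | add x y _ _ hx hy =>
    refine ⟨add_mem hx.1 hy.1, fun z hz => ?_⟩
    rw [add_lie]
    exact add_mem (hx.2 z hz) (hy.2 z hz)
  | lie x y _ _ hx hy =>
    refine ⟨hx.2 y hy.1, fun z hz => ?_⟩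
    rw [lie_lie]
    exact sub_mem (hx.2 _ (hy.2 z hz)) (hy.2 _ (hx.2 z hz))

end Triangular

/-! ### Signs of the weight differences that occur in the representation -/

section WeightRep

open CartanMatrix

variable {n : ℕ} {Ω : Set (EuclideanSpace ℝ (Fin n))}

/-- The operator does not decrease any of the given functionals on the support of a vector. -/
def Raises {K : Type} (ω : K → EuclideanSpace ℝ (Fin n) →ₗ[ℝ] ℝ)
    (M : Module.End ℂ (WeightSpace Ω)) : Prop :=
  ∀ (w : EuclideanSpace ℝ (Fin n)) (y : WeightSpace Ω),
    (∀ u, coeffAt y u ≠ 0 → ∀ k, ω k w ≤ ω k u) → ∀ u, coeffAt (M y) u ≠ 0 → ∀ k, ω k w ≤ ω k u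

namespace Raises

variable {K : Type} {ω : K → EuclideanSpace ℝ (Fin n) →ₗ[ℝ] ℝ}
  {M N : Module.End ℂ (WeightSpace Ω)}

lemma zero : Raises ω (0 : Module.End ℂ (WeightSpace Ω)) :=
  fun _ _ _ _ hu => absurd (coeffAt_zero _) hu

lemma add (hM : Raises ω M) (hN : Raises ω N) : Raises ω (M + N) := by
  intro w y hy u hu
  rw [LinearMap.add_apply, coeffAt_add] at hu
  by_cases h0 : coeffAt (M y) u = 0
  · rw [h0, zero_add] at hu
    exact hN w y hy u hu
  · exact hM w y hy u h0

lemma smul (c : ℂ) (hM : Raises ω M) : Raises ω (c • M) := by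
  intro w y hy u hu
  rw [LinearMap.smul_apply, coeffAt_smul] at hu
  exact hM w y hy u (right_ne_zero_of_mul hu)

lemma mul (hM : Raises ω M) (hN : Raises ω N) : Raises ω (M * N) :=
  fun w y hy => hM w _ (hN w y hy)

lemma sub (hM : Raises ω M) (hN : Raises ω N) : Raises ω (M - N) := by
  have hMN : M - N = M + (-1 : ℂ) • N := LinearMap.ext fun x => by simp [sub_eq_add_neg]
  exact hMN ▸ hM.add (hN.smul (-1))

lemma opE {a : EuclideanSpace ℝ (Fin n)} (ha : ∀ k, 0 ≤ ω k a) : Raises ω (opE Ω a) := by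
  intro w y hy u hu k
  by_cases h : u ∈ Ω
  · rw [coeffAt_opE_of_mem _ _ h] at hu
    have := hy _ hu k
    rw [map_sub] at this
    linarith [ha k]
  · exact absurd (coeffAt_of_notMem _ h) hu

lemma opF {a : EuclideanSpace ℝ (Fin n)} (ha : ∀ k, ω k a ≤ 0) : Raises ω (opF Ω a) := by
  intro w y hy u hu k
  by_cases h : u ∈ Ω
  · rw [coeffAt_opF_of_mem _ _ h] at hu
    have := hy _ hu k
    rw [map_add] at this
    linarith [ha k]
  · exact absurd (coeffAt_of_notMem _ h) hu

lemma opH (a : EuclideanSpace ℝ (Fin n)) : Raises ω (opH Ω a) := by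
  intro w y hy u hu
  rw [coeffAt_opH] at hu
  exact hy u (right_ne_zero_of_mul hu)

lemma le_of_coeffAt_ne_zero (hM : Raises ω M) {w : Ω} {u : EuclideanSpace ℝ (Fin n)}
    (hu : coeffAt (M (basisVec w)) u ≠ 0) (k : K) : ω k w ≤ ω k u := by
  refine hM w _ (fun u hu k => ?_) u hu k
  rw [coeffAt_basisVec] at hu
  rw [of_not_not fun h => hu (if_neg h)]

lemma of_mem_lieSpan {L : Type*} [LieRing L] [LieAlgebra ℂ L]
    (ρ : L →ₗ⁅ℂ⁆ Module.End ℂ (WeightSpace Ω)) {s : Set L} (hs : ∀ x ∈ s, Raises ω (ρ x)) {x : L}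
    (hx : x ∈ LieSubalgebra.lieSpan ℂ L s) : Raises ω (ρ x) := by
  induction hx using LieSubalgebra.lieSpan_induction with
  | mem x hx => exact hs x hx
  | zero => rw [map_zero]; exact zero
  | smul t x _ hx => rw [map_smul]; exact hx.smul t
  | add x y _ _ hx hy => rw [map_add]; exact hx.add hy
  | lie x y _ _ hx hy =>
    rw [map_lie_eq_commutator]
    exact (hx.mul hy).sub (hy.mul hx)

lemma of_mem_span {L : Type*} [LieRing L] [LieAlgebra ℂ L]
    (ρ : L →ₗ⁅ℂ⁆ Module.End ℂ (WeightSpace Ω)) {s : Set L} (hs : ∀ x ∈ s, Raises ω (ρ x)) {x : L}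
    (hx : x ∈ Submodule.span ℂ s) : Raises ω (ρ x) :=
  of_mem_lieSpan ρ hs (LieSubalgebra.submodule_span_le_lieSpan hx)

end Raises

variable {B : Type} [DecidableEq B] {A : Matrix B B ℤ} {α : B → EuclideanSpace ℝ (Fin n)}
  {ρ : A.ToLieAlgebra ℂ →ₗ⁅ℂ⁆ Module.End ℂ (WeightSpace Ω)}

lemma range_serreGen :
    Set.range (serreGen A) = Set.range (fun i => serreGen A (.E i)) ∪
      Set.range (fun i => serreGen A (.F i)) ∪ Set.range (fun i => serreGen A (.H i)) := by
  ext x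
  constructor
  · rintro ⟨i | i | i, rfl⟩
    exacts [.inr ⟨i, rfl⟩, .inl (.inl ⟨i, rfl⟩), .inl (.inr ⟨i, rfl⟩)]
  · rintro ((⟨i, rfl⟩ | ⟨i, rfl⟩) | ⟨i, rfl⟩) <;> exact ⟨_, rfl⟩

lemma mem_triangular (x : A.ToLieAlgebra ℂ) :
    x ∈ (LieSubalgebra.lieSpan ℂ _ (Set.range fun i => serreGen A (.F i))).toSubmodule ⊔
      Submodule.span ℂ (Set.range fun i => serreGen A (.H i)) ⊔
      (LieSubalgebra.lieSpan ℂ _ (Set.range fun i => serreGen A (.E i))).toSubmodule := by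
  refine triangular_decomposition (c := fun i j => ((A i j : ℤ) : ℂ)) (lie_serreGen_H_H A)
    (fun i j => ?_) (fun i j => ?_) (fun i j => ?_) ?_ x
  · rw [lie_serreGen_H_E, Int.cast_smul_eq_zsmul]
  · rw [lie_serreGen_H_F, neg_smul, Int.cast_smul_eq_zsmul]
  · by_cases hij : i = j
    · rw [← hij, lie_serreGen_E_F_self]
      exact Submodule.subset_span ⟨i, rfl⟩
    · rw [lie_serreGen_E_F A hij]
      exact zero_mem _
  · rw [← range_serreGen, lieSpan_range_serreGen]

/-- If a weight occurs in the image of a weight vector, then the difference of the weights is a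
combination of simple roots whose coefficients do not have mixed signs. -/
lemma IsWeightRep.le_or_le (hρ : IsWeightRep A Ω α ρ) {K : Type}
    {ω : K → EuclideanSpace ℝ (Fin n) →ₗ[ℝ] ℝ} (hω : ∀ k i, 0 ≤ ω k (α i)) {w u : Ω}
    {x : A.ToLieAlgebra ℂ} (hu : ρ x (basisVec w) u ≠ 0) :
    (∀ k, ω k w ≤ ω k u) ∨ ∀ k, ω k u ≤ ω k w := by
  obtain ⟨yz, hyz, p, hp, rfl⟩ := Submodule.mem_sup.1 (mem_triangular x)
  obtain ⟨y, hy, z, hz, rfl⟩ := Submodule.mem_sup.1 hyz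
  have hp' : Raises ω (ρ p) := Raises.of_mem_lieSpan ρ
    (by rintro _ ⟨i, rfl⟩; rw [(hρ i).1]; exact Raises.opE fun k => hω k i) hp
  have hz' : Raises ω (ρ z) := Raises.of_mem_span ρ
    (by rintro _ ⟨i, rfl⟩; rw [(hρ i).2.2]; exact Raises.opH _) hz
  -- The lowering part raises the negatives of the functionals.
  have hy' : Raises (-ω) (ρ y) := Raises.of_mem_lieSpan ρ
    (by
      rintro _ ⟨i, rfl⟩
      rw [(hρ i).2.1]
      exact Raises.opF fun k => neg_nonpos.2 (hω k i)) hy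
  rw [map_add, map_add, add_assoc, LinearMap.add_apply, ← coeffAt_coe, coeffAt_add] at hu
  by_cases h0 : coeffAt (ρ y (basisVec w)) u = 0
  · rw [h0, zero_add] at hu
    exact .inl ((hz'.add hp').le_of_coeffAt_ne_zero hu)
  · exact .inr fun k => neg_le_neg_iff.1 (hy'.le_of_coeffAt_ne_zero h0 k)

end WeightRep


/-! ### Simple reflections -/

section WeightRep

variable {n : ℕ} {Ω : Set (EuclideanSpace ℝ (Fin n))}

/-- The image of a representation is stable under conjugation by `1 + ρ g` if `ρ g` squares
to zero. -/
lemma exists_map_eq_conj {L V : Type*} [LieRing L] [LieAlgebra ℂ L] [AddCommGroup V]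
    [Module ℂ V] (ρ : L →ₗ⁅ℂ⁆ Module.End ℂ V) {g : L} (hg : ρ g * ρ g = 0) (x : L) :
    ∃ x', ρ x' = (1 + ρ g) * ρ x * (1 - ρ g) := by
  -- This is `exp (ad g) x` cut off after the quadratic term; as `ρ g` squares to zero, the higher
  -- terms act as 0 and `exp (ρ g) = 1 + ρ g`.
  refine ⟨x + ⁅g, x⁆ + (2⁻¹ : ℂ) • ⁅g, ⁅g, x⁆⁆, ?_⟩
  have h1 : ρ g * (ρ g * ρ x - ρ x * ρ g) - (ρ g * ρ x - ρ x * ρ g) * ρ g =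
      (2 : ℂ) • -(ρ g * ρ x * ρ g) := by
    have h2 : ρ g * (ρ g * ρ x - ρ x * ρ g) - (ρ g * ρ x - ρ x * ρ g) * ρ g =
        ρ g * ρ g * ρ x - ρ g * ρ x * ρ g - ρ g * ρ x * ρ g + ρ x * (ρ g * ρ g) := by
      noncomm_ring
    rw [h2, hg, two_smul]
    noncomm_ring
  rw [map_add, map_add, map_smul, map_lie_eq_commutator, map_lie_eq_commutator,
    map_lie_eq_commutator, h1, smul_smul, inv_mul_cancel₀ two_ne_zero, one_smul]
  noncomm_ring

/-- The reflection in the hyperplane orthogonal to a root of norm `32`. -/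
def rootReflection (a v : EuclideanSpace ℝ (Fin n)) : EuclideanSpace ℝ (Fin n) :=
  v - (inner ℝ v a / 16) • a

/-- The product `(1 + c E) (1 - c F) (1 + c E)`, which acts by a reflection on the weights
if `c = ± 1`. -/
def reflectionOp (Ω : Set (EuclideanSpace ℝ (Fin n))) (a : EuclideanSpace ℝ (Fin n)) (c : ℂ) :
    Module.End ℂ (WeightSpace Ω) :=
  (1 + c • opE Ω a) * (1 - c • opF Ω a) * (1 + c • opE Ω a)

lemma rootReflection_sub (a v w : EuclideanSpace ℝ (Fin n)) :
    rootReflection a v - rootReflection a w = rootReflection a (v - w) := by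
  rw [rootReflection, rootReflection, rootReflection, inner_sub_left, sub_div, sub_smul]
  abel

lemma norm_rootReflection {a : EuclideanSpace ℝ (Fin n)} (ha : inner ℝ a a = (32 : ℝ))
    (v : EuclideanSpace ℝ (Fin n)) : ‖rootReflection a v‖ ^ 2 = ‖v‖ ^ 2 := by
  rw [rootReflection, norm_sub_sq_real, norm_smul, mul_pow, ← real_inner_self_eq_norm_sq a, ha,
    inner_smul_right, Real.norm_eq_abs, sq_abs]
  ring

lemma rootReflection_rootReflection {a : EuclideanSpace ℝ (Fin n)} (ha : inner ℝ a a = (32 : ℝ))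
    (v : EuclideanSpace ℝ (Fin n)) : rootReflection a (rootReflection a v) = v := by
  have h1 : inner ℝ (rootReflection a v) a = -inner ℝ v a := by
    rw [rootReflection, inner_sub_left, real_inner_smul_left, ha]
    ring
  rw [rootReflection, h1, rootReflection, neg_div, neg_smul]
  abel

namespace IsMinuscule

variable {B : Type} {A : Matrix B B ℤ} {α : B → EuclideanSpace ℝ (Fin n)}

lemma inner_root_self (h : IsMinuscule A Ω α) (i : B) : inner ℝ (α i) (α i) = (32 : ℝ) := by
  rw [h.inner_root, h.diag]
  norm_num

lemma rootReflection_mem (h : IsMinuscule A Ω α)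
    {e : EuclideanSpace ℝ (Fin n)} (he : e ∈ Ω) (i : B) :
    rootReflection (α i) e ∈ Ω := by
  rw [rootReflection]
  rcases h.inner_cases e he i with h1 | h1 | h1
  · have := (h.add_mem e he i).2 h1
    rw [h1]; norm_num
    exact this
  · rw [h1]; simpa
  · have := (h.sub_mem e he i).2 h1
    rw [h1]; norm_num
    exact this

/-- On coefficients, `reflectionOp` is the reflection, up to signs. -/
lemma exists_coeffAt_reflectionOp (h : IsMinuscule A Ω α) (i : B) {c : ℂ} (hc : c * c = 1)
    {e : EuclideanSpace ℝ (Fin n)} (he : e ∈ Ω) :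
    ∃ ε : ℂ, ε ≠ 0 ∧ ∀ y, coeffAt (reflectionOp Ω (α i) c y) e =
      ε * coeffAt y (rootReflection (α i) e) := by
  have hc0 : c ≠ 0 := by rintro rfl; simp at hc
  have hE : ∀ (y : WeightSpace Ω) {e}, e ∈ Ω → coeffAt ((1 + c • opE Ω (α i)) y) e =
      coeffAt y e + c * if inner ℝ e (α i) = 16 then coeffAt y (e - α i) else 0 := by
    intro y e he
    rw [LinearMap.add_apply, Module.End.one_apply, LinearMap.smul_apply, coeffAt_add, coeffAt_smul,
      h.coeffAt_opE _ _ he]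
  have hF : ∀ (y : WeightSpace Ω) {e}, e ∈ Ω → coeffAt ((1 - c • opF Ω (α i)) y) e =
      coeffAt y e - c * if inner ℝ e (α i) = -16 then coeffAt y (e + α i) else 0 := by
    intro y e he
    rw [LinearMap.sub_apply, Module.End.one_apply, LinearMap.smul_apply, coeffAt_sub, coeffAt_smul,
      h.coeffAt_opF _ _ he]
  rw [rootReflection]
  simp only [reflectionOp, Module.End.mul_apply]
  rcases h.inner_cases e he i with h1 | h1 | h1
  · have he' := (h.add_mem e he i).2 h1
    have h2 : inner ℝ (e + α i) (α i) = 16 := by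
      rw [h.inner_add, h1, h.diag]; norm_num
    have hs : e - ((-16 : ℝ) / 16) • α i = e + α i := by norm_num
    refine ⟨-c, neg_ne_zero.2 hc0, fun y => ?_⟩
    rw [hE _ he, h1, if_neg (by norm_num), hF _ he, h1, if_pos rfl, hE _ he, h1,
      if_neg (by norm_num), hE _ he', h2, if_pos rfl, add_sub_cancel_right, hs]
    -- The contributions of `y` at `e` itself cancel because `c * c = 1`.
    linear_combination (-coeffAt y e) * hc
  · refine ⟨1, one_ne_zero, fun y => ?_⟩
    rw [hE _ he, h1, if_neg (by norm_num), hF _ he, h1, if_neg (by norm_num), hE _ he, h1,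
      if_neg (by norm_num), zero_div, zero_smul]
    simp
  · have he' := (h.sub_mem e he i).2 h1
    have h2 : inner ℝ (e - α i) (α i) = -16 := by
      rw [h.inner_sub, h1, h.diag]; norm_num
    have hs : e - ((16 : ℝ) / 16) • α i = e - α i := by norm_num
    refine ⟨c, hc0, fun y => ?_⟩
    rw [hE _ he, h1, if_pos rfl, hF _ he, h1, if_neg (by norm_num), hE _ he, h1, if_pos rfl,
      hF _ he', h2, if_pos rfl, hE _ he', h2, if_neg (by norm_num), sub_add_cancel, hE _ he, h1,
      if_pos rfl, hs]
    linear_combination (-coeffAt y e - c * coeffAt y (e - α i)) * hc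

lemma exists_reflectionOp_basisVec (h : IsMinuscule A Ω α)
    (i : B) {c : ℂ} (hc : c * c = 1) (v w : Ω)
    (hw : rootReflection (α i) v = w) :
    ∃ ε : ℂ, ε ≠ 0 ∧ reflectionOp Ω (α i) c (basisVec v) = ε • basisVec w := by
  obtain ⟨ε, hε, hcoeff⟩ := h.exists_coeffAt_reflectionOp i hc w.2
  refine ⟨ε, hε, ext_coeffAt fun e he => ?_⟩
  rw [coeffAt_smul, coeffAt_basisVec]
  split_ifs with hew
  · rw [hew, hcoeff, ← hw, rootReflection_rootReflection (h.inner_root_self i), coeffAt_basisVec,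
      if_pos rfl]
  · obtain ⟨ε', -, hcoeff'⟩ := h.exists_coeffAt_reflectionOp i hc he
    rw [hcoeff', coeffAt_basisVec, if_neg, mul_zero, mul_zero]
    intro hev
    apply hew
    rw [← hw, ← hev, rootReflection_rootReflection (h.inner_root_self i)]

variable [DecidableEq B] {ρ : A.ToLieAlgebra ℂ →ₗ⁅ℂ⁆ Module.End ℂ (WeightSpace Ω)}

/-- The image of the representation is stable under conjugation by the reflection operators. -/
lemma exists_map_eq_reflectionOp_conj (h : IsMinuscule A Ω α)
    (hρ : IsWeightRep A Ω α ρ) (i : B) (x : A.ToLieAlgebra ℂ) :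
    ∃ x', ρ x' = reflectionOp Ω (α i) 1 * ρ x * reflectionOp Ω (α i) (-1) := by
  have hE : ρ (serreGen A (.E i)) * ρ (serreGen A (.E i)) = 0 := by
    rw [(hρ i).1]
    exact LinearMap.ext (h.opE_opE_self i)
  have hF : ρ (-serreGen A (.F i)) * ρ (-serreGen A (.F i)) = 0 := by
    rw [map_neg, (hρ i).2.1]
    exact LinearMap.ext fun x => by simp [h.opF_opF_self i]
  -- Three conjugations, by `1 + E`, `1 - F` and `1 + E`; their inverses compose to the reflection
  -- operator with `c = -1`.
  obtain ⟨x₁, hx₁⟩ := exists_map_eq_conj ρ hE x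
  obtain ⟨x₂, hx₂⟩ := exists_map_eq_conj ρ hF x₁
  obtain ⟨x₃, hx₃⟩ := exists_map_eq_conj ρ hE x₂
  refine ⟨x₃, ?_⟩
  have hE' : 1 + (-1 : ℂ) • opE Ω (α i) = 1 - opE Ω (α i) :=
    LinearMap.ext fun x => by simp [sub_eq_add_neg]
  have hF' : 1 - (-1 : ℂ) • opF Ω (α i) = 1 + opF Ω (α i) := LinearMap.ext fun x => by simp
  rw [hx₃, hx₂, hx₁, map_neg, (hρ i).1, (hρ i).2.1, reflectionOp, reflectionOp, hE', hF']
  simp only [one_smul, ← sub_eq_add_neg, sub_neg_eq_add, mul_assoc]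

/-- If a weight occurs in the image of a weight vector, then this also holds for the reflected
weights. -/
lemma exists_rootReflection_ne_zero (h : IsMinuscule A Ω α)
    (hρ : IsWeightRep A Ω α ρ) (i : B) {w u w' u' : Ω}
    (hw : rootReflection (α i) w = w') (hu : rootReflection (α i) u = u') {x : A.ToLieAlgebra ℂ}
    (hx : ρ x (basisVec w) u ≠ 0) : ∃ x', ρ x' (basisVec w') u' ≠ 0 := by
  obtain ⟨x', hx'⟩ := h.exists_map_eq_reflectionOp_conj hρ i x
  have hw' : rootReflection (α i) w' = w := by
    rw [← hw, rootReflection_rootReflection (h.inner_root_self i)]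
  have hu' : rootReflection (α i) u' = u := by
    rw [← hu, rootReflection_rootReflection (h.inner_root_self i)]
  obtain ⟨ε, hε, h1⟩ := h.exists_reflectionOp_basisVec i (c := -1) (by norm_num) w' w hw'
  obtain ⟨ε', hε', h2⟩ := h.exists_coeffAt_reflectionOp i (c := 1) (by norm_num) u'.2
  refine ⟨x', ?_⟩
  rw [hx', Module.End.mul_apply, Module.End.mul_apply, h1, map_smul, map_smul, ← coeffAt_coe,
    coeffAt_smul, h2, hu', coeffAt_coe]
  exact mul_ne_zero hε (mul_ne_zero hε' hx)

/-- In the representation on a minuscule set of weights, the weights that occur in the image of a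
weight vector of weight `w` differ from `w` by a vector of norm `0` or `32`. -/
theorem norm_sub_sq_of_ne_zero (h : IsMinuscule A Ω α) [Fintype B] (hρ : IsWeightRep A Ω α ρ)
    {ω : B → EuclideanSpace ℝ (Fin n) →ₗ[ℝ] ℝ}
    (hω : ∀ k i, ω k (α i) = if k = i then 1 else 0)
    {c : B → ℤ} {w u : Ω} (hc : (u : EuclideanSpace ℝ (Fin n)) - w = ∑ i, (c i : ℝ) • α i)
    {x : A.ToLieAlgebra ℂ} (hx : ρ x (basisVec w) u ≠ 0) :
    ‖(u : EuclideanSpace ℝ (Fin n)) - w‖ ^ 2 = 0 ∨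
      ‖(u : EuclideanSpace ℝ (Fin n)) - w‖ ^ 2 = 32 := by
  have hωc : ∀ (c : B → ℤ) (w u : Ω),
      (u : EuclideanSpace ℝ (Fin n)) - w = ∑ i, (c i : ℝ) • α i → ∀ k, ω k u - ω k w = c k := by
    intro c w u hc k
    rw [← map_sub, hc, map_sum]
    simp [hω]
  have hsign : ∀ (c : B → ℤ) (w u : Ω),
      (u : EuclideanSpace ℝ (Fin n)) - w = ∑ i, (c i : ℝ) • α i → ∀ x, ρ x (basisVec w) u ≠ 0 →
      (∀ k, 0 ≤ c k) ∨ ∀ k, c k ≤ 0 := by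
    intro c w u hc x hx
    have hω0 : ∀ k i, 0 ≤ ω k (α i) := fun k i => by rw [hω]; split_ifs <;> norm_num
    refine (hρ.le_or_le hω0 hx).imp (fun h1 k => ?_) fun h1 k => ?_
    · have := hωc c w u hc k
      have : (0 : ℝ) ≤ c k := by linarith [h1 k]
      exact_mod_cast this
    · have := hωc c w u hc k
      have : (c k : ℝ) ≤ 0 := by linarith [h1 k]
      exact_mod_cast this
  -- Induction on the sum of the absolute values of the coefficients of `u - w`, over all pairs of
  -- weights that occur.
  induction hN : ∑ i, (c i).natAbs using Nat.strong_induction_on generalizing c w u x with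
  | _ N ih =>
  by_contra! hne
  set δ := (u : EuclideanSpace ℝ (Fin n)) - w with hδ
  -- Expanding `|δ| ^ 2 > 0` in simple roots yields an index at which the coefficient and the scalar
  -- product have the same sign.
  have hpos : 0 < ∑ i, (c i : ℝ) * inner ℝ δ (α i) := by
    have : ‖δ‖ ^ 2 = ∑ i, (c i : ℝ) * inner ℝ δ (α i) := by
      rw [← real_inner_self_eq_norm_sq]
      conv_lhs => rw [hc]
      rw [sum_inner]
      refine Finset.sum_congr rfl fun i _ => ?_
      rw [real_inner_smul_left, ← hc, real_inner_comm]
    rw [← this]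
    exact lt_of_le_of_ne (sq_nonneg _) hne.1.symm
  obtain ⟨i, -, hi⟩ := Finset.exists_lt_of_sum_lt
    (f := fun _ : B => (0 : ℝ)) (g := fun i => (c i : ℝ) * inner ℝ δ (α i)) (s := Finset.univ)
    (by simpa using hpos)
  -- Both weights have scalar product -16, 0 or 16 with `α i`, so `|k| ≤ 2`. The reflection replaces
  -- `c i` by `c i - k` and leaves the other coefficients unchanged.
  obtain ⟨k, hk, hk2⟩ : ∃ k : ℤ, inner ℝ δ (α i) = 16 * (k : ℝ) ∧ k.natAbs ≤ 2 := by
    rw [hδ, inner_sub_left]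
    rcases h.inner_cases u u.2 i with h1 | h1 | h1 <;>
      rcases h.inner_cases w w.2 i with h2 | h2 | h2 <;> rw [h1, h2]
    exacts [⟨0, by norm_num⟩, ⟨-1, by norm_num⟩, ⟨-2, by norm_num⟩, ⟨1, by norm_num⟩,
      ⟨0, by norm_num⟩, ⟨-1, by norm_num⟩, ⟨2, by norm_num⟩, ⟨1, by norm_num⟩, ⟨0, by norm_num⟩]
  have hck : 0 < c i * k := by
    rw [hk] at hi
    have : (0 : ℝ) < ((c i * k : ℤ) : ℝ) := by push_cast; linarith
    exact_mod_cast this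
  let u' : Ω := ⟨_, h.rootReflection_mem u.2 i⟩
  let w' : Ω := ⟨_, h.rootReflection_mem w.2 i⟩
  obtain ⟨x', hx'⟩ := h.exists_rootReflection_ne_zero hρ i (w' := w') (u' := u') rfl rfl hx
  have hδ' : (u' : EuclideanSpace ℝ (Fin n)) - w' = rootReflection (α i) δ :=
    rootReflection_sub _ _ _
  have hc' : (u' : EuclideanSpace ℝ (Fin n)) - w' =
      ∑ j, ((c j - if j = i then k else 0 : ℤ) : ℝ) • α j := by
    rw [hδ', rootReflection, hk, hc]
    simp only [Int.cast_sub, sub_smul, Finset.sum_sub_distrib]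
    congr 1
    rw [Finset.sum_eq_single i (fun j _ hj => by simp [hj]) (by simp)]
    simp
  have hnorm : ‖(u' : EuclideanSpace ℝ (Fin n)) - w'‖ ^ 2 = ‖δ‖ ^ 2 := by
    rw [hδ', norm_rootReflection (h.inner_root_self i)]
  by_cases hlt : (c i - k).natAbs < (c i).natAbs
  · have hsum : ∑ j, (c j - if j = i then k else 0).natAbs < N := by
      rw [← hN]
      refine Finset.sum_lt_sum (fun j _ => ?_) ⟨i, Finset.mem_univ i, by simpa using hlt⟩
      split_ifs with hj
      · rw [hj]; exact hlt.le
      · simp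
    have := ih _ hsum hc' hx' rfl
    rw [hnorm] at this
    exact this.elim hne.1 hne.2
  -- If the reflection does not shrink `c i`, then `c i = ± 1` and `k = 2 c i`, so it changes the
  -- sign of `c i`.
  · have hci : (c i = 1 ∧ k = 2) ∨ (c i = -1 ∧ k = -2) := by
      have h3 : (0 < c i ∧ 0 < k) ∨ (c i < 0 ∧ k < 0) := by
        rcases mul_pos_iff.1 hck with h4 | h4
        exacts [.inl h4, .inr h4]
      omega
    -- Mixed signs are excluded before and after the reflection, and only the sign of `c i` has
    -- changed, so the other coefficients vanish and `δ = ± α i`.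
    have hz : ∀ j, j ≠ i → c j = 0 := by
      intro j hj
      have s1 := hsign _ _ _ hc _ hx
      have s2 := hsign _ _ _ hc' _ hx'
      rcases s1 with s1 | s1 <;> rcases s2 with s2 | s2 <;>
      · have a1 := s1 i
        have a2 := s2 i
        have a3 := s1 j
        have a4 := s2 j
        simp only [if_true, hj, if_false] at a2 a4
        omega
    have hδi : δ = (c i : ℝ) • α i := by
      rw [hc, Finset.sum_eq_single i (fun j _ hj => by simp [hz j hj]) (by simp)]
    apply hne.2
    rw [hδi, norm_smul, mul_pow, ← real_inner_self_eq_norm_sq (α i), h.inner_root_self, Real.norm_eq_abs,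
      sq_abs]
    rcases hci with ⟨h1, -⟩ | ⟨h1, -⟩ <;> rw [h1] <;> norm_num

end IsMinuscule

/-- If the differences of weights are integral combinations of the simple roots, then the weights
that occur in the image of a weight vector of weight `v` are `v` and weights at distance `√32`. -/
lemma IsMinuscule.eq_or_dist_eq {B : Type} [Fintype B] [DecidableEq B] {A : Matrix B B ℤ}
    {α : B → EuclideanSpace ℝ (Fin n)} (h : IsMinuscule A Ω α)
    {ω : B → EuclideanSpace ℝ (Fin n) →ₗ[ℝ] ℝ} (hω : ∀ k i, ω k (α i) = if k = i then 1 else 0)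
    (hΩ : ∀ w ∈ Ω, ∀ u ∈ Ω, ∃ c : B → ℤ, u - w = ∑ i, (c i : ℝ) • α i)
    {ρ : A.ToLieAlgebra ℂ →ₗ⁅ℂ⁆ Module.End ℂ (WeightSpace Ω)} (hρ : IsWeightRep A Ω α ρ)
    {x : A.ToLieAlgebra ℂ} {v u : Ω} (hx : ρ x (basisVec v) u ≠ 0) :
    u = v ∨ dist v u = √32 := by
  obtain ⟨c, hc⟩ := hΩ v v.2 u u.2
  refine (h.norm_sub_sq_of_ne_zero hρ hω hc hx).imp (fun h1 => ?_) fun h1 => ?_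
  · exact Subtype.ext (sub_eq_zero.1 (norm_eq_zero.1 (pow_eq_zero_iff two_ne_zero |>.1 h1)))
  · rw [Subtype.dist_eq, dist_comm, dist_eq_norm, ← h1, Real.sqrt_sq (norm_nonneg _)]

lemma mem_span_basisVec {s : Set Ω} {y : WeightSpace Ω} (hy : ∀ u, y u ≠ 0 → u ∈ s) :
    y ∈ Submodule.span ℂ (basisVec '' s) := by
  have : y ∈ Finsupp.supported ℂ ℂ s :=
    (Finsupp.mem_supported ℂ y).2 fun u hu => hy u (Finsupp.mem_support_iff.1 hu)
  rwa [Finsupp.supported_eq_span_single] at this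

end WeightRep


/-! ### The weights of the minuscule representations of `E₇` and `E₆` -/

section Concrete

/-- The vector of Euclidean space with the given integral coordinates. -/
def ofInt (z : Fin 8 → ℤ) : EuclideanSpace ℝ (Fin 8) := WithLp.toLp 2 fun k => (z k : ℝ)

lemma ofInt_apply (z : Fin 8 → ℤ) (k : Fin 8) : ofInt z k = z k := rfl

lemma ofInt_injective : Function.Injective ofInt := by
  intro y z h
  funext k
  have := congrArg (fun v : EuclideanSpace ℝ (Fin 8) => v k) h
  simpa only [ofInt_apply, Int.cast_inj] using this

lemma ofInt_add (y z : Fin 8 → ℤ) : ofInt (y + z) = ofInt y + ofInt z := by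
  ext k; simp [ofInt_apply]

lemma ofInt_sub (y z : Fin 8 → ℤ) : ofInt (y - z) = ofInt y - ofInt z := by
  ext k; simp [ofInt_apply]

lemma inner_ofInt (y z : Fin 8 → ℤ) : inner ℝ (ofInt y) (ofInt z) = ((y ⬝ᵥ z : ℤ) : ℝ) := by
  rw [PiLp.inner_apply, dotProduct, Int.cast_sum]
  refine Finset.sum_congr rfl fun k _ => ?_
  simp [ofInt_apply, mul_comm]

/-- The integral coordinates of `vertex i j`. -/
def vertexInt (i j : Fin 8) : Fin 8 → ℤ :=
  fun k => 4 * ((if k = i then 1 else 0) + (if k = j then 1 else 0)) - 1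

lemma ofInt_vertexInt (i j : Fin 8) : ofInt (vertexInt i j) = vertex i j := by
  ext k
  rw [ofInt_apply, vertex_apply, vertexInt]
  push_cast
  rfl

/-- The integral coordinates of the elements of `psiE7`. -/
def weightsInt : Finset (Fin 8 → ℤ) :=
  (Finset.univ.filter fun p : Fin 8 × Fin 8 => p.1 < p.2).image (fun p => vertexInt p.1 p.2) ∪
    (Finset.univ.filter fun p : Fin 8 × Fin 8 => p.1 < p.2).image (fun p => -vertexInt p.1 p.2)

lemma ofInt_neg (z : Fin 8 → ℤ) : ofInt (-z) = -ofInt z := by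
  ext k; simp [ofInt_apply]

lemma psiE7_eq : psiE7 = ofInt '' weightsInt := by
  ext v
  simp only [psiE7, Set.mem_ofPred_eq, weightsInt, Set.mem_image, Finset.mem_coe, Finset.mem_union,
    Finset.mem_image, Finset.mem_filter, Finset.mem_univ, true_and, Prod.exists]
  constructor
  · rintro ⟨i, j, hij, rfl | rfl⟩
    · exact ⟨_, .inl ⟨i, j, hij, rfl⟩, ofInt_vertexInt i j⟩
    · exact ⟨_, .inr ⟨i, j, hij, rfl⟩, by rw [ofInt_neg, ofInt_vertexInt]⟩
  · rintro ⟨_, ⟨i, j, hij, rfl⟩ | ⟨i, j, hij, rfl⟩, rfl⟩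
    · exact ⟨i, j, hij, .inl (ofInt_vertexInt i j)⟩
    · exact ⟨i, j, hij, .inr (by rw [ofInt_neg, ofInt_vertexInt])⟩

lemma ofInt_mem_psiE7 {z : Fin 8 → ℤ} : ofInt z ∈ psiE7 ↔ z ∈ weightsInt := by
  rw [psiE7_eq, ofInt_injective.mem_set_image, Finset.mem_coe]

/-- The integral coordinates of the simple roots. -/
def rootInt : Fin 7 → Fin 8 → ℤ :=
  ![![0, 4, -4, 0, 0, 0, 0, 0], ![-2, -2, -2, -2, 2, 2, 2, 2], ![0, 0, 4, -4, 0, 0, 0, 0],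
    ![0, 0, 0, 4, -4, 0, 0, 0], ![0, 0, 0, 0, 4, -4, 0, 0], ![0, 0, 0, 0, 0, 4, -4, 0],
    ![0, 0, 0, 0, 0, 0, 4, -4]]

/-- Four times the fundamental coweights, up to multiples of `(1, …, 1)`. -/
def coweightInt : Fin 7 → Fin 8 → ℤ :=
  ![![-1, 1, 0, 0, 0, 0, 0, 0], ![-2, 0, 0, 0, 0, 0, 0, 0], ![-2, 1, 1, 0, 0, 0, 0, 0],
    ![-3, 1, 1, 1, 0, 0, 0, 0], ![-2, 1, 1, 1, 1, 0, 0, 0], ![-1, 1, 1, 1, 1, 1, 0, 0],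
    ![0, 1, 1, 1, 1, 1, 1, 0]]

lemma ofInt_rootInt (i : Fin 7) : ofInt (rootInt i) = rootE7 i := by
  ext k
  rw [ofInt_apply]
  fin_cases i <;> fin_cases k <;>
    simp [rootInt, rootE7, chainRoot, lastRoot, Fin.ext_iff]

/-- In integral coordinates the conditions of `IsMinuscule` concern 56 weights and 7 roots and are
decided by enumeration. -/
lemma add_rootInt_mem : ∀ z ∈ weightsInt, ∀ i,
    z + rootInt i ∈ weightsInt ↔ z ⬝ᵥ rootInt i = -16 := by decide +kernel

lemma sub_rootInt_mem : ∀ z ∈ weightsInt, ∀ i,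
    z - rootInt i ∈ weightsInt ↔ z ⬝ᵥ rootInt i = 16 := by decide +kernel

lemma dotProduct_rootInt_cases : ∀ z ∈ weightsInt, ∀ i,
    z ⬝ᵥ rootInt i = -16 ∨ z ⬝ᵥ rootInt i = 0 ∨ z ⬝ᵥ rootInt i = 16 := by decide +kernel

lemma rootInt_dotProduct_rootInt : ∀ i j,
    rootInt i ⬝ᵥ rootInt j = 16 * CartanMatrix.E₇ i j := by decide +kernel

lemma coweightInt_dotProduct_rootInt : ∀ k i,
    coweightInt k ⬝ᵥ rootInt i = if k = i then 4 else 0 := by decide +kernel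

/-- The pairing with `coweightInt i` is four times the coefficient of the `i`-th simple root; the
enumeration confirms that the integer quotients by 4 are the coefficients. -/
lemma sub_vertexInt_eq_sum : ∀ z ∈ weightsInt, ∀ m, z m - vertexInt 0 7 m =
    ∑ i, (coweightInt i ⬝ᵥ (z - vertexInt 0 7) / 4) * rootInt i m := by decide +kernel

lemma card_weightsInt : weightsInt.card = 56 := by decide +kernel

lemma card_weightsInt_filter :
    (weightsInt.filter fun z => z ⬝ᵥ vertexInt 0 7 = 8).card = 27 ∧
      (weightsInt.filter fun z => z ⬝ᵥ vertexInt 0 7 = -8).card = 27 := by decide +kernel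

lemma finrank_weightSpace_ofInt (s : Finset (Fin 8 → ℤ)) :
    Module.finrank ℂ (WeightSpace (ofInt '' s)) = s.card := by
  rw [Module.finrank_eq_nat_card_basis (Finsupp.basisSingleOne (R := ℂ)), Nat.card_coe_set_eq,
    Set.ncard_image_of_injective _ ofInt_injective, Set.ncard_coe_finset]

theorem finrank_weightSpace_psiE7 : Module.finrank ℂ (WeightSpace psiE7) = 56 := by
  rw [psiE7_eq, finrank_weightSpace_ofInt, card_weightsInt]

lemma psiE6_eq (l : ℤ) :
    psiE6 l = ofInt '' (weightsInt.filter fun z => z ⬝ᵥ vertexInt 0 7 = l) := by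
  ext v
  rw [psiE6, Set.mem_ofPred_eq, psiE7_eq]
  constructor
  · rintro ⟨⟨z, hz, rfl⟩, hl⟩
    rw [← ofInt_vertexInt, inner_ofInt] at hl
    exact ⟨z, by simpa using ⟨hz, by exact_mod_cast hl⟩, rfl⟩
  · rintro ⟨z, hz, rfl⟩
    rw [Finset.mem_coe, Finset.mem_filter] at hz
    refine ⟨⟨z, hz.1, rfl⟩, ?_⟩
    rw [← ofInt_vertexInt, inner_ofInt, hz.2]

theorem finrank_weightSpace_psiE6 {s : ℝ} (hs : s = 1 ∨ s = -1) :
    Module.finrank ℂ (WeightSpace (psiE6 (8 * s))) = 27 := by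
  rcases hs with rfl | rfl
  · have : psiE6 (8 * 1) = psiE6 ((8 : ℤ) : ℝ) := by norm_num
    rw [this, psiE6_eq, finrank_weightSpace_ofInt, card_weightsInt_filter.1]
  · have : psiE6 (8 * -1) = psiE6 ((-8 : ℤ) : ℝ) := by norm_num
    rw [this, psiE6_eq, finrank_weightSpace_ofInt, card_weightsInt_filter.2]

theorem isMinuscule_psiE7 : IsMinuscule CartanMatrix.E₇ psiE7 rootE7 where
  add_mem v hv i := by
    obtain ⟨z, hz, rfl⟩ := psiE7_eq ▸ hv
    rw [← ofInt_rootInt, ← ofInt_add, ofInt_mem_psiE7, inner_ofInt]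
    exact (add_rootInt_mem z hz i).trans
      ⟨fun h => by rw [h]; norm_num, fun h => Int.cast_injective (α := ℝ) (by rw [h]; norm_num)⟩
  sub_mem v hv i := by
    obtain ⟨z, hz, rfl⟩ := psiE7_eq ▸ hv
    rw [← ofInt_rootInt, ← ofInt_sub, ofInt_mem_psiE7, inner_ofInt]
    exact (sub_rootInt_mem z hz i).trans
      ⟨fun h => by rw [h]; norm_num, fun h => Int.cast_injective (α := ℝ) (by rw [h]; norm_num)⟩
  inner_cases v hv i := by
    obtain ⟨z, hz, rfl⟩ := psiE7_eq ▸ hv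
    rw [← ofInt_rootInt, inner_ofInt]
    exact_mod_cast dotProduct_rootInt_cases z hz i
  inner_root i j := by
    rw [← ofInt_rootInt, ← ofInt_rootInt, inner_ofInt, rootInt_dotProduct_rootInt]
    push_cast
    rfl
  diag := by decide
  off_diag i j := by
    fin_cases i <;> fin_cases j <;> decide

/-- The fundamental coweights. -/
def coweight (k : Fin 7) : EuclideanSpace ℝ (Fin 8) →ₗ[ℝ] ℝ :=
  (4⁻¹ : ℝ) • (innerSL ℝ (ofInt (coweightInt k))).toLinearMap

lemma coweight_root (k i : Fin 7) : coweight k (rootE7 i) = if k = i then 1 else 0 := by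
  have h : coweight k (rootE7 i) = 4⁻¹ * inner ℝ (ofInt (coweightInt k)) (rootE7 i) := rfl
  rw [h, ← ofInt_rootInt, inner_ofInt, coweightInt_dotProduct_rootInt]
  split_ifs <;> norm_num

lemma exists_sub_eq_sum_rootE7 {w u : EuclideanSpace ℝ (Fin 8)} (hw : w ∈ psiE7) (hu : u ∈ psiE7) :
    ∃ c : Fin 7 → ℤ, u - w = ∑ i, (c i : ℝ) • rootE7 i := by
  have key : ∀ v ∈ psiE7, ∃ c : Fin 7 → ℤ, v - vertex 0 7 = ∑ i, (c i : ℝ) • rootE7 i := by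
    intro v hv
    obtain ⟨z, hz, rfl⟩ := psiE7_eq ▸ hv
    refine ⟨fun i => coweightInt i ⬝ᵥ (z - vertexInt 0 7) / 4, ?_⟩
    rw [← ofInt_vertexInt, ← ofInt_sub]
    ext m
    simp only [← ofInt_rootInt]
    rw [ofInt_apply, Pi.sub_apply, sub_vertexInt_eq_sum z hz m, Int.cast_sum]
    simp only [WithLp.ofLp_sum, Finset.sum_apply, WithLp.ofLp_smul, Pi.smul_apply, smul_eq_mul,
      ofInt_apply, Int.cast_mul]
  obtain ⟨c, hc⟩ := key w hw
  obtain ⟨d, hd⟩ := key u hu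
  refine ⟨d - c, ?_⟩
  rw [← sub_sub_sub_cancel_right u w (vertex 0 7), hc, hd, ← Finset.sum_sub_distrib]
  simp [sub_smul]

lemma rootE6_eq (i : Fin 6) : rootE6 i = rootE7 i.castSucc := by
  fin_cases i <;> rfl

lemma rootInt_dotProduct_vertexInt : ∀ i,
    rootInt i ⬝ᵥ vertexInt 0 7 = if i = Fin.last 6 then -16 else 0 := by decide +kernel

lemma inner_rootE7_vertex (i : Fin 7) :
    inner ℝ (rootE7 i) (vertex 0 7) = if i = Fin.last 6 then -16 else 0 := by
  rw [← ofInt_rootInt, ← ofInt_vertexInt, inner_ofInt, rootInt_dotProduct_vertexInt]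
  split_ifs <;> norm_num

lemma inner_rootE6_vertex (i : Fin 6) : inner ℝ (rootE6 i) (vertex 0 7) = 0 := by
  rw [rootE6_eq, inner_rootE7_vertex, if_neg (Fin.castSucc_lt_last i).ne]

lemma cartanMatrix_E₆_apply : ∀ i j : Fin 6,
    CartanMatrix.E₆ i j = CartanMatrix.E₇ i.castSucc j.castSucc := by
  intro i j
  fin_cases i <;> fin_cases j <;> rfl

/-- The roots of `E₆` are orthogonal to `v_{0,7}`, so steps along them stay in the slice and every
condition is inherited from `E₇`. -/
theorem isMinuscule_psiE6 (l : ℝ) : IsMinuscule CartanMatrix.E₆ (psiE6 l) rootE6 where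
  add_mem v hv i := by
    rw [psiE6, Set.mem_ofPred_eq, inner_add_left, inner_rootE6_vertex, add_zero,
      and_iff_left hv.2, rootE6_eq]
    exact isMinuscule_psiE7.add_mem v hv.1 _
  sub_mem v hv i := by
    rw [psiE6, Set.mem_ofPred_eq, inner_sub_left, inner_rootE6_vertex, sub_zero,
      and_iff_left hv.2, rootE6_eq]
    exact isMinuscule_psiE7.sub_mem v hv.1 _
  inner_cases v hv i := by
    rw [rootE6_eq]
    exact isMinuscule_psiE7.inner_cases v hv.1 _
  inner_root i j := by
    rw [rootE6_eq, rootE6_eq, cartanMatrix_E₆_apply]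
    exact isMinuscule_psiE7.inner_root _ _
  diag := by decide
  off_diag i j := by
    fin_cases i <;> fin_cases j <;> decide

/-- Among the simple roots of `E₇` only `α_6`, the last in the list, is not orthogonal to `v_{0,7}`;
its coefficient vanishes for a difference of two weights in one slice. -/
lemma exists_sub_eq_sum_rootE6 {l : ℝ} {w u : EuclideanSpace ℝ (Fin 8)} (hw : w ∈ psiE6 l)
    (hu : u ∈ psiE6 l) : ∃ c : Fin 6 → ℤ, u - w = ∑ i, (c i : ℝ) • rootE6 i := by
  obtain ⟨c, hc⟩ := exists_sub_eq_sum_rootE7 hw.1 hu.1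
  rw [Fin.sum_univ_castSucc] at hc
  simp only [← rootE6_eq] at hc
  have h0 : inner ℝ (u - w) (vertex 0 7) = 0 := by rw [inner_sub_left, hu.2, hw.2, sub_self]
  rw [hc, inner_add_left, sum_inner, real_inner_smul_left, inner_rootE7_vertex, if_pos rfl,
    Finset.sum_eq_zero fun i _ => by rw [real_inner_smul_left, inner_rootE6_vertex, mul_zero]] at h0
  have hlast : (c (Fin.last 6) : ℝ) = 0 := by linarith
  refine ⟨fun i => c i.castSucc, ?_⟩
  rw [hc, hlast, zero_smul, add_zero]

theorem eq_or_dist_eq_of_isWeightRep_E7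
    {ρ : LieAlgebra.e₇ ℂ →ₗ⁅ℂ⁆ Module.End ℂ (WeightSpace psiE7)}
    (hρ : IsWeightRep CartanMatrix.E₇ psiE7 rootE7 ρ) {x : LieAlgebra.e₇ ℂ} {v u : psiE7}
    (hx : ρ x (basisVec v) u ≠ 0) : u = v ∨ dist v u = √32 :=
  isMinuscule_psiE7.eq_or_dist_eq coweight_root
    (fun _ hw _ hu => exists_sub_eq_sum_rootE7 hw hu) hρ hx

theorem eq_or_dist_eq_of_isWeightRep_E6 {l : ℝ}
    {ρ : LieAlgebra.e₆ ℂ →ₗ⁅ℂ⁆ Module.End ℂ (WeightSpace (psiE6 l))}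
    (hρ : IsWeightRep CartanMatrix.E₆ (psiE6 l) rootE6 ρ) {x : LieAlgebra.e₆ ℂ} {v u : psiE6 l}
    (hx : ρ x (basisVec v) u ≠ 0) : u = v ∨ dist v u = √32 := by
  refine (isMinuscule_psiE6 l).eq_or_dist_eq (ω := fun k => coweight k.castSucc) (fun k i => ?_)
    (fun _ hw _ hu => exists_sub_eq_sum_rootE6 hw hu) hρ hx
  rw [rootE6_eq, coweight_root]
  simp only [Fin.castSucc_inj]

end Concrete

end

theorem proposition7p6 :
    -- the 56-dimensional module for `e₇` and the lines on del Pezzo surfaces of degree 2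
    (Module.finrank ℂ (WeightSpace psiE7) = 56 ∧
      (∃! ρ, IsWeightRep CartanMatrix.E₇ psiE7 rootE7 ρ) ∧
      (∀ ρ, IsWeightRep CartanMatrix.E₇ psiE7 rootE7 ρ →
        ∀ (x : LieAlgebra.e₇ ℂ) (v : psiE7),
          ρ x (basisVec v) ∈
            Submodule.span ℂ (basisVec '' {u : psiE7 | u = v ∨ dist v u = √32})) ∧
      ∀ P : Fin 7 → Plane, GeneralPosition P →
        ∃ line : psiE7 ≃ {L : Set (BlowUp P) // IsLine P L},
          (∀ v : psiE7, ∃ D, LineClass7 v D ∧ IsCurve P (line v) D) ∧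
          (∀ v u : psiE7, dist v u = √32 →
            Disjoint (line u : Set (BlowUp P)) (line v)) ∧
          ∀ ρ, IsWeightRep CartanMatrix.E₇ psiE7 rootE7 ρ →
            ∀ (x : LieAlgebra.e₇ ℂ) (v u : psiE7), ρ x (basisVec v) u ≠ 0 →
              u = v ∨ Disjoint (line u : Set (BlowUp P)) (line v)) ∧
    -- the two 27-dimensional modules for `e₆` and the lines on del Pezzo surfaces of degree 3
    ∀ s : ℝ, s = 1 ∨ s = -1 →
      (Module.finrank ℂ (WeightSpace (psiE6 (8 * s))) = 27 ∧
      (∃! ρ, IsWeightRep CartanMatrix.E₆ (psiE6 (8 * s)) rootE6 ρ) ∧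
      (∀ ρ, IsWeightRep CartanMatrix.E₆ (psiE6 (8 * s)) rootE6 ρ →
        ∀ (x : LieAlgebra.e₆ ℂ) (v : psiE6 (8 * s)),
          ρ x (basisVec v) ∈
            Submodule.span ℂ (basisVec '' {u : psiE6 (8 * s) | u = v ∨ dist v u = √32})) ∧
      ∀ P : Fin 6 → Plane, GeneralPosition P →
        ∃ line : psiE6 (8 * s) ≃ {L : Set (BlowUp P) // IsLine P L},
          (∀ v : psiE6 (8 * s), ∃ D, LineClass6 (s • (v : EuclideanSpace ℝ (Fin 8))) D ∧
            IsCurve P (line v) D) ∧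
          (∀ v u : psiE6 (8 * s), dist v u = √32 →
            Disjoint (line u : Set (BlowUp P)) (line v)) ∧
          ∀ ρ, IsWeightRep CartanMatrix.E₆ (psiE6 (8 * s)) rootE6 ρ →
            ∀ (x : LieAlgebra.e₆ ℂ) (v u : psiE6 (8 * s)), ρ x (basisVec v) u ≠ 0 →
              u = v ∨ Disjoint (line u : Set (BlowUp P)) (line v)) := by
  refine ⟨⟨finrank_weightSpace_psiE7, isMinuscule_psiE7.existsUnique_isWeightRep,
    fun ρ hρ x v => mem_span_basisVec fun u hu => eq_or_dist_eq_of_isWeightRep_E7 hρ hu,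
    fun P hP => ?_⟩, fun s hs => ⟨finrank_weightSpace_psiE6 hs,
    (isMinuscule_psiE6 _).existsUnique_isWeightRep,
    fun ρ hρ x v => mem_span_basisVec fun u hu => eq_or_dist_eq_of_isWeightRep_E6 hρ hu,
    fun P hP => ?_⟩⟩
  · obtain ⟨line, hclass, hskew⟩ := exists_line_equiv_psiE7 hP
    exact ⟨line, hclass, hskew, fun ρ hρ x v u hu =>
      (eq_or_dist_eq_of_isWeightRep_E7 hρ hu).imp_right (hskew v u)⟩
  · obtain ⟨line, hclass, hskew⟩ := exists_line_equiv_psiE6 hs hP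
    exact ⟨line, hclass, hskew, fun ρ hρ x v u hu =>
      (eq_or_dist_eq_of_isWeightRep_E6 hρ hu).imp_right (hskew v u)⟩
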